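/- Let $n\ge 2$. For $s\ge 1$, a bounded domain $G\subset\mathbb{R}^n$ is an $s$-John domain if there are a point $x_0\in G$ (an $s$-John center) and a constant $c>0$ such that every $x\in G$ can be joined to $x_0$ by a rectifiable curve $\gamma:[0,l]\to G$, parametrized by arc length, with $\gamma(0)=x$, $\gamma(l)=x_0$, $l\le c$ and $\operatorname{dist}(\gamma(t),\partial G)\ge t^s/c$ for all $t\in[0,l]$. The upper Minkowski dimension of $E\subset\mathbb{R}^n$ is $$\dim_{\mathcal M}(E)=\sup\Big\{\mu\ge 0 : \limsup_{r\to0+}\frac{|E+B^n(0,r)|}{r^{n-\mu}}=\infty\Big\}.$$ For $\delta,\tau\in(0,1)$ and $1\le p,q<\infty$, a bounded domain $G$ supports the fractional $(q,p)$-Poincaré inequality if there is a constant $c<\infty$ such that, for all $u\in L^p(G)$ with mean value $u_G$ over $G$, $$\int_G|u(x)-u_G|^q\,dx\le c\left(\int_G\int_{G\cap B^n(x,\tau\operatorname{dist}(x,\partial G))}\frac{|u(x)-u(y)|^p}{|x-y|^{n+\delta p}}\,dy\,dx\right)^{q/p}.\tag{1.1}$$ Let $G\subset\mathbb{R}^n$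 be a $1$-John domain with $1$-John center $x_0$. Let $W$ be a Whitney decomposition of $G$: a family of closed dyadic cubes with pairwise disjoint interiors and union $G$, such that $\operatorname{diam}(Q)\le\operatorname{dist}(Q,\partial G)\le 4\operatorname{diam}(Q)$ for every $Q\in W$. Let $Q_0\in W$ be a cube containing $x_0$, and let $W_k$ be the set of the cubes in $W$ of side length $2^{-k}$. Let $s>1$ be such that $$(\ell(Q)/8)^s\le \ell(Q)/32\qquad\text{for every }Q\in W,\tag{6.1}$$ where $\ell(Q)$ is the side length of $Q$. For $Q\in W$ with midpoint $(x_1,\dots,x_n)$ and side length $\ell=\ell(Q)$, define the room $R(Q)$, the $s$-passage $P_s(Q)$, the long $s$-passage $L_s(Q)$ and the $s$-apartment $A_s(Q)$ by $$R(Q)=\prod_{i=1}^n(x_i-\ell/8,\,x_i+\ell/8),$$ $$P_s(Q)=\prod_{i=1}^{n-1}\big(x_i-(\ell/8)^s,\,x_i+(\ell/8)^s\big)\times(x_n+\ell/8,\,x_n+\ell/4),$$ $$L_s(Q)=\prod_{i=1}^{n-1}\big(x_i-(\ell/8)^s,\,x_i+(\ell/8)^s\big)\times(x_n,\,x_n+\ell/2),$$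 $$A_s(Q)=L_s(Q)\cup\big(Q\setminus(\partial R(Q)\cup\partial P_s(Q))\big).$$ The $s$-version of $G$ is $$G_s=Q_0\cup\bigcup_{Q\in W,\,Q\ne Q_0}A_s(Q).$$ Suppose that $\lambda:=\dim_{\mathcal M}(\partial G)\in[n-1,n)$ and $\limsup_{k\to\infty}2^{-\lambda k}\cdot\#W_k>0$. Let $\delta,\tau\in(0,1)$ and $1\le q<p<\infty$ be such that $$\frac{(p-q)(\lambda-n)}{pq}+\frac{(s-1)(n-1)}{p}\ge 1-s(1-\delta).\tag{6.5}$$ Then $G_s$ is an $s$-John domain, $\dim_{\mathcal M}(\partial G_s)=\lambda$, and $G_s$ does not support the fractional $(q,p)$-Poincaré inequality (1.1) with these $\delta$ and $\tau$. -/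

import Mathlib

open Set Filter Topology MeasureTheory
open scoped NNReal ENNReal

noncomputable section

namespace FracPoincare

/-- The `μ`-dimensional Minkowski precontent `|E + B(0,r)| / r ^ (n - μ)` of `E ⊆ ℝⁿ`
(used for `r > 0`). -/
def minkowskiPrecontent {n : ℕ} (μ : ℝ) (E : Set (EuclideanSpace ℝ (Fin n))) (r : ℝ) : ℝ≥0∞ :=
  volume (Metric.thickening r E) / ENNReal.ofReal (r ^ ((n : ℝ) - μ))

/-- The upper Minkowski dimension: the supremum, in `[0,∞]`, of all `μ ≥ 0` such that
`limsup_{r → 0+}` of the `μ`-dimensional precontent is infinite. -/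
def upperMinkowskiDim {n : ℕ} (E : Set (EuclideanSpace ℝ (Fin n))) : ℝ≥0∞ :=
  ⨆ (μ : ℝ≥0) (_ : limsup (fun r : ℝ => minkowskiPrecontent (μ : ℝ) E r) (𝓝[>] 0) = ∞),
    (μ : ℝ≥0∞)

/-- `x₀` is an `s`-John center of `G`: with one constant `c`, every point of `G` is joined to `x₀`
in `G` by a rectifiable curve `γ : [0,l] → G`, parametrized by arc length (`HasUnitSpeedOn`),
of length `l ≤ c`, with `dist (γ t, ∂G) ≥ t ^ s / c`. -/
def IsJohnCenter {n : ℕ} (s : ℝ) (G : Set (EuclideanSpace ℝ (Fin n)))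
    (x₀ : EuclideanSpace ℝ (Fin n)) : Prop :=
  x₀ ∈ G ∧ ∃ c : ℝ, 0 < c ∧ ∀ x ∈ G, ∃ (l : ℝ) (γ : ℝ → EuclideanSpace ℝ (Fin n)),
    0 ≤ l ∧ l ≤ c ∧ ContinuousOn γ (Icc 0 l) ∧ HasUnitSpeedOn γ (Icc 0 l) ∧
    MapsTo γ (Icc 0 l) G ∧ γ 0 = x ∧ γ l = x₀ ∧
    ∀ t ∈ Icc (0 : ℝ) l, t ^ s / c ≤ Metric.infDist (γ t) (frontier G)

/-- A bounded domain of `ℝⁿ` that has an `s`-John center. -/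
structure IsJohnDomain {n : ℕ} (s : ℝ) (G : Set (EuclideanSpace ℝ (Fin n))) : Prop where
  isOpen : IsOpen G
  isConnected : IsConnected G
  isBounded : Bornology.IsBounded G
  exists_center : ∃ x₀, IsJohnCenter s G x₀

/-- The right-hand double integral of the fractional Poincaré inequality:
`∫_G ∫_{G ∩ B(x, τ dist(x,∂G))} |u x - u y| ^ p / |x - y| ^ (n + δ p) dy dx`. -/
def fractionalEnergy {n : ℕ} (p δ τ : ℝ) (G : Set (EuclideanSpace ℝ (Fin n)))
    (u : EuclideanSpace ℝ (Fin n) → ℝ) : ℝ≥0∞ :=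
  ∫⁻ x in G, ∫⁻ y in G ∩ Metric.ball x (τ * Metric.infDist x (frontier G)),
    ENNReal.ofReal (|u x - u y| ^ p / ‖x - y‖ ^ ((n : ℝ) + δ * p))

/-- `G` supports the fractional `(q,p)`-Poincaré inequality with parameters `δ, τ`: there is a
finite constant `c` that works for all `u ∈ L^p(G)`. Both sides are in `[0,∞]`. -/
def SupportsFractionalPoincare {n : ℕ} (q p δ τ : ℝ) (G : Set (EuclideanSpace ℝ (Fin n))) : Prop :=
  ∃ c : ℝ≥0, ∀ u : EuclideanSpace ℝ (Fin n) → ℝ,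
    MemLp u (ENNReal.ofReal p) (volume.restrict G) →
    ∫⁻ x in G, ENNReal.ofReal (|u x - ⨍ y in G, u y| ^ q) ≤
      (c : ℝ≥0∞) * fractionalEnergy p δ τ G u ^ (q / p)

/-- Index of the closed dyadic cube `∏ i, [2⁻ʲ mᵢ, 2⁻ʲ (mᵢ + 1)]`, with `j = gen`, `m = pos`. -/
structure DyadicCube (n : ℕ) where
  gen : ℤ
  pos : Fin n → ℤ

namespace DyadicCube

variable {n : ℕ}

/-- The side length `2⁻ʲ`. -/
def side (Q : DyadicCube n) : ℝ := (2 : ℝ) ^ (-Q.gen)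

/-- The closed cube itself. -/
def toSet (Q : DyadicCube n) : Set (EuclideanSpace ℝ (Fin n)) :=
  {x | ∀ i, (Q.pos i : ℝ) * Q.side ≤ x i ∧ x i ≤ ((Q.pos i : ℝ) + 1) * Q.side}

/-- The `i`-th coordinate of the midpoint. -/
def mid (Q : DyadicCube n) (i : Fin n) : ℝ := ((Q.pos i : ℝ) + 1 / 2) * Q.side

/-- The room: the open concentric cube of side length `ℓ(Q) / 4`. -/
def room (Q : DyadicCube n) : Set (EuclideanSpace ℝ (Fin n)) :=
  {x | ∀ i, |x i - Q.mid i| < Q.side / 8}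

/-- The open box whose sides in the first `n - 1` coordinates are centered at the midpoint of `Q`
and have half-length `(ℓ(Q) / 8) ^ s`, and whose last coordinate runs through
`(xₙ + a, xₙ + b)`, where `xₙ` is the last coordinate of the midpoint. -/
def corridor (s a b : ℝ) (Q : DyadicCube n) : Set (EuclideanSpace ℝ (Fin n)) :=
  {x | ∀ i : Fin n,
    ((i : ℕ) + 1 < n → |x i - Q.mid i| < (Q.side / 8) ^ s) ∧
    ((i : ℕ) + 1 = n → Q.mid i + a < x i ∧ x i < Q.mid i + b)}

/-- The `s`-passage. -/
def passage (s : ℝ) (Q : DyadicCube n) : Set (EuclideanSpace ℝ (Fin n)) :=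
  Q.corridor s (Q.side / 8) (Q.side / 4)

/-- The long `s`-passage. -/
def longPassage (s : ℝ) (Q : DyadicCube n) : Set (EuclideanSpace ℝ (Fin n)) :=
  Q.corridor s 0 (Q.side / 2)

/-- The `s`-apartment: the walls of the room and of the passage are removed from `Q`, except
for the two openings that lie in the long passage. -/
def apartment (s : ℝ) (Q : DyadicCube n) : Set (EuclideanSpace ℝ (Fin n)) :=
  Q.longPassage s ∪ (Q.toSet \ (frontier Q.room ∪ frontier (Q.passage s)))

end DyadicCube

/-- `W` is a Whitney decomposition of `G` into closed dyadic cubes: the cubes cover exactly `G`,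
have disjoint interiors, and satisfy `diam Q ≤ dist(Q, ∂G) ≤ 4 diam Q`. -/
structure IsWhitneyDecomposition {n : ℕ} (G : Set (EuclideanSpace ℝ (Fin n)))
    (W : Set (DyadicCube n)) : Prop where
  iUnion_eq : ⋃ Q ∈ W, Q.toSet = G
  disjoint_interior :
    W.Pairwise fun Q Q' => Disjoint (interior Q.toSet) (interior Q'.toSet)
  diam_le : ∀ Q ∈ W, ∀ x ∈ Q.toSet, Metric.diam Q.toSet ≤ Metric.infDist x (frontier G)
  le_diam : ∀ Q ∈ W, ∃ x ∈ Q.toSet, Metric.infDist x (frontier G) ≤ 4 * Metric.diam Q.toSet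

/-- The cubes of `W` of side length `2⁻ᵏ`. -/
def cubesOfGen {n : ℕ} (W : Set (DyadicCube n)) (k : ℤ) : Set (DyadicCube n) :=
  {Q ∈ W | Q.gen = k}

/-- The `s`-version of the domain with Whitney decomposition `W`: every cube of `W` but the
central cube `Q₀` is replaced by its `s`-apartment. -/
def sVersion {n : ℕ} (s : ℝ) (W : Set (DyadicCube n)) (Q₀ : DyadicCube n) :
    Set (EuclideanSpace ℝ (Fin n)) :=
  Q₀.toSet ∪ ⋃ Q ∈ W \ {Q₀}, Q.apartment s

end FracPoincare

end

/-! Topology. A cube Q ≠ Q₀ loses only a closed set of walls well inside it. The s-version is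
therefore G minus a family of walls that is locally finite in G (`side_le_of_mem_walls`), and its
boundary lies in the union of ∂G and these walls.

John condition. In an apartment of side ℓ the only bottleneck is the passage, of width comparable to
ℓ^s. It is crossed within a time of order ℓ, which is just what an s-John curve may do
(`exists_path_to_boundary`). From the boundary of the cube on, the 1-John curve of G is imitated:
its piece up to the last exit from a cube is replaced by a detour near the boundary of that cube, of
length comparable to the chord and at distance at least ℓ/8 from the walls (`exists_unitPath_shell`,
`exists_path_along`).

Dimension. For ρ ≥ r the r-neighbourhood of the walls in the cubes of side ρ has at most a constant
times r/ρ of their volume, and these cubes lie within 6nρ of ∂G. If the μ-precontent of ∂G has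
finite limsup and μ > n - 1, the resulting terms r ρ^(n-1-μ) over dyadic ρ ≥ r form a geometric
series of order r^(n-μ). Walls in smaller cubes are within a multiple of r of ∂G
(`limsup_minkowskiPrecontent_frontier_ne_top`).

Failure of the inequality. The test function is a sum of a_Q times a bump that is 1 in the room of Q
and falls linearly to 0 along the passage. With w = (ℓ/8)^s, only points within a multiple of w of
the passage contribute to the energy, and one bump costs at most a constant times ℓ^(1-p)
w^(n-1+p(1-δ)) (`exists_fractionalEnergy_le`). Whatever the mean value is, the function differs from
it by at least a_Q/2 on the room or on an equally large cube below it (`le_lintegral_sum_bump`). In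
a generation of N cubes take a_Q = (N ℓ^n)^(-1/q). The left side then gains a fixed amount per
generation. If N is at least a multiple of ℓ^(-λ), as happens in infinitely many generations, the
assumed relation between the exponents bounds the energy per generation (`generation_energy_le`).
With K such generations the inequality would bound K by a multiple of K^(q/p), which fails for large
K because q < p. -/

namespace FracPoincare

/-! ### Boxes in coordinates and the walls of one apartment -/

section BoxesAndWalls

variable {n : ℕ}

section Coordinates

theorem abs_sub_le_dist (x y : EuclideanSpace ℝ (Fin n)) (i : Fin n) : |x i - y i| ≤ dist x y := by
  rw [dist_eq_norm, ← Real.norm_eq_abs]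
  exact PiLp.norm_apply_le (x - y) i

theorem dist_le_of_abs_sub_le {x y : EuclideanSpace ℝ (Fin n)} {M : ℝ} (hM : 0 ≤ M)
    (h : ∀ i, |x i - y i| ≤ M) : dist x y ≤ n * M := by
  rcases Nat.eq_zero_or_pos n with rfl | hn
  · simp [Subsingleton.elim x y]
  have hn1 : (1 : ℝ) ≤ n := by exact_mod_cast hn
  rw [EuclideanSpace.dist_eq]
  apply Real.sqrt_le_iff.2
  refine ⟨by positivity, ?_⟩
  calc ∑ i, dist (x i) (y i) ^ 2 ≤ ∑ _i : Fin n, M ^ 2 := by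
        refine Finset.sum_le_sum fun i _ => ?_
        rw [Real.dist_eq]
        exact pow_le_pow_left₀ (abs_nonneg _) (h i) 2
    _ = n * M ^ 2 := by simp
    _ ≤ (n * M) ^ 2 := by
        rw [mul_pow]
        exact mul_le_mul_of_nonneg_right (by nlinarith) (sq_nonneg M)

/-- The open box with opposite corners `a` and `b`. -/
def openBox (a b : Fin n → ℝ) : Set (EuclideanSpace ℝ (Fin n)) := {x | ∀ i, a i < x i ∧ x i < b i}

/-- The closed box with opposite corners `a` and `b`. -/
def closedBox (a b : Fin n → ℝ) : Set (EuclideanSpace ℝ (Fin n)) :=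
  {x | ∀ i, a i ≤ x i ∧ x i ≤ b i}

theorem openBox_eq_preimage (a b : Fin n → ℝ) :
    openBox a b = (EuclideanSpace.equiv (Fin n) ℝ).toHomeomorph ⁻¹'
      (Set.pi univ fun i => Ioo (a i) (b i)) := by
  ext x; simp [openBox]

theorem closedBox_eq_preimage (a b : Fin n → ℝ) :
    closedBox a b = (EuclideanSpace.equiv (Fin n) ℝ).toHomeomorph ⁻¹'
      (Set.pi univ fun i => Icc (a i) (b i)) := by
  ext x; simp [closedBox, -Set.pi_univ_Icc]

theorem isOpen_openBox (a b : Fin n → ℝ) : IsOpen (openBox a b) := by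
  rw [openBox_eq_preimage]
  exact (isOpen_set_pi finite_univ fun i _ => isOpen_Ioo).preimage (Homeomorph.continuous _)

theorem isClosed_closedBox (a b : Fin n → ℝ) : IsClosed (closedBox a b) := by
  rw [closedBox_eq_preimage]
  exact (isClosed_set_pi fun i _ => isClosed_Icc).preimage (Homeomorph.continuous _)

theorem closure_openBox {a b : Fin n → ℝ} (h : ∀ i, a i < b i) :
    closure (openBox a b) = closedBox a b := by
  rw [openBox_eq_preimage, closedBox_eq_preimage, ← Homeomorph.preimage_closure, closure_pi_set]
  congr 1
  exact Set.pi_congr rfl fun i _ => closure_Ioo (h i).ne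

theorem interior_closedBox (a b : Fin n → ℝ) : interior (closedBox a b) = openBox a b := by
  rw [openBox_eq_preimage, closedBox_eq_preimage, ← Homeomorph.preimage_interior,
    interior_pi_set finite_univ]
  simp only [interior_Icc]

theorem frontier_openBox {a b : Fin n → ℝ} (h : ∀ i, a i < b i) :
    frontier (openBox a b) = closedBox a b \ openBox a b := by
  rw [(isOpen_openBox a b).frontier_eq, closure_openBox h]

theorem convex_closedBox (a b : Fin n → ℝ) : Convex ℝ (closedBox a b) := by
  intro x hx y hy s t hs ht hst i
  have h1 := hx i
  have h2 := hy i
  simp only [PiLp.add_apply, PiLp.smul_apply, smul_eq_mul]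
  exact (convex_Icc (a i) (b i)) h1 h2 hs ht hst

theorem volume_closedBox (a b : Fin n → ℝ) :
    volume (closedBox a b) = ∏ i, ENNReal.ofReal (b i - a i) := by
  have h := (PiLp.volume_preserving_ofLp (Fin n)).measure_preimage
    (s := Set.pi univ fun i => Icc (a i) (b i))
    (MeasurableSet.univ_pi fun i => measurableSet_Icc).nullMeasurableSet
  rw [volume_pi_pi] at h
  simp only [Real.volume_Icc] at h
  rw [← h]
  congr 1
  ext x; simp [closedBox, -Set.pi_univ_Icc]

theorem volume_openBox (a b : Fin n → ℝ) :
    volume (openBox a b) = ∏ i, ENNReal.ofReal (b i - a i) := by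
  have h := (PiLp.volume_preserving_ofLp (Fin n)).measure_preimage
    (s := Set.pi univ fun i => Ioo (a i) (b i))
    (MeasurableSet.univ_pi fun i => measurableSet_Ioo).nullMeasurableSet
  rw [volume_pi_pi] at h
  simp only [Real.volume_Ioo] at h
  rw [← h]
  congr 1
  ext x; simp [openBox]

end Coordinates

theorem exists_mem_frontier_of_segment {E : Type*} [NormedAddCommGroup E] [NormedSpace ℝ E]
    {S : Set E} {z v : E} (hz : z ∈ S) (hv : v ∉ S) : ∃ y ∈ segment ℝ z v, y ∈ frontier S := by
  have hc : IsPreconnected (segment ℝ z v) := (convex_segment z v).isPreconnected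
  by_contra! h
  have hcov : segment ℝ z v ⊆ interior S ∪ (closure S)ᶜ := fun y hy => by
    by_contra hy'
    simp only [mem_union, mem_compl_iff, not_or, not_not] at hy'
    exact h y hy ⟨hy'.2, hy'.1⟩
  have hz' : z ∈ interior S := (hcov (left_mem_segment ℝ z v)).resolve_right
    fun h' => h' (subset_closure hz)
  have hv' : v ∈ (closure S)ᶜ := (hcov (right_mem_segment ℝ z v)).resolve_left
    fun h' => hv (interior_subset h')
  obtain ⟨y, -, hy1, hy2⟩ := hc _ _ isOpen_interior isClosed_closure.isOpen_compl hcov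
    ⟨z, left_mem_segment ℝ z v, hz'⟩ ⟨v, right_mem_segment ℝ z v, hv'⟩
  exact hy2 (subset_closure (interior_subset hy1))

/-- A point outside `S` is at least as far from a point of `S` as the boundary is. -/
theorem infDist_frontier_le {E : Type*} [NormedAddCommGroup E] [NormedSpace ℝ E] {S : Set E}
    {z v : E} (hz : z ∈ S) (hv : v ∉ S) : Metric.infDist z (frontier S) ≤ dist z v := by
  obtain ⟨y, hy, hyS⟩ := exists_mem_frontier_of_segment hz hv
  refine (Metric.infDist_le_dist_of_mem hyS).trans ?_
  linarith [dist_add_dist_of_mem_segment hy, dist_nonneg (x := y) (y := v)]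

namespace DyadicCube

variable (Q : DyadicCube n) (s : ℝ)

theorem side_pos : 0 < Q.side := zpow_pos two_pos _

theorem toSet_eq_closedBox :
    Q.toSet = closedBox (fun i => Q.mid i - Q.side / 2) (fun i => Q.mid i + Q.side / 2) := by
  ext x
  simp only [toSet, closedBox, mid, mem_ofPred_eq]
  refine forall_congr' fun i => ?_
  constructor <;> rintro ⟨h1, h2⟩ <;> constructor <;> linarith

theorem mem_toSet_iff {x : EuclideanSpace ℝ (Fin n)} :
    x ∈ Q.toSet ↔ ∀ i, |x i - Q.mid i| ≤ Q.side / 2 := by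
  rw [toSet_eq_closedBox]
  refine forall_congr' fun i => ?_
  rw [abs_le]
  constructor <;> rintro ⟨h1, h2⟩ <;> constructor <;> linarith

theorem mem_interior_iff {x : EuclideanSpace ℝ (Fin n)} :
    x ∈ interior Q.toSet ↔ ∀ i, |x i - Q.mid i| < Q.side / 2 := by
  rw [toSet_eq_closedBox, interior_closedBox]
  refine forall_congr' fun i => ?_
  rw [abs_lt]
  constructor <;> rintro ⟨h1, h2⟩ <;> constructor <;> linarith

theorem convex_toSet : Convex ℝ Q.toSet := by
  rw [toSet_eq_closedBox]; exact convex_closedBox _ _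

theorem isClosed_toSet : IsClosed Q.toSet := by
  rw [toSet_eq_closedBox]; exact isClosed_closedBox _ _

theorem closure_interior_toSet : closure (interior Q.toSet) = Q.toSet := by
  rw [toSet_eq_closedBox, interior_closedBox, closure_openBox]
  intro i
  linarith [Q.side_pos]

theorem volume_interior_toSet : volume (interior Q.toSet) = ENNReal.ofReal Q.side ^ n := by
  rw [toSet_eq_closedBox, interior_closedBox, volume_openBox]
  simp

theorem dist_le_of_mem {x y : EuclideanSpace ℝ (Fin n)} (hx : x ∈ Q.toSet) (hy : y ∈ Q.toSet) :
    dist x y ≤ n * Q.side := by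
  refine dist_le_of_abs_sub_le Q.side_pos.le fun i => ?_
  have h1 := abs_le.1 (Q.mem_toSet_iff.1 hx i)
  have h2 := abs_le.1 (Q.mem_toSet_iff.1 hy i)
  rw [abs_le]
  constructor <;> linarith

theorem isBounded_toSet : Bornology.IsBounded Q.toSet :=
  Metric.isBounded_iff.2 ⟨_, fun _ hx _ hy => Q.dist_le_of_mem hx hy⟩

theorem diam_le : Metric.diam Q.toSet ≤ n * Q.side :=
  Metric.diam_le_of_forall_dist_le (mul_nonneg n.cast_nonneg Q.side_pos.le)
    fun _ hx _ hy => Q.dist_le_of_mem hx hy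

theorem dist_le_diam {x y : EuclideanSpace ℝ (Fin n)} (hx : x ∈ Q.toSet) (hy : y ∈ Q.toSet) :
    dist x y ≤ Metric.diam Q.toSet :=
  Metric.dist_le_diam_of_mem Q.isBounded_toSet hx hy

/-- The midpoint of a cube. -/
noncomputable def center : EuclideanSpace ℝ (Fin n) := WithLp.toLp 2 Q.mid

@[simp] theorem center_apply (i : Fin n) : Q.center i = Q.mid i := rfl

theorem center_mem : Q.center ∈ Q.toSet := Q.mem_toSet_iff.2 fun i => by
  simp [(half_pos Q.side_pos).le]

theorem side_le_diam (hn : 0 < n) : Q.side ≤ Metric.diam Q.toSet := by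
  let x : EuclideanSpace ℝ (Fin n) := WithLp.toLp 2 fun i => Q.mid i - Q.side / 2
  let y : EuclideanSpace ℝ (Fin n) := WithLp.toLp 2 fun i => Q.mid i + Q.side / 2
  have hl := Q.side_pos
  have hx : x ∈ Q.toSet := Q.mem_toSet_iff.2 fun i => by
    simp [x, abs_of_pos (half_pos hl)]
  have hy : y ∈ Q.toSet := Q.mem_toSet_iff.2 fun i => by
    simp [y, abs_of_pos (half_pos hl)]
  refine le_trans ?_ (Q.dist_le_diam hx hy)
  refine le_trans ?_ (abs_sub_le_dist x y ⟨0, hn⟩)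
  rw [abs_sub_comm]
  refine le_trans (le_of_eq ?_) (le_abs_self _)
  simp [x, y]

theorem room_eq_openBox :
    Q.room = openBox (fun i => Q.mid i - Q.side / 8) (fun i => Q.mid i + Q.side / 8) := by
  ext x
  refine forall_congr' fun i => ?_
  rw [abs_lt]
  constructor <;> rintro ⟨h1, h2⟩ <;> constructor <;> linarith

theorem corridor_eq_openBox (a b : ℝ) :
    Q.corridor s a b = openBox
      (fun i => if (i : ℕ) + 1 = n then Q.mid i + a else Q.mid i - (Q.side / 8) ^ s)
      (fun i => if (i : ℕ) + 1 = n then Q.mid i + b else Q.mid i + (Q.side / 8) ^ s) := by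
  ext x
  refine forall_congr' fun i => ?_
  by_cases h : (i : ℕ) + 1 = n
  · simp [h]
  · have h' : (i : ℕ) + 1 < n := by omega
    simp only [h, h', if_false, true_implies, abs_lt, false_implies, and_true]
    constructor <;> rintro ⟨h1, h2⟩ <;> constructor <;> linarith

theorem width_pos : 0 < (Q.side / 8) ^ s := Real.rpow_pos_of_pos (by linarith [Q.side_pos]) _

theorem isOpen_room : IsOpen Q.room := by
  rw [room_eq_openBox]; exact isOpen_openBox _ _

theorem isOpen_corridor (a b : ℝ) : IsOpen (Q.corridor s a b) := by
  rw [corridor_eq_openBox]; exact isOpen_openBox _ _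

theorem mem_closure_room_iff {x : EuclideanSpace ℝ (Fin n)} :
    x ∈ closure Q.room ↔ ∀ i, |x i - Q.mid i| ≤ Q.side / 8 := by
  rw [room_eq_openBox, closure_openBox (fun i => by linarith [Q.side_pos])]
  refine forall_congr' fun i => ?_
  rw [abs_le]
  constructor <;> rintro ⟨h1, h2⟩ <;> constructor <;> linarith

theorem mem_closure_corridor_iff {a b : ℝ} (hab : a < b) {x : EuclideanSpace ℝ (Fin n)} :
    x ∈ closure (Q.corridor s a b) ↔ ∀ i : Fin n,
      ((i : ℕ) + 1 < n → |x i - Q.mid i| ≤ (Q.side / 8) ^ s) ∧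
      ((i : ℕ) + 1 = n → Q.mid i + a ≤ x i ∧ x i ≤ Q.mid i + b) := by
  rw [corridor_eq_openBox, closure_openBox]
  · refine forall_congr' fun i => ?_
    by_cases h : (i : ℕ) + 1 = n
    · simp [h]
    · have h' : (i : ℕ) + 1 < n := by omega
      simp only [h, h', if_false, true_implies, abs_le, false_implies, and_true]
      constructor <;> rintro ⟨h1, h2⟩ <;> constructor <;> linarith
  · intro i
    have := Q.width_pos s
    split_ifs <;> linarith

/-- The part of the walls of the room and of the passage that is removed from the cube. -/
def walls : Set (EuclideanSpace ℝ (Fin n)) :=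
  (frontier Q.room ∪ frontier (Q.passage s)) \ Q.longPassage s

variable {Q s}

theorem mem_closure_of_mem_walls {v : EuclideanSpace ℝ (Fin n)} (hv : v ∈ Q.walls s) :
    v ∈ closure Q.room ∨ v ∈ closure (Q.passage s) :=
  hv.1.imp (fun h => h.1) (fun h => h.1)

theorem abs_sub_mid_le_of_mem_walls (hw : (Q.side / 8) ^ s ≤ Q.side / 32)
    {v : EuclideanSpace ℝ (Fin n)} (hv : v ∈ Q.walls s) (i : Fin n) :
    |v i - Q.mid i| ≤ Q.side / 4 := by
  have hl := Q.side_pos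
  rcases mem_closure_of_mem_walls hv with h | h
  · linarith [Q.mem_closure_room_iff.1 h i]
  · have h := (Q.mem_closure_corridor_iff s (by linarith)).1 h i
    rcases (show (i : ℕ) + 1 < n ∨ (i : ℕ) + 1 = n by omega) with hi | hi
    · linarith [h.1 hi]
    · have := h.2 hi
      rw [abs_le]
      constructor <;> linarith

theorem walls_subset_interior (hw : (Q.side / 8) ^ s ≤ Q.side / 32) :
    Q.walls s ⊆ interior Q.toSet := fun v hv => Q.mem_interior_iff.2 fun i => by
  linarith [abs_sub_mid_le_of_mem_walls hw hv i, Q.side_pos]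

/-- A wall point is either beyond the width of the passage in one of the first coordinates, or
on the bottom of the room. -/
theorem lateral_or_bottom_of_mem_walls (hw : (Q.side / 8) ^ s ≤ Q.side / 32)
    {v : EuclideanSpace ℝ (Fin n)} (hv : v ∈ Q.walls s) :
    (∃ i : Fin n, (i : ℕ) + 1 < n ∧ (Q.side / 8) ^ s ≤ |v i - Q.mid i|) ∨
      ∃ i : Fin n, (i : ℕ) + 1 = n ∧ v i ≤ Q.mid i - Q.side / 8 := by
  have hl := Q.side_pos
  by_contra! hcon
  obtain ⟨h1, h2⟩ := hcon
  -- A laterally narrow point above the midpoint would lie in the long passage, which contains no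
  -- wall point. What remains is the lower half of the open room, which the walls avoid too.
  have h3 : ∀ i : Fin n, (i : ℕ) + 1 = n → v i ≤ Q.mid i := by
    by_contra! h3
    obtain ⟨j, hj, hjv⟩ := h3
    refine hv.2 fun i => ⟨h1 i, fun hi => ?_⟩
    obtain rfl : i = j := Fin.ext (by omega)
    have := abs_le.1 (abs_sub_mid_le_of_mem_walls hw hv i)
    constructor <;> linarith
  rcases hv.1 with h | h
  · rw [Q.isOpen_room.frontier_eq] at h
    refine h.2 fun i => ?_
    rcases (show (i : ℕ) + 1 < n ∨ (i : ℕ) + 1 = n by omega) with hi | hi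
    · linarith [h1 i hi]
    · rw [abs_lt]
      constructor <;> linarith [h2 i hi, h3 i hi]
  · have h := (Q.mem_closure_corridor_iff s (by linarith)).1 h.1
    rcases Nat.eq_zero_or_pos n with rfl | hn
    · exact hv.2 fun i => i.elim0
    · have := (h ⟨n - 1, by omega⟩).2 (by simp; omega)
      have := h3 ⟨n - 1, by omega⟩ (by simp; omega)
      linarith

/-- The passage starts at height ℓ/8 above the midpoint, where the room ends, so neither frontier
enters the open room. -/
theorem exists_side_le_of_mem_walls (hw : (Q.side / 8) ^ s ≤ Q.side / 32)
    {v : EuclideanSpace ℝ (Fin n)} (hv : v ∈ Q.walls s) :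
    ∃ i, Q.side / 8 ≤ |v i - Q.mid i| := by
  have hl := Q.side_pos
  by_contra! h
  rcases hv.1 with h' | h'
  · rw [Q.isOpen_room.frontier_eq] at h'
    exact h'.2 h
  · have h'' := (Q.mem_closure_corridor_iff s (by linarith)).1 h'.1
    -- In dimension zero every corridor is the whole space, so there are no walls.
    rcases Nat.eq_zero_or_pos n with rfl | hn
    · exact hv.2 fun i => i.elim0
    · have h3 := (h'' ⟨n - 1, by omega⟩).2 (by simp; omega)
      have h4 := abs_lt.1 (h ⟨n - 1, by omega⟩)
      linarith

theorem longPassage_subset (hw : (Q.side / 8) ^ s ≤ Q.side / 32) :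
    Q.longPassage s ⊆ interior Q.toSet := fun v hv => Q.mem_interior_iff.2 fun i => by
  have hl := Q.side_pos
  rcases (show (i : ℕ) + 1 < n ∨ (i : ℕ) + 1 = n by omega) with hi | hi
  · linarith [(hv i).1 hi]
  · have := (hv i).2 hi
    rw [abs_lt]
    constructor <;> linarith

/-- The long passage lies in the cube, so restoring it amounts to removing fewer walls. In this form
an apartment is a closed cube minus a closed set. -/
theorem mem_apartment_iff (hw : (Q.side / 8) ^ s ≤ Q.side / 32)
    {x : EuclideanSpace ℝ (Fin n)} : x ∈ Q.apartment s ↔ x ∈ Q.toSet ∧ x ∉ Q.walls s := by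
  simp only [apartment, walls, mem_union, Set.mem_sdiff]
  constructor
  · rintro (h | h)
    · exact ⟨interior_subset (longPassage_subset hw h), fun h' => h'.2 h⟩
    · exact ⟨h.1, fun h' => h.2 h'.1⟩
  · rintro ⟨h, h'⟩
    by_cases hL : x ∈ Q.longPassage s
    · exact Or.inl hL
    · exact Or.inr ⟨h, fun h'' => h' ⟨h'', hL⟩⟩

theorem isClosed_walls : IsClosed (Q.walls s) :=
  (isClosed_frontier.union isClosed_frontier).sdiff (Q.isOpen_corridor s _ _)

end DyadicCube

end BoxesAndWalls

/-! ### The s-version as an open set, and its boundary -/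

section Setting

variable {n : ℕ} {s : ℝ} {G : Set (EuclideanSpace ℝ (Fin n))} {W : Set (DyadicCube n)}
  {Q₀ : DyadicCube n}

/-- A bounded open set with a Whitney decomposition and a central cube, for which the passages
of the `s`-apartments are narrow compared to the rooms. -/
structure IsApartmentSetting (s : ℝ) (G : Set (EuclideanSpace ℝ (Fin n))) (W : Set (DyadicCube n))
    (Q₀ : DyadicCube n) : Prop where
  two_le : 2 ≤ n
  isOpen : IsOpen G
  isBounded : Bornology.IsBounded G
  whitney : IsWhitneyDecomposition G W
  mem_central : Q₀ ∈ W
  one_lt : 1 < s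
  width_le : ∀ Q ∈ W, (Q.side / 8) ^ s ≤ Q.side / 32

theorem le_infDist_of_forall_dist {E : Type*} [PseudoMetricSpace E] {S : Set E} (hS : S.Nonempty)
    {z : E} {b : ℝ} (h : ∀ v ∈ S, b ≤ dist z v) : b ≤ Metric.infDist z S :=
  (Metric.le_infDist hS).2 fun {_} hv => h _ hv

namespace IsApartmentSetting

variable (h : IsApartmentSetting s G W Q₀)
include h

theorem n_pos : 0 < n := by have := h.two_le; omega

theorem one_le_n : (1 : ℝ) ≤ n := by exact_mod_cast h.n_pos

theorem subset {Q : DyadicCube n} (hQ : Q ∈ W) : Q.toSet ⊆ G := by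
  rw [← h.whitney.iUnion_eq]
  exact subset_biUnion_of_mem (u := fun Q : DyadicCube n => Q.toSet) hQ

theorem exists_mem {z : EuclideanSpace ℝ (Fin n)} (hz : z ∈ G) : ∃ Q ∈ W, z ∈ Q.toSet := by
  rw [← h.whitney.iUnion_eq] at hz
  simpa using hz

theorem ne_univ : G ≠ univ := by
  intro hG
  have : Nonempty (Fin n) := ⟨⟨0, h.n_pos⟩⟩
  have hb := h.isBounded
  rw [hG] at hb
  exact NormedSpace.unbounded_univ ℝ (EuclideanSpace ℝ (Fin n)) hb

theorem frontier_nonempty : (frontier G).Nonempty :=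
  nonempty_frontier_iff.2 ⟨⟨_, h.subset h.mem_central Q₀.center_mem⟩, h.ne_univ⟩

/-- A closed cube is the closure of its interior, so meeting an open interior forces the two
interiors to meet. -/
theorem eq_of_mem_interior {Q Q' : DyadicCube n} (hQ : Q ∈ W) (hQ' : Q' ∈ W)
    {z : EuclideanSpace ℝ (Fin n)} (hz : z ∈ interior Q.toSet) (hz' : z ∈ Q'.toSet) : Q = Q' := by
  by_contra hne
  rw [← Q'.closure_interior_toSet] at hz'
  obtain ⟨y, hy, hy'⟩ := mem_closure_iff.1 hz' _ isOpen_interior hz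
  exact Set.disjoint_left.1 (h.whitney.disjoint_interior hQ hQ' hne) hy hy'

theorem side_le_infDist {Q : DyadicCube n} (hQ : Q ∈ W) {z : EuclideanSpace ℝ (Fin n)}
    (hz : z ∈ Q.toSet) : Q.side ≤ Metric.infDist z (frontier G) :=
  (Q.side_le_diam h.n_pos).trans (h.whitney.diam_le Q hQ z hz)

theorem infDist_le {Q : DyadicCube n} (hQ : Q ∈ W) {z : EuclideanSpace ℝ (Fin n)}
    (hz : z ∈ Q.toSet) : Metric.infDist z (frontier G) ≤ 5 * n * Q.side := by
  obtain ⟨x, hx, hxd⟩ := h.whitney.le_diam Q hQ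
  have h1 := Metric.infDist_le_infDist_add_dist (s := frontier G) (x := z) (y := x)
  have h2 := Q.dist_le_of_mem hz hx
  have h3 := Q.diam_le
  linarith

/-- Walls are interior to their cube and interior points belong to a single cube, so membership can
be tested in any one cube that contains the point. -/
theorem mem_sVersion_iff {Q : DyadicCube n} (hQ : Q ∈ W) {z : EuclideanSpace ℝ (Fin n)}
    (hz : z ∈ Q.toSet) : z ∈ sVersion s W Q₀ ↔ Q = Q₀ ∨ z ∉ Q.walls s := by
  constructor
  · intro hzs
    by_contra! hcon
    have hint := DyadicCube.walls_subset_interior (h.width_le Q hQ) hcon.2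
    rcases hzs with hzs | hzs
    · exact hcon.1 (h.eq_of_mem_interior hQ h.mem_central hint hzs)
    · simp only [mem_iUnion] at hzs
      obtain ⟨Q', ⟨hQ', -⟩, hzs⟩ := hzs
      rw [DyadicCube.mem_apartment_iff (h.width_le Q' hQ')] at hzs
      obtain rfl := h.eq_of_mem_interior hQ hQ' hint hzs.1
      exact hzs.2 hcon.2
  · intro hor
    by_cases hQQ : Q = Q₀
    · exact Or.inl (hQQ ▸ hz)
    · refine Or.inr (mem_biUnion (x := Q) ⟨hQ, hQQ⟩ ?_)
      exact (DyadicCube.mem_apartment_iff (h.width_le Q hQ)).2 ⟨hz, hor.resolve_left hQQ⟩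

theorem sVersion_subset : sVersion s W Q₀ ⊆ G := by
  rintro z (hz | hz)
  · exact h.subset h.mem_central hz
  · simp only [mem_iUnion] at hz
    obtain ⟨Q, ⟨hQ, -⟩, hz⟩ := hz
    exact h.subset hQ ((DyadicCube.mem_apartment_iff (h.width_le Q hQ)).1 hz).1

theorem isBounded_sVersion : Bornology.IsBounded (sVersion s W Q₀) :=
  h.isBounded.subset h.sVersion_subset

/-- This makes the walls locally finite in G. The walls of Q' stay within ℓ(Q')/4 of its midpoint in
each coordinate, while z is not interior to Q', so ℓ(Q') ≤ 4 dist(z, v). Then v is within 5nℓ(Q') ≤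
20n dist(z, v) of ∂G, and ℓ(Q) ≤ dist(z, ∂G) adds one more dist(z, v). -/
theorem side_le_of_mem_walls {Q Q' : DyadicCube n} (hQ : Q ∈ W) (hQ' : Q' ∈ W) (hne : Q' ≠ Q)
    {z v : EuclideanSpace ℝ (Fin n)} (hz : z ∈ Q.toSet) (hv : v ∈ Q'.walls s) :
    Q.side ≤ (20 * n + 1) * dist z v := by
  have hz' : z ∉ interior Q'.toSet := fun hz' => hne (h.eq_of_mem_interior hQ' hQ hz' hz)
  rw [DyadicCube.mem_interior_iff] at hz'
  push Not at hz'
  obtain ⟨i, hi⟩ := hz'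
  have h1 := DyadicCube.abs_sub_mid_le_of_mem_walls (h.width_le Q' hQ') hv i
  have h2 : Q'.side / 4 ≤ dist z v := by
    have h3 := abs_sub_le_dist z v i
    have h4 : |z i - Q'.mid i| ≤ |z i - v i| + |v i - Q'.mid i| := abs_sub_le _ _ _
    linarith
  have h5 := h.infDist_le hQ' (interior_subset
    (DyadicCube.walls_subset_interior (h.width_le Q' hQ') hv))
  have h6 := h.side_le_infDist hQ hz
  have h7 := Metric.infDist_le_infDist_add_dist (s := frontier G) (x := z) (y := v)
  have h8 : (n : ℝ) * (Q'.side / 4) ≤ n * dist z v :=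
    mul_le_mul_of_nonneg_left h2 n.cast_nonneg
  linarith

theorem isOpen_sVersion : IsOpen (sVersion s W Q₀) := by
  rw [Metric.isOpen_iff]
  intro z hz
  obtain ⟨Q, hQ, hzQ⟩ := h.exists_mem (h.sVersion_subset hz)
  have hor := (h.mem_sVersion_iff hQ hzQ).1 hz
  obtain ⟨ε₁, hε₁, hb₁⟩ := Metric.isOpen_iff.1 h.isOpen z (h.sVersion_subset hz)
  obtain ⟨ε₂, hε₂, hb₂⟩ : ∃ ε > 0, Q = Q₀ ∨ Metric.ball z ε ⊆ (Q.walls s)ᶜ := by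
    rcases hor with hor | hor
    · exact ⟨1, one_pos, Or.inl hor⟩
    · obtain ⟨ε, hε, hb⟩ := Metric.isOpen_iff.1 DyadicCube.isClosed_walls.isOpen_compl z hor
      exact ⟨ε, hε, Or.inr hb⟩
  have hl := Q.side_pos
  have hn : (0 : ℝ) < 20 * n + 1 := by positivity
  refine ⟨min (min ε₁ ε₂) (Q.side / (20 * n + 1)), by positivity, fun v hv => ?_⟩
  rw [Metric.mem_ball, lt_min_iff, lt_min_iff] at hv
  obtain ⟨Q', hQ', hvQ'⟩ := h.exists_mem (hb₁ hv.1.1)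
  rw [h.mem_sVersion_iff hQ' hvQ']
  by_cases hne : Q' = Q
  · subst hne
    exact hb₂.imp id fun hb₂ => hb₂ hv.1.2
  · refine Or.inr fun hvw => ?_
    have h1 := h.side_le_of_mem_walls hQ hQ' hne hzQ hvw
    have h2 := (lt_div_iff₀ hn).1 hv.2
    rw [dist_comm v z] at h2
    linarith

theorem frontier_sVersion_subset {v : EuclideanSpace ℝ (Fin n)}
    (hv : v ∈ frontier (sVersion s W Q₀)) :
    v ∈ frontier G ∨ ∃ Q ∈ W, Q ≠ Q₀ ∧ v ∈ Q.walls s := by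
  rw [h.isOpen_sVersion.frontier_eq] at hv
  by_cases hvG : v ∈ G
  · obtain ⟨Q, hQ, hvQ⟩ := h.exists_mem hvG
    have := (h.mem_sVersion_iff hQ hvQ).not.1 hv.2
    push Not at this
    exact Or.inr ⟨Q, hQ, this⟩
  · rw [h.isOpen.frontier_eq]
    exact Or.inl ⟨closure_mono h.sVersion_subset hv.1, hvG⟩

/-- A boundary point of a cube belongs to the `s`-version of the domain. -/
theorem mem_sVersion_of_not_mem_interior {Q : DyadicCube n} (hQ : Q ∈ W)
    {z : EuclideanSpace ℝ (Fin n)} (hz : z ∈ Q.toSet) (hz' : z ∉ interior Q.toSet) :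
    z ∈ sVersion s W Q₀ :=
  (h.mem_sVersion_iff hQ hz).2 (Or.inr fun hw =>
    hz' (DyadicCube.walls_subset_interior (h.width_le Q hQ) hw))

theorem exists_mem_diff_interior (Q : DyadicCube n) :
    ∃ z ∈ Q.toSet, z ∉ interior Q.toSet := by
  have hl := Q.side_pos
  refine ⟨WithLp.toLp 2 fun i => Q.mid i + Q.side / 2, Q.mem_toSet_iff.2 fun i => ?_, fun hz => ?_⟩
  · simp [abs_of_pos (half_pos hl)]
  · have := Q.mem_interior_iff.1 hz ⟨0, h.n_pos⟩
    simp [abs_of_pos (half_pos hl)] at this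

/-- Cubes near a point of ∂G are small, and the boundary of each cube survives in the s-version. -/
theorem frontier_subset : frontier G ⊆ frontier (sVersion s W Q₀) := by
  intro v hv
  rw [h.isOpen.frontier_eq] at hv
  rw [h.isOpen_sVersion.frontier_eq]
  refine ⟨Metric.mem_closure_iff.2 fun ε hε => ?_, fun hv' => hv.2 (h.sVersion_subset hv')⟩
  obtain ⟨x, hx, hxv⟩ := Metric.mem_closure_iff.1 hv.1 (ε / 2) (half_pos hε)
  obtain ⟨Q, hQ, hxQ⟩ := h.exists_mem hx
  obtain ⟨z, hz, hz'⟩ := h.exists_mem_diff_interior Q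
  refine ⟨z, h.mem_sVersion_of_not_mem_interior hQ hz hz', ?_⟩
  have h1 := h.whitney.diam_le Q hQ x hxQ
  have h2 := Q.dist_le_diam hxQ hz
  have h3 := infDist_frontier_le hx hv.2
  have h4 := dist_triangle v x z
  rw [dist_comm x v] at h3
  linarith

theorem frontier_sVersion_nonempty : (frontier (sVersion s W Q₀)).Nonempty :=
  h.frontier_nonempty.mono h.frontier_subset

/-- Lower bound for the distance to the boundary of the `s`-version: besides the walls of the cube
itself, the whole boundary is at distance at least a constant times the side length. -/
theorem le_infDist_sVersion {Q : DyadicCube n} (hQ : Q ∈ W) {z : EuclideanSpace ℝ (Fin n)}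
    (hz : z ∈ Q.toSet) {b : ℝ} (hb : (20 * n + 1) * b ≤ Q.side)
    (hb' : Q ≠ Q₀ → ∀ v ∈ Q.walls s, b ≤ dist z v) :
    b ≤ Metric.infDist z (frontier (sVersion s W Q₀)) := by
  have hn : (0 : ℝ) < 20 * n + 1 := by positivity
  refine le_infDist_of_forall_dist h.frontier_sVersion_nonempty fun v hv => ?_
  rcases h.frontier_sVersion_subset hv with hv | ⟨Q', hQ', hne, hv⟩
  · have h1 := h.side_le_infDist hQ hz
    have h2 := Metric.infDist_le_dist_of_mem (x := z) hv
    have h3 : (0 : ℝ) ≤ n := n.cast_nonneg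
    by_cases hb0 : 0 ≤ b
    · nlinarith
    · linarith [dist_nonneg (x := z) (y := v)]
  · by_cases hQQ : Q' = Q
    · subst hQQ
      exact hb' hne v hv
    · exact le_of_mul_le_mul_left (hb.trans (h.side_le_of_mem_walls hQ hQ' hQQ hz hv)) hn

end IsApartmentSetting

end Setting

/-! ### Unit speed curves and their concatenation -/

section UnitPath

variable {E : Type*} [NormedAddCommGroup E]

/-- There is a unit speed curve `γ : [a,b] → E` from `x` to `y` such that `D t (γ t)` holds at all
times `t`. -/
def UnitPath (D : ℝ → E → Prop) (a b : ℝ) (x y : E) : Prop :=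
  a ≤ b ∧ ∃ γ : ℝ → E, HasUnitSpeedOn γ (Icc a b) ∧ γ a = x ∧ γ b = y ∧ ∀ t ∈ Icc a b, D t (γ t)

theorem dist_le_of_hasUnitSpeedOn {E : Type*} [PseudoMetricSpace E] {γ : ℝ → E} {S : Set ℝ}
    (hγ : HasUnitSpeedOn γ S) {t u : ℝ} (ht : t ∈ S) (hu : u ∈ S) (htu : t ≤ u) :
    dist (γ t) (γ u) ≤ u - t := by
  have h1 := hγ ht hu
  have h2 := eVariationOn.edist_le γ (s := S ∩ Icc t u) ⟨ht, left_mem_Icc.2 htu⟩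
    ⟨hu, right_mem_Icc.2 htu⟩
  rw [h1, edist_dist, ENNReal.ofReal_le_ofReal_iff (by simp; linarith)] at h2
  simpa using h2

theorem continuousOn_of_hasUnitSpeedOn {E : Type*} [PseudoMetricSpace E] {γ : ℝ → E} {S : Set ℝ}
    (hγ : HasUnitSpeedOn γ S) : ContinuousOn γ S := by
  have : LipschitzOnWith 1 γ S := LipschitzOnWith.of_dist_le_mul fun t ht u hu => by
    rcases le_total t u with htu | htu
    · have := dist_le_of_hasUnitSpeedOn hγ ht hu htu
      rw [Real.dist_eq, abs_sub_comm, abs_of_nonneg (by linarith)]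
      simpa using this
    · have := dist_le_of_hasUnitSpeedOn hγ hu ht htu
      rw [Real.dist_eq, abs_of_nonneg (by linarith), dist_comm]
      simpa using this
  exact this.continuousOn

/-- Variation depends only on mutual distances, so it equals that of the identity of ℝ, which is
monotone. -/
theorem eVariationOn_of_isometry {γ : ℝ → E} (hγ : Isometry γ) (S : Set ℝ) :
    ∀ ⦃a⦄ (_ : a ∈ S) ⦃b⦄ (_ : b ∈ S), Icc a b ⊆ S →
      eVariationOn γ (S ∩ Icc a b) = ENNReal.ofReal (b - a) := by
  intro a ha b hb hab
  rw [inter_eq_self_of_subset_right hab]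
  rcases le_total a b with h | h
  · apply le_antisymm
    · have h1 : eVariationOn γ (Icc a b) = eVariationOn (id : ℝ → ℝ) (Icc a b) := by
        simp only [eVariationOn, hγ.edist_eq, id]
      have h2 := (monotone_id (α := ℝ)).monotoneOn (Icc a b) |>.eVariationOn_eq
        (left_mem_Icc.2 h) (right_mem_Icc.2 h)
      simpa only [h1, inter_self, id] using h2.le
    · have := eVariationOn.edist_le γ (left_mem_Icc.2 h) (right_mem_Icc.2 h)
      rwa [hγ.edist_eq, edist_comm, edist_dist, Real.dist_eq, abs_of_nonneg (by linarith)] at this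
  · rw [ENNReal.ofReal_of_nonpos (by linarith)]
    refine eVariationOn.subsingleton _ fun u hu v hv => ?_
    linarith [hu.1, hu.2, hv.1, hv.2]

variable {D D' : ℝ → E → Prop} {a b c : ℝ} {x y z : E}

theorem UnitPath.refl (h : D a x) : UnitPath D a a x x := by
  refine ⟨le_rfl, fun _ => x, ?_, rfl, rfl, ?_⟩
  · exact hasConstantSpeedOnWith_of_subsingleton _ (by simp) _
  · rintro t ⟨h1, h2⟩
    rwa [le_antisymm h2 h1]

/-- The parameter interval may start anywhere, so concatenation needs no shift and a condition on
the elapsed time is preserved. -/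
theorem UnitPath.trans (h₁ : UnitPath D a b x y) (h₂ : UnitPath D b c y z) :
    UnitPath D a c x z := by
  obtain ⟨hab, γ₁, hs₁, ha₁, hb₁, hD₁⟩ := h₁
  obtain ⟨hbc, γ₂, hs₂, ha₂, hb₂, hD₂⟩ := h₂
  let γ : ℝ → E := fun t => if t ≤ b then γ₁ t else γ₂ t
  have e₁ : EqOn γ₁ γ (Icc a b) := fun t ht => by simp [γ, ht.2]
  have e₂ : EqOn γ₂ γ (Icc b c) := fun t ht => by
    by_cases htb : t ≤ b
    · obtain rfl := le_antisymm htb ht.1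
      simp [γ, ha₂, hb₁]
    · simp [γ, htb]
  have congr : ∀ {f g : ℝ → E} {S : Set ℝ}, EqOn f g S → HasUnitSpeedOn f S →
      HasUnitSpeedOn g S := fun hfg hf u hu v hv => by
    rw [← eVariationOn.congr (hfg.mono inter_subset_left)]
    exact hf hu hv
  refine ⟨hab.trans hbc, γ, (congr e₁ hs₁).Icc_Icc (congr e₂ hs₂), ?_, ?_, fun t ht => ?_⟩
  · rw [← e₁ (left_mem_Icc.2 hab), ha₁]
  · rw [← e₂ (right_mem_Icc.2 hbc), hb₂]
  · rcases le_total t b with htb | htb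
    · rw [← e₁ ⟨ht.1, htb⟩]
      exact hD₁ t ⟨ht.1, htb⟩
    · rw [← e₂ ⟨htb, ht.2⟩]
      exact hD₂ t ⟨htb, ht.2⟩

theorem UnitPath.mono (h : UnitPath D a b x y) (hD : ∀ t ∈ Icc a b, ∀ z, D t z → D' t z) :
    UnitPath D' a b x y := by
  obtain ⟨hab, γ, hs, ha, hb, hγ⟩ := h
  exact ⟨hab, γ, hs, ha, hb, fun t ht => hD t ht _ (hγ t ht)⟩

theorem UnitPath.of_segment [NormedSpace ℝ E]
    (h : ∀ θ ∈ Icc (0 : ℝ) 1, D (a + θ * dist x y) (x + θ • (y - x))) :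
    UnitPath D a (a + dist x y) x y := by
  rcases eq_or_ne x y with rfl | hxy
  · have := h 0 (by simp)
    simp only [dist_self, mul_zero, add_zero, zero_smul] at this ⊢
    exact UnitPath.refl this
  have hd : 0 < dist x y := dist_pos.2 hxy
  have hd' : ‖y - x‖ = dist x y := by rw [dist_comm, dist_eq_norm]
  let γ : ℝ → E := fun t => x + ((t - a) / dist x y) • (y - x)
  have hγ : Isometry γ := Isometry.of_dist_eq fun t u => by
    simp only [γ, dist_add_left]
    rw [dist_eq_norm, ← sub_smul, norm_smul, hd', Real.dist_eq, ← sub_div, Real.norm_eq_abs,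
      abs_div, abs_of_pos hd]
    field_simp
    ring_nf
  refine ⟨by linarith, γ, ?_, by simp [γ], ?_, fun t ht => ?_⟩
  · intro u hu v hv
    have := eVariationOn_of_isometry hγ (Icc a (a + dist x y)) hu hv (Icc_subset_Icc hu.1 hv.2)
    simpa using this
  · simp [γ, hd.ne']
  · have := h ((t - a) / dist x y) ⟨div_nonneg (by linarith [ht.1]) hd.le,
      (div_le_one hd).2 (by linarith [ht.2])⟩
    rw [div_mul_cancel₀ _ hd.ne'] at this
    simpa [γ] using this

end UnitPath

/-! ### Curves from a point of an apartment to the boundary of its cube -/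

section Boundary

variable {n : ℕ} {s : ℝ} {G : Set (EuclideanSpace ℝ (Fin n))} {W : Set (DyadicCube n)}
  {Q₀ : DyadicCube n}

/-- The condition on the points of an `s`-John curve in `G` with John constant `C`. -/
def JohnCond (s C : ℝ) (G : Set (EuclideanSpace ℝ (Fin n))) (t : ℝ)
    (z : EuclideanSpace ℝ (Fin n)) : Prop :=
  z ∈ G ∧ t ^ s ≤ C * Metric.infDist z (frontier G)

theorem JohnCond.mono {C C' : ℝ} (hC : C ≤ C') {t : ℝ} {z : EuclideanSpace ℝ (Fin n)}
    (h : JohnCond s C G t z) : JohnCond s C' G t z :=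
  ⟨h.1, h.2.trans (mul_le_mul_of_nonneg_right hC Metric.infDist_nonneg)⟩

namespace DyadicCube

/-- The point at height `τ` above the midpoint. -/
noncomputable def axisPoint (Q : DyadicCube n) (τ : ℝ) : EuclideanSpace ℝ (Fin n) :=
  WithLp.toLp 2 fun i => if (i : ℕ) + 1 = n then Q.mid i + τ else Q.mid i

variable {Q : DyadicCube n}

theorem axisPoint_last {i : Fin n} (hi : (i : ℕ) + 1 = n) (τ : ℝ) :
    Q.axisPoint τ i = Q.mid i + τ := by simp [axisPoint, hi]

theorem axisPoint_lateral {i : Fin n} (hi : (i : ℕ) + 1 < n) (τ : ℝ) :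
    Q.axisPoint τ i = Q.mid i := by simp [axisPoint, hi.ne]

theorem axisPoint_mem {τ : ℝ} (h0 : 0 ≤ τ) (h1 : τ ≤ Q.side / 2) : Q.axisPoint τ ∈ Q.toSet :=
  Q.mem_toSet_iff.2 fun i => by
    have hl := Q.side_pos
    rcases (show (i : ℕ) + 1 < n ∨ (i : ℕ) + 1 = n by omega) with hi | hi
    · rw [axisPoint_lateral hi]; simp; linarith
    · rw [axisPoint_last hi, add_sub_cancel_left, abs_of_nonneg h0]; exact h1

theorem axisPoint_top_not_mem_interior (hn : 0 < n) :
    Q.axisPoint (Q.side / 2) ∉ interior Q.toSet := fun h => by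
  have := Q.mem_interior_iff.1 h ⟨n - 1, by omega⟩
  rw [axisPoint_last (by simp; omega), add_sub_cancel_left] at this
  exact absurd (le_abs_self (Q.side / 2)) (not_le.2 this)

theorem width_le_dist_axisPoint (hw : (Q.side / 8) ^ s ≤ Q.side / 32)
    {v : EuclideanSpace ℝ (Fin n)} (hv : v ∈ Q.walls s) {τ : ℝ} (hτ : 0 ≤ τ) :
    (Q.side / 8) ^ s ≤ dist (Q.axisPoint τ) v := by
  have hl := Q.side_pos
  rcases lateral_or_bottom_of_mem_walls hw hv with ⟨i, hi, hvi⟩ | ⟨i, hi, hvi⟩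
  · refine le_trans ?_ (abs_sub_le_dist _ v i)
    rwa [axisPoint_lateral hi, abs_sub_comm]
  · refine le_trans ?_ (abs_sub_le_dist _ v i)
    rw [axisPoint_last hi]
    exact le_trans (by linarith) (le_abs_self _)

theorem axisPoint_segment (τ τ' θ : ℝ) :
    Q.axisPoint τ + θ • (Q.axisPoint τ' - Q.axisPoint τ) = Q.axisPoint (τ + θ * (τ' - τ)) := by
  ext i
  rcases (show (i : ℕ) + 1 < n ∨ (i : ℕ) + 1 = n by omega) with hi | hi
  · simp [axisPoint_lateral hi]
  · simp [axisPoint_last hi]; ring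

theorem segment_mem {x y : EuclideanSpace ℝ (Fin n)} (hx : x ∈ Q.toSet) (hy : y ∈ Q.toSet)
    {θ : ℝ} (hθ : θ ∈ Icc (0 : ℝ) 1) : x + θ • (y - x) ∈ Q.toSet :=
  Q.convex_toSet.add_smul_sub_mem hx hy hθ

/-- Moving horizontally to the axis, a fraction θ of the way yields clearance θ times the width from
the lateral walls by convexity. The bottom of the room is at least ℓ/8 lower. -/
theorem mul_width_le_dist_of_mem_longPassage (hw : (Q.side / 8) ^ s ≤ Q.side / 32)
    {x v : EuclideanSpace ℝ (Fin n)} (hx : x ∈ Q.longPassage s) (hv : v ∈ Q.walls s)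
    {last : Fin n} (hlast : (last : ℕ) + 1 = n) {θ : ℝ} (hθ : θ ∈ Icc (0 : ℝ) 1) :
    θ * (Q.side / 8) ^ s ≤ dist (x + θ • (Q.axisPoint (x last - Q.mid last) - x)) v := by
  have hl := Q.side_pos
  have hw0 := Q.width_pos s
  rcases lateral_or_bottom_of_mem_walls hw hv with ⟨i, hi, hvi⟩ | ⟨i, hi, hvi⟩
  · refine le_trans ?_ (abs_sub_le_dist _ v i)
    have h1 := (hx i).1 hi
    simp only [PiLp.add_apply, PiLp.smul_apply, PiLp.sub_apply, axisPoint_lateral hi, smul_eq_mul]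
    have h2 : |x i + θ * (Q.mid i - x i) - Q.mid i| ≤ (1 - θ) * (Q.side / 8) ^ s := by
      rw [show x i + θ * (Q.mid i - x i) - Q.mid i = (1 - θ) * (x i - Q.mid i) by ring, abs_mul,
        abs_of_nonneg (by linarith [hθ.2])]
      exact mul_le_mul_of_nonneg_left h1.le (by linarith [hθ.2])
    have h3 := abs_sub_le (v i) (x i + θ * (Q.mid i - x i)) (Q.mid i)
    rw [abs_sub_comm (v i) (x i + _)] at h3
    linarith
  · obtain rfl : i = last := Fin.ext (by omega)
    refine le_trans ?_ (abs_sub_le_dist _ v i)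
    simp only [PiLp.add_apply, PiLp.smul_apply, PiLp.sub_apply, axisPoint_last hi, smul_eq_mul]
    have h1 := (hx i).2 hi
    refine le_trans ?_ (le_abs_self _)
    have : θ * (Q.side / 8) ^ s ≤ 1 * (Q.side / 8) ^ s :=
      mul_le_mul_of_nonneg_right hθ.2 hw0.le
    have h2 : x i + θ * (Q.mid i + (x i - Q.mid i) - x i) = x i := by ring
    rw [h2]
    linarith

/-- The room is a cube about the midpoint that no wall enters, so contracting towards the midpoint
by θ yields clearance θℓ/8, which exceeds θ times the width. -/
theorem mul_width_le_dist_of_mem_room (hw : (Q.side / 8) ^ s ≤ Q.side / 32)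
    {x v : EuclideanSpace ℝ (Fin n)} (hx : x ∈ Q.room) (hv : v ∈ Q.walls s)
    {θ : ℝ} (hθ : θ ∈ Icc (0 : ℝ) 1) :
    θ * (Q.side / 8) ^ s ≤ dist (x + θ • (Q.axisPoint 0 - x)) v := by
  have hl := Q.side_pos
  obtain ⟨i, hvi⟩ := exists_side_le_of_mem_walls hw hv
  refine le_trans ?_ (abs_sub_le_dist _ v i)
  have h0 : Q.axisPoint 0 i = Q.mid i := by simp [axisPoint]
  simp only [PiLp.add_apply, PiLp.smul_apply, PiLp.sub_apply, h0, smul_eq_mul]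
  have h2 : |x i + θ * (Q.mid i - x i) - Q.mid i| ≤ (1 - θ) * (Q.side / 8) := by
    rw [show x i + θ * (Q.mid i - x i) - Q.mid i = (1 - θ) * (x i - Q.mid i) by ring, abs_mul,
      abs_of_nonneg (by linarith [hθ.2])]
    exact mul_le_mul_of_nonneg_left (hx i).le (by linarith [hθ.2])
  have h3 := abs_sub_le (v i) (x i + θ * (Q.mid i - x i)) (Q.mid i)
  rw [abs_sub_comm (v i) (x i + _)] at h3
  have h4 : θ * (Q.side / 8) ^ s ≤ θ * (Q.side / 8) :=
    mul_le_mul_of_nonneg_left (by linarith) hθ.1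
  linarith

/-- The union of the closed room and the closed passage is star shaped with respect to a ball
whose radius is the width of the passage. -/
theorem mul_width_le_dist_of_not_mem_closure (hw : (Q.side / 8) ^ s ≤ Q.side / 32)
    {x v : EuclideanSpace ℝ (Fin n)} (hx : x ∉ closure Q.room)
    (hx' : x ∉ closure (Q.passage s)) (hv : v ∈ Q.walls s) {ρ : ℝ} (hρ : 0 ≤ ρ) :
    ρ * (Q.side / 8) ^ s ≤ dist (x + ρ • (x - Q.center)) v := by
  by_contra! hcon
  have hl := Q.side_pos
  have hw0 := Q.width_pos s
  have hρw : ρ * (Q.side / 8) ^ s ≤ ρ * (Q.side / 32) := mul_le_mul_of_nonneg_left hw hρ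
  have hρl : 0 ≤ ρ * Q.side := mul_nonneg hρ hl.le
  -- If v were too near, x would be a convex combination, with weights 1/(1+ρ) and ρ/(1+ρ), of v and
  -- a point within the width of the midpoint in each coordinate. This puts x in the closed room or
  -- the closed passage.
  have key : ∀ i, |(1 + ρ) * (x i - Q.mid i) - (v i - Q.mid i)| ≤ ρ * (Q.side / 8) ^ s := fun i => by
    have h1 := (abs_sub_le_dist (x + ρ • (x - Q.center)) v i).trans hcon.le
    simp only [PiLp.add_apply, PiLp.smul_apply, PiLp.sub_apply, center_apply, smul_eq_mul] at h1
    rwa [show (1 + ρ) * (x i - Q.mid i) - (v i - Q.mid i) =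
      x i + ρ * (x i - Q.mid i) - v i by ring]
  have hρ1 : 0 < 1 + ρ := by linarith
  have cancel : ∀ {y A : ℝ}, (1 + ρ) * y ≤ (1 + ρ) * A → y ≤ A :=
    fun h => le_of_mul_le_mul_left h hρ1
  rcases mem_closure_of_mem_walls hv with h | h
  · refine hx (Q.mem_closure_room_iff.2 fun i => ?_)
    have h1 := abs_le.1 (Q.mem_closure_room_iff.1 h i)
    have h2 := abs_le.1 (key i)
    rw [abs_le]
    constructor <;> apply cancel <;> linarith
  · rw [passage, Q.mem_closure_corridor_iff s (by linarith)] at h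
    have hlat : ∀ i : Fin n, (i : ℕ) + 1 < n → |x i - Q.mid i| ≤ (Q.side / 8) ^ s := fun i hi => by
      have h1 := abs_le.1 ((h i).1 hi)
      have h2 := abs_le.1 (key i)
      rw [abs_le]
      constructor <;> apply cancel <;> linarith
    have hlast : ∀ i : Fin n, (i : ℕ) + 1 = n →
        -(Q.side / 8) ≤ x i - Q.mid i ∧ x i - Q.mid i ≤ Q.side / 4 := fun i hi => by
      have h1 := (h i).2 hi
      have h2 := abs_le.1 (key i)
      constructor <;> apply cancel <;> linarith
    by_cases hup : ∀ i : Fin n, (i : ℕ) + 1 = n → Q.side / 8 ≤ x i - Q.mid i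
    · refine hx' ((Q.mem_closure_corridor_iff s (by linarith)).2 fun i => ⟨hlat i, fun hi => ?_⟩)
      have := hup i hi
      have := hlast i hi
      constructor <;> linarith
    · push Not at hup
      obtain ⟨j, hj, hjx⟩ := hup
      refine hx (Q.mem_closure_room_iff.2 fun i => ?_)
      rcases (show (i : ℕ) + 1 < n ∨ (i : ℕ) + 1 = n by omega) with hi | hi
      · linarith [hlat i hi]
      · obtain rfl : i = j := Fin.ext (by omega)
        exact abs_le.2 ⟨(hlast i hi).1, hjx.le⟩

/-- The radial projection to the boundary of a cube. -/
theorem exists_radial (hn : 0 < n) {x : EuclideanSpace ℝ (Fin n)} (hx : x ∈ Q.toSet)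
    (hxc : x ≠ Q.center) : ∃ ρ : ℝ, 0 ≤ ρ ∧ x + ρ • (x - Q.center) ∈ Q.toSet ∧
      x + ρ • (x - Q.center) ∉ interior Q.toSet := by
  have : Nonempty (Fin n) := ⟨⟨0, hn⟩⟩
  obtain ⟨j, hj⟩ := Finite.exists_max fun i => |x i - Q.mid i|
  have hpos : 0 < |x j - Q.mid j| := by
    by_contra! h0
    refine hxc (PiLp.ext fun i => ?_)
    have := (hj i).trans h0
    simpa [sub_eq_zero] using this
  have hle := Q.mem_toSet_iff.1 hx j
  have hco : ∀ (ρ : ℝ) i, (x + ρ • (x - Q.center)) i - Q.mid i = (1 + ρ) * (x i - Q.mid i) :=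
    fun ρ i => by
      simp only [PiLp.add_apply, PiLp.smul_apply, PiLp.sub_apply, center_apply, smul_eq_mul]; ring
  have h1 : 1 ≤ Q.side / 2 / |x j - Q.mid j| := (one_le_div hpos).2 hle
  -- The factor 1 + ρ brings the largest coordinate deviation to exactly ℓ/2.
  refine ⟨Q.side / 2 / |x j - Q.mid j| - 1, by linarith, Q.mem_toSet_iff.2 fun i => ?_, fun h => ?_⟩
  · rw [hco, abs_mul, add_sub_cancel, abs_of_nonneg (by linarith)]
    calc _ ≤ Q.side / 2 / |x j - Q.mid j| * |x j - Q.mid j| :=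
          mul_le_mul_of_nonneg_left (hj i) (by linarith)
      _ = _ := div_mul_cancel₀ _ hpos.ne'
  · have := Q.mem_interior_iff.1 h j
    rw [hco, abs_mul, add_sub_cancel, abs_of_nonneg (by linarith), div_mul_cancel₀ _ hpos.ne'] at this
    exact lt_irrefl _ this

/-- Here the exponents match. Write t^s = t · t^(s-1), bound the first factor by lam · Kℓ and the
second by (Kℓ)^(s-1); the product is (8K)^s · lam · (ℓ/8)^s. The parameter `lam` is the fraction of
the way travelled, to which both the time and the clearance are proportional. -/
theorem rpow_le_of_width_le {K lam t d : ℝ} (hK : 0 < K) (ht : 0 ≤ t) (hs : 1 < s)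
    (h1 : t ≤ lam * (K * Q.side)) (h2 : t ≤ K * Q.side) (hd : lam * (Q.side / 8) ^ s ≤ d) :
    t ^ s ≤ (8 * K) ^ s * d := by
  have hl := Q.side_pos
  have hKl : 0 < K * Q.side := mul_pos hK hl
  have e1 : t ^ s = t * t ^ (s - 1) := by
    rcases ht.eq_or_lt with rfl | ht
    · simp [Real.zero_rpow (by linarith : s ≠ 0)]
    · rw [mul_comm, ← Real.rpow_add_one ht.ne']; ring_nf
  have e2 : (K * Q.side) ^ s = K * Q.side * (K * Q.side) ^ (s - 1) := by
    rw [mul_comm (K * Q.side) (_ ^ _), ← Real.rpow_add_one hKl.ne']; ring_nf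
  have e3 : (K * Q.side) ^ s = (8 * K) ^ s * (Q.side / 8) ^ s := by
    rw [← Real.mul_rpow (by positivity) (by positivity)]
    congr 1; ring
  calc t ^ s = t * t ^ (s - 1) := e1
    _ ≤ lam * (K * Q.side) * (K * Q.side) ^ (s - 1) := by
        refine mul_le_mul h1 (Real.rpow_le_rpow ht h2 (by linarith)) (by positivity) (ht.trans h1)
    _ = lam * (K * Q.side) ^ s := by rw [e2]; ring
    _ = (8 * K) ^ s * (lam * (Q.side / 8) ^ s) := by rw [e3]; ring
    _ ≤ _ := mul_le_mul_of_nonneg_left hd (by positivity)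

end DyadicCube

namespace IsApartmentSetting

variable (h : IsApartmentSetting s G W Q₀)
include h

theorem exists_side_le : ∃ M, 0 < M ∧ ∀ Q ∈ W, Q.side ≤ M := by
  have hb : Bornology.IsBounded (closure G) := h.isBounded.closure
  refine ⟨Metric.diam (closure G) + 1, by positivity, fun Q hQ => ?_⟩
  obtain ⟨v, hv⟩ := h.frontier_nonempty
  have h1 := h.side_le_infDist hQ Q.center_mem
  have h2 := Metric.infDist_le_dist_of_mem (x := Q.center) hv
  have h3 := Metric.dist_le_diam_of_mem hb (subset_closure (h.subset hQ Q.center_mem))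
    (frontier_subset_closure hv)
  linarith

/-- An admissible John constant at the points of a cube `Q` that are reached in time
`≤ K ℓ(Q)`. -/
theorem johnCond_of_rpow_le {K C M : ℝ} (hK : 0 < K) (hC : 0 < C) (hM : ∀ Q ∈ W, Q.side ≤ M)
    (hMC : (20 * n + 1) * (K ^ s * M ^ (s - 1)) ≤ C) {Q : DyadicCube n} (hQ : Q ∈ W)
    {z : EuclideanSpace ℝ (Fin n)} (hz : z ∈ Q.toSet) (hzs : z ∈ sVersion s W Q₀) {t : ℝ}
    (ht : 0 ≤ t) (ht' : t ≤ K * Q.side)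
    (hwall : Q ≠ Q₀ → ∀ v ∈ Q.walls s, t ^ s ≤ C * dist z v) :
    JohnCond s C (sVersion s W Q₀) t z := by
  have hl := Q.side_pos
  refine ⟨hzs, ?_⟩
  rw [← div_le_iff₀' hC]
  refine h.le_infDist_sVersion hQ hz ?_ fun hne v hv => (div_le_iff₀' hC).2 (hwall hne v hv)
  rw [mul_div_assoc', div_le_iff₀ hC]
  have h1s := h.one_lt
  have e2 : (K * Q.side) ^ s = K ^ s * Q.side ^ (s - 1) * Q.side := by
    rw [Real.mul_rpow hK.le hl.le, mul_assoc, ← Real.rpow_add_one hl.ne']; ring_nf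
  -- As s > 1 and sides are at most M, the power (Kℓ)^s is at most K^s M^(s-1) ℓ, a linear bound in
  -- ℓ.
  calc (20 * n + 1) * t ^ s ≤ (20 * n + 1) * (K * Q.side) ^ s := by
        gcongr
    _ = (20 * n + 1) * (K ^ s * Q.side ^ (s - 1)) * Q.side := by rw [e2]; ring
    _ ≤ (20 * n + 1) * (K ^ s * M ^ (s - 1)) * Q.side := by
        have := hM Q hQ
        gcongr
    _ ≤ C * Q.side := mul_le_mul_of_nonneg_right hMC hl.le
    _ = _ := mul_comm _ _

/-- Every point of an apartment can be joined to the boundary of the cube. -/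
theorem exists_path_to_boundary : ∃ C, 0 < C ∧ ∀ Q ∈ W, Q ≠ Q₀ → ∀ x ∈ Q.toSet,
    x ∈ sVersion s W Q₀ → ∃ y ∈ Q.toSet, y ∉ interior Q.toSet ∧ ∃ b, 0 ≤ b ∧
      b ≤ 2 * n * Q.side ∧ UnitPath (JohnCond s C (sVersion s W Q₀)) 0 b x y := by
  obtain ⟨M, hM0, hM⟩ := h.exists_side_le
  have hn1 := h.one_le_n
  -- Each curve below consists of at most two segments in the cube, of length at most nℓ each.
  have hK : (0 : ℝ) < 2 * n := by linarith
  -- The first entry handles the walls of the cube itself, the second the rest of the boundary.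
  set C := max ((8 * (2 * n : ℝ)) ^ s) ((20 * n + 1) * ((2 * n : ℝ) ^ s * M ^ (s - 1))) with hCdef
  have hC : 0 < C := lt_max_of_lt_left (by positivity)
  refine ⟨C, hC, fun Q hQ hne x hx hxs => ?_⟩
  have hl := Q.side_pos
  have hw := h.width_le Q hQ
  have hw0 := Q.width_pos s
  have hxw : x ∉ Q.walls s := ((h.mem_sVersion_iff hQ hx).1 hxs).resolve_left hne
  have hnl : Q.side ≤ n * Q.side := le_mul_of_one_le_left hl.le hn1
  have good : ∀ {z : EuclideanSpace ℝ (Fin n)} {t lam : ℝ}, z ∈ Q.toSet → z ∉ Q.walls s → 0 ≤ t →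
      t ≤ 2 * n * Q.side → t ≤ lam * (2 * n * Q.side) →
      (∀ v ∈ Q.walls s, lam * (Q.side / 8) ^ s ≤ dist z v) →
      JohnCond s C (sVersion s W Q₀) t z := by
    intro z t lam hz hzw ht h1 h2 h3
    refine h.johnCond_of_rpow_le hK hC hM (le_max_right _ _) hQ hz
      ((h.mem_sVersion_iff hQ hz).2 (Or.inr hzw)) ht h1 fun _ v hv => ?_
    exact (DyadicCube.rpow_le_of_width_le hK ht h.one_lt h2 h1 (h3 v hv)).trans
      (mul_le_mul_of_nonneg_right (le_max_left _ _) dist_nonneg)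
  have straight : ∀ {y : EuclideanSpace ℝ (Fin n)} {ρ : ℝ}, y ∈ Q.toSet → 0 ≤ ρ →
      dist x y ≤ ρ * (n * Q.side) →
      (∀ θ ∈ Icc (0 : ℝ) 1, ∀ v ∈ Q.walls s,
        θ * ρ * (Q.side / 8) ^ s ≤ dist (x + θ • (y - x)) v) →
      UnitPath (JohnCond s C (sVersion s W Q₀)) 0 (0 + dist x y) x y := by
    intro y ρ hy hρ hd hv
    refine UnitPath.of_segment fun θ hθ => ?_
    rw [zero_add]
    have hdn : dist x y ≤ n * Q.side := Q.dist_le_of_mem hx hy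
    have h0 : θ * dist x y ≤ 1 * dist x y := mul_le_mul_of_nonneg_right hθ.2 dist_nonneg
    have h1 : θ * dist x y ≤ θ * (ρ * (n * Q.side)) := mul_le_mul_of_nonneg_left hd hθ.1
    have h2 : 0 ≤ θ * (ρ * (n * Q.side)) :=
      mul_nonneg hθ.1 (mul_nonneg hρ (by linarith))
    refine good (lam := θ * ρ) (Q.segment_mem hx hy hθ) (fun hcon => ?_)
      (mul_nonneg hθ.1 dist_nonneg) (by linarith) (by linarith) (hv θ hθ)
    have h3 := hv θ hθ _ hcon
    rw [dist_self] at h3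
    have h4 : θ * ρ = 0 := le_antisymm (nonpos_of_mul_nonpos_left h3 hw0) (mul_nonneg hθ.1 hρ)
    -- A vanishing lower bound means θ = 0 or ρ = 0; in both cases the point is x itself, which is
    -- not on a wall.
    rcases mul_eq_zero.1 h4 with rfl | rfl
    · simp [hxw] at hcon
    · have h5 : x = y := dist_le_zero.1 (by simpa using hd)
      simp [← h5, hxw] at hcon
  have axis : ∀ {τ a : ℝ}, 0 ≤ τ → τ ≤ Q.side / 2 → 0 ≤ a → a ≤ n * Q.side →
      ∃ b, a ≤ b ∧ b ≤ 2 * n * Q.side ∧ UnitPath (JohnCond s C (sVersion s W Q₀)) a b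
        (Q.axisPoint τ) (Q.axisPoint (Q.side / 2)) := by
    intro τ a hτ hτ' ha ha'
    have hdn : dist (Q.axisPoint τ) (Q.axisPoint (Q.side / 2)) ≤ n * Q.side :=
      Q.dist_le_of_mem (Q.axisPoint_mem hτ hτ') (Q.axisPoint_mem (by linarith) le_rfl)
    refine ⟨_, le_add_of_nonneg_right dist_nonneg, by linarith,
      UnitPath.of_segment fun θ hθ => ?_⟩
    have h0 : θ * dist (Q.axisPoint τ) (Q.axisPoint (Q.side / 2)) ≤ 1 * (n * Q.side) :=
      mul_le_mul hθ.2 hdn dist_nonneg zero_le_one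
    have h1 : 0 ≤ θ * dist (Q.axisPoint τ) (Q.axisPoint (Q.side / 2)) :=
      mul_nonneg hθ.1 dist_nonneg
    have h2 : 0 ≤ θ * (Q.side / 2 - τ) := mul_nonneg hθ.1 (by linarith)
    have h4 := Q.segment_mem (Q.axisPoint_mem hτ hτ') (Q.axisPoint_mem (by linarith) le_rfl) hθ
    rw [DyadicCube.axisPoint_segment] at h4 ⊢
    have h3 : ∀ v ∈ Q.walls s, (Q.side / 8) ^ s ≤
        dist (Q.axisPoint (τ + θ * (Q.side / 2 - τ))) v := fun v hv =>
      DyadicCube.width_le_dist_axisPoint hw hv (by linarith)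
    refine good (lam := 1) h4 (fun hcon => ?_) (by linarith) (by linarith) (by linarith)
      fun v hv => by rw [one_mul]; exact h3 v hv
    have := h3 _ hcon
    rw [dist_self] at this
    linarith
  have viaAxis : ∀ {τ : ℝ}, 0 ≤ τ → τ ≤ Q.side / 2 →
      (∀ θ ∈ Icc (0 : ℝ) 1, ∀ v ∈ Q.walls s,
        θ * (Q.side / 8) ^ s ≤ dist (x + θ • (Q.axisPoint τ - x)) v) →
      ∃ y ∈ Q.toSet, y ∉ interior Q.toSet ∧ ∃ b, 0 ≤ b ∧ b ≤ 2 * n * Q.side ∧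
        UnitPath (JohnCond s C (sVersion s W Q₀)) 0 b x y := by
    intro τ hτ hτ' hv
    have hmem := Q.axisPoint_mem hτ hτ'
    have p1 := straight (ρ := 1) hmem zero_le_one (by rw [one_mul]; exact Q.dist_le_of_mem hx hmem)
      (by simpa using hv)
    obtain ⟨b, hb, hb', p2⟩ := axis (a := 0 + dist x (Q.axisPoint τ)) hτ hτ'
      (by rw [zero_add]; exact dist_nonneg) (by rw [zero_add]; exact Q.dist_le_of_mem hx hmem)
    refine ⟨_, Q.axisPoint_mem (by linarith) le_rfl, Q.axisPoint_top_not_mem_interior h.n_pos,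
      b, ?_, hb', p1.trans p2⟩
    rw [zero_add] at hb
    exact dist_nonneg.trans hb
  -- From the long passage the curve goes horizontally to the axis and then up; from the rest of the
  -- room, to the midpoint and then up the axis; from elsewhere, radially outwards.
  by_cases hxL : x ∈ Q.longPassage s
  · let last : Fin n := ⟨n - 1, by have := h.n_pos; omega⟩
    have hlast : (last : ℕ) + 1 = n := by have := h.n_pos; simp [last]; omega
    have h1 := (hxL last).2 hlast
    exact viaAxis (by linarith) (by linarith) fun θ hθ v hv =>
      DyadicCube.mul_width_le_dist_of_mem_longPassage hw hxL hv hlast hθ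
  by_cases hxR : x ∈ Q.room
  · exact viaAxis le_rfl (by linarith) fun θ hθ v hv =>
      DyadicCube.mul_width_le_dist_of_mem_room hw hxR hv hθ
  have hxR' : x ∉ closure Q.room := fun hc => hxw ⟨Or.inl (by
    rw [Q.isOpen_room.frontier_eq]; exact ⟨hc, hxR⟩), hxL⟩
  have hxP' : x ∉ closure (Q.passage s) := fun hc => by
    refine hxw ⟨Or.inr ?_, hxL⟩
    rw [DyadicCube.passage, (Q.isOpen_corridor s _ _).frontier_eq]
    refine ⟨hc, fun hP => hxL fun i => ⟨(hP i).1, fun hi => ?_⟩⟩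
    have := (hP i).2 hi
    constructor <;> linarith
  have hxc : x ≠ Q.center := by
    rintro rfl
    exact hxR fun i => by simp [hl]
  obtain ⟨ρ, hρ, hmem, hmem'⟩ := DyadicCube.exists_radial h.n_pos hx hxc
  have hd : dist x (x + ρ • (x - Q.center)) ≤ ρ * (n * Q.side) := by
    rw [dist_self_add_right, norm_smul, Real.norm_of_nonneg hρ, ← dist_eq_norm]
    exact mul_le_mul_of_nonneg_left (Q.dist_le_of_mem hx Q.center_mem) hρ
  refine ⟨_, hmem, hmem', _, ?_, ?_, straight hmem hρ hd fun θ hθ v hv => ?_⟩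
  · rw [zero_add]; exact dist_nonneg
  · rw [zero_add]
    linarith [Q.dist_le_of_mem hx hmem]
  · rw [add_sub_cancel_left, smul_smul]
    exact DyadicCube.mul_width_le_dist_of_not_mem_closure hw hxR' hxP' hv (mul_nonneg hθ.1 hρ)

end IsApartmentSetting

end Boundary

/-! ### Imitating the John curve of G along the boundaries of cubes -/

section Chain

variable {n : ℕ} {s : ℝ} {G : Set (EuclideanSpace ℝ (Fin n))} {W : Set (DyadicCube n)}
  {Q₀ : DyadicCube n}

namespace DyadicCube

variable {Q : DyadicCube n}

/-- The points of a cube that are far from its walls. -/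
def FarFromWalls (s : ℝ) (Q : DyadicCube n) (z : EuclideanSpace ℝ (Fin n)) : Prop :=
  z ∈ Q.toSet ∧ ∀ v ∈ Q.walls s, Q.side / 8 ≤ dist z v

theorem farFromWalls_of_coord (hw : (Q.side / 8) ^ s ≤ Q.side / 32)
    {z : EuclideanSpace ℝ (Fin n)} (hz : z ∈ Q.toSet) {i : Fin n}
    (hi : 3 * Q.side / 8 ≤ |z i - Q.mid i|) : Q.FarFromWalls s z := by
  refine ⟨hz, fun v hv => ?_⟩
  have h1 := abs_sub_mid_le_of_mem_walls hw hv i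
  have h2 := abs_sub_le (z i) (v i) (Q.mid i)
  have h3 := abs_sub_le_dist z v i
  linarith

theorem exists_extreme {z : EuclideanSpace ℝ (Fin n)} (hz : z ∈ Q.toSet)
    (hz' : z ∉ interior Q.toSet) : ∃ i, |z i - Q.mid i| = Q.side / 2 := by
  by_contra! hne
  exact hz' (Q.mem_interior_iff.2 fun i => lt_of_le_of_ne (Q.mem_toSet_iff.1 hz i) (hne i))

theorem unitPath_in_face (hw : (Q.side / 8) ^ s ≤ Q.side / 32) {x y : EuclideanSpace ℝ (Fin n)}
    (hx : x ∈ Q.toSet) (hy : y ∈ Q.toSet) {i : Fin n} (hi : |x i - Q.mid i| = Q.side / 2)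
    (hxy : x i = y i) (a : ℝ) :
    UnitPath (fun _ => Q.FarFromWalls s) a (a + dist x y) x y :=
  UnitPath.of_segment fun θ hθ => farFromWalls_of_coord hw (Q.segment_mem hx hy hθ) (i := i) (by
    have : (x + θ • (y - x)) i = x i := by simp [hxy]
    rw [this, hi]
    linarith [Q.side_pos])

theorem update_mem {x : EuclideanSpace ℝ (Fin n)} (hx : x ∈ Q.toSet) (j : Fin n) {u : ℝ}
    (hu : |u - Q.mid j| ≤ Q.side / 2) :
    (WithLp.toLp 2 (Function.update x.ofLp j u) : EuclideanSpace ℝ (Fin n)) ∈ Q.toSet :=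
  Q.mem_toSet_iff.2 fun k => by
    rcases eq_or_ne k j with rfl | hk
    · simpa using hu
    · simpa [hk] using Q.mem_toSet_iff.1 hx k

/-- Faces in different coordinate directions have a common point: x with its j-th coordinate
replaced by that of y. The curve through it stays in the two faces. -/
theorem unitPath_two_faces (hw : (Q.side / 8) ^ s ≤ Q.side / 32)
    {x y : EuclideanSpace ℝ (Fin n)} (hx : x ∈ Q.toSet) (hy : y ∈ Q.toSet) {i j : Fin n}
    (hij : i ≠ j) (hi : |x i - Q.mid i| = Q.side / 2) (hj : |y j - Q.mid j| = Q.side / 2) (a : ℝ) :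
    ∃ b, b ≤ a + 2 * n * Q.side ∧ UnitPath (fun _ => Q.FarFromWalls s) a b x y := by
  have hr := update_mem hx j hj.le
  set r : EuclideanSpace ℝ (Fin n) := WithLp.toLp 2 (Function.update x.ofLp j (y j))
  have hri : r i = x i := by simp [r, hij]
  have hrj : r j = y j := by simp [r]
  refine ⟨_, ?_, (unitPath_in_face hw hx hr hi hri.symm a).trans
    (unitPath_in_face hw hr hy (by rw [hrj]; exact hj) hrj _)⟩
  linarith [Q.dist_le_of_mem hx hr, Q.dist_le_of_mem hr hy]

/-- Two boundary points of a cube can be joined by a curve far from the walls whose length is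
comparable to their distance. -/
theorem exists_unitPath_shell (hn : 2 ≤ n) (hw : (Q.side / 8) ^ s ≤ Q.side / 32)
    {x y : EuclideanSpace ℝ (Fin n)} (hx : x ∈ Q.toSet) (hx' : x ∉ interior Q.toSet)
    (hy : y ∈ Q.toSet) (hy' : y ∉ interior Q.toSet) (a : ℝ) :
    ∃ b, b ≤ a + 24 * n * dist x y ∧ b ≤ a + 3 * n * Q.side ∧
      UnitPath (fun _ => Q.FarFromWalls s) a b x y := by
  have hl := Q.side_pos
  have hn1 : (1 : ℝ) ≤ n := by exact_mod_cast (by omega : 1 ≤ n)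
  have hnl : (0 : ℝ) ≤ n * Q.side := by positivity
  obtain ⟨i, hi⟩ := exists_extreme hx hx'
  -- For close points the segment keeps the extreme coordinate of x beyond 3ℓ/8. Otherwise ℓ < 8
  -- dist(x, y), so a length of 3nℓ is at most 24n dist(x, y).
  by_cases hd : dist x y ≤ Q.side / 8
  · refine ⟨a + dist x y, ?_, ?_, UnitPath.of_segment fun θ hθ =>
      farFromWalls_of_coord hw (Q.segment_mem hx hy hθ) (i := i) ?_⟩
    · nlinarith [dist_nonneg (x := x) (y := y)]
    · linarith [Q.dist_le_of_mem hx hy]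
    · have h1 := abs_sub_le_dist x (x + θ • (y - x)) i
      rw [dist_self_add_right, norm_smul, Real.norm_of_nonneg hθ.1, ← dist_eq_norm,
        dist_comm] at h1
      have h2 : θ * dist x y ≤ 1 * dist x y := mul_le_mul_of_nonneg_right hθ.2 dist_nonneg
      have h3 := abs_sub_le (x i) ((x + θ • (y - x)) i) (Q.mid i)
      linarith
  · push Not at hd
    suffices ∃ b, b ≤ a + 3 * n * Q.side ∧ UnitPath (fun _ => Q.FarFromWalls s) a b x y by
      obtain ⟨b, hb, hp⟩ := this
      refine ⟨b, ?_, hb, hp⟩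
      nlinarith
    obtain ⟨j, hj⟩ := exists_extreme hy hy'
    -- Two points on the same or on opposite faces are joined through a face in another direction,
    -- which exists as n ≥ 2.
    rcases eq_or_ne i j with rfl | hij
    · have : Nontrivial (Fin n) := Fin.nontrivial_iff_two_le.2 hn
      obtain ⟨k, hk⟩ := exists_ne i
      have hu : |Q.mid k + Q.side / 2 - Q.mid k| = Q.side / 2 := by
        rw [add_sub_cancel_left, abs_of_pos (half_pos hl)]
      have hr := update_mem hx k hu.le
      set r : EuclideanSpace ℝ (Fin n) :=
        WithLp.toLp 2 (Function.update x.ofLp k (Q.mid k + Q.side / 2))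
      have hri : r i = x i := by simp [r, hk.symm]
      have hrk : |r k - Q.mid k| = Q.side / 2 := by simpa [r] using hu
      obtain ⟨b, hb, hp⟩ := unitPath_two_faces hw hr hy hk hrk hj (a + dist x r)
      exact ⟨b, by linarith [Q.dist_le_of_mem hx hr],
        (unitPath_in_face hw hx hr hi hri.symm a).trans hp⟩
    · obtain ⟨b, hb, hp⟩ := unitPath_two_faces hw hx hy hij hi hj a
      exact ⟨b, by linarith, hp⟩

end DyadicCube

namespace IsApartmentSetting

variable (h : IsApartmentSetting s G W Q₀)
include h

/-- The interiors are disjoint, have volume at least ε^n and lie in a bounded set. -/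
theorem finite_le_side {ε : ℝ} (hε : 0 < ε) : {Q ∈ W | ε ≤ Q.side}.Finite := by
  have hfin := Measure.finite_const_le_meas_of_disjoint_iUnion
    (volume : Measure (EuclideanSpace ℝ (Fin n))) (ε := ENNReal.ofReal ε ^ n)
    (As := fun Q : W => interior Q.1.toSet)
    (by positivity) (fun Q => isOpen_interior.measurableSet)
    (fun Q Q' hne => h.whitney.disjoint_interior Q.2 Q'.2 (Subtype.coe_injective.ne hne))
    (((measure_mono (iUnion_subset fun Q => interior_subset.trans (h.subset Q.2))).trans_lt
      h.isBounded.measure_lt_top).ne)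
  refine (hfin.image Subtype.val).subset fun Q hQ => ⟨⟨Q, hQ.1⟩, ?_, rfl⟩
  simp only [mem_ofPred_eq, DyadicCube.volume_interior_toSet]
  exact pow_le_pow_left' (ENNReal.ofReal_le_ofReal hQ.2) n

theorem finite_cubesOfGen (k : ℤ) : (cubesOfGen W k).Finite :=
  (h.finite_le_side (zpow_pos two_pos (-k))).subset fun Q hQ => ⟨hQ.1, by
    rw [DyadicCube.side, hQ.2]⟩

/-- The curve in the `s`-version that follows a curve `γ` in `G` by passing through the cubes that
`γ` meets, in the order in which `γ` leaves them, away from the walls. -/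
theorem exists_path_along {l : ℝ} {γ : ℝ → EuclideanSpace ℝ (Fin n)} {D : ℝ →
    EuclideanSpace ℝ (Fin n) → Prop} {a₀ : ℝ} (hγ : HasUnitSpeedOn γ (Icc 0 l))
    (hγG : MapsTo γ (Icc 0 l) G) (hγl : γ l ∈ Q₀.toSet)
    (hfin : {Q ∈ W | ∃ u ∈ Icc 0 l, γ u ∈ Q.toSet}.Finite)
    (hD : ∀ Q ∈ W, ∀ t ∈ Icc 0 l, γ t ∈ Q.toSet → ∀ τ, 0 ≤ τ →
      τ ≤ a₀ + 24 * n * t + 3 * n * Q.side → ∀ z ∈ Q.toSet,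
      (Q ≠ Q₀ → Q.FarFromWalls s z) → D τ z) (m : ℕ) :
    ∀ t ∈ Icc 0 l, ∀ a, 0 ≤ a → a ≤ a₀ + 24 * n * t →
      (∀ Q ∈ W, Q ≠ Q₀ → γ t ∉ interior Q.toSet) →
      {Q ∈ W | ∃ u ∈ Ioc t l, γ u ∈ Q.toSet}.ncard < m →
      ∃ b, b ≤ a₀ + 24 * n * l + n * Q₀.side ∧ UnitPath D a b (γ t) (γ l) := by
  have hcont := continuousOn_of_hasUnitSpeedOn hγ
  have hnl₀ : 0 ≤ n * Q₀.side := mul_nonneg n.cast_nonneg Q₀.side_pos.le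
  -- Finitely many cubes meet the curve, so one of them is visited at times arbitrarily close to t
  -- from the right; being closed, it contains γ t.
  have next : ∀ t ∈ Ico 0 l, ∃ Q ∈ W, γ t ∈ Q.toSet ∧ ∃ᶠ u in 𝓝[>] t, γ u ∈ Q.toSet := by
    intro t ht
    have hIoc : ∀ᶠ u in 𝓝[>] t, u ∈ Ioc t l := Ioc_mem_nhdsGT ht.2
    have hex : ∃ Q ∈ {Q ∈ W | ∃ u ∈ Icc 0 l, γ u ∈ Q.toSet},
        ∃ᶠ u in 𝓝[>] t, γ u ∈ Q.toSet := by
      by_contra! hcon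
      have hall := (hfin.eventually_all (l := 𝓝[>] t) (p := fun Q u => γ u ∉ Q.toSet)).2
        fun Q hQ => by simpa using hcon Q hQ
      obtain ⟨u, hu, hu'⟩ := (hall.and hIoc).exists
      have hu0 : u ∈ Icc 0 l := ⟨ht.1.trans hu'.1.le, hu'.2⟩
      obtain ⟨Q, hQ, huQ⟩ := h.exists_mem (hγG hu0)
      exact hu Q ⟨hQ, u, hu0, huQ⟩ huQ
    obtain ⟨Q, hQ, hfreq⟩ := hex
    refine ⟨Q, hQ.1, ?_, hfreq⟩
    have htend : Tendsto γ (𝓝[Ioc t l] t) (𝓝 (γ t)) :=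
      (hcont t ⟨ht.1, ht.2.le⟩).mono fun u hu => ⟨ht.1.trans hu.1.le, hu.2⟩
    rw [nhdsWithin_Ioc_eq_nhdsGT ht.2] at htend
    exact Q.isClosed_toSet.mem_of_frequently_of_tendsto hfreq htend
  -- Induction on the number of cubes met after t. Each step moves to the last time `t'` in the
  -- present cube, which is never met again.
  induction m with
  | zero => intro t _ a _ _ _ hcard; omega
  | succ m ih =>
    intro t ht a ha ha' hinv hcard
    by_cases htQ₀ : γ t ∈ Q₀.toSet
    · have hdist := Q₀.dist_le_of_mem htQ₀ hγl
      have htl : 24 * n * t ≤ 24 * n * l := mul_le_mul_of_nonneg_left ht.2 (by positivity)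
      refine ⟨a + dist (γ t) (γ l), by linarith, UnitPath.of_segment fun θ hθ =>
        hD Q₀ h.mem_central t ht htQ₀ _ (add_nonneg ha (mul_nonneg hθ.1 dist_nonneg)) ?_ _
          (Q₀.segment_mem htQ₀ hγl hθ) fun hne => absurd rfl hne⟩
      have : θ * dist (γ t) (γ l) ≤ 1 * dist (γ t) (γ l) :=
        mul_le_mul_of_nonneg_right hθ.2 dist_nonneg
      linarith
    have htl : t < l := lt_of_le_of_ne ht.2 fun heq => htQ₀ (heq ▸ hγl)
    obtain ⟨Q, hQ, htQ, hfreq⟩ := next t ⟨ht.1, htl⟩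
    have hne : Q ≠ Q₀ := fun heq => htQ₀ (heq ▸ htQ)
    obtain ⟨t', ⟨ht', ht'Q⟩, hlast⟩ : ∃ t', IsGreatest (Icc t l ∩ γ ⁻¹' Q.toSet) t' := by
      have hc : ContinuousOn γ (Icc t l) := hcont.mono (Icc_subset_Icc_left ht.1)
      exact (isCompact_Icc.of_isClosed_subset
        (hc.preimage_isClosed_of_isClosed isClosed_Icc Q.isClosed_toSet)
        inter_subset_left).exists_isGreatest ⟨t, ⟨le_rfl, ht.2⟩, htQ⟩
    have ht'0 : t' ∈ Icc 0 l := ⟨ht.1.trans ht'.1, ht'.2⟩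
    have htt' : t < t' := by
      have hIoc : ∀ᶠ u in 𝓝[>] t, u ∈ Ioc t l := Ioc_mem_nhdsGT htl
      obtain ⟨u, huQ, hu⟩ := (hfreq.and_eventually hIoc).exists
      exact hu.1.trans_le (hlast ⟨⟨hu.1.le, hu.2⟩, huQ⟩)
    -- At `t' < l` the curve passes on to a cube other than Q that contains γ t'. An interior point
    -- lies in only one cube, so γ t' is interior to none. At `t' = l` the curve is in `Q₀`.
    have hinv' : ∀ Q' ∈ W, Q' ≠ Q₀ → γ t' ∉ interior Q'.toSet := by
      intro Q' hQ' hne' hint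
      rcases ht'.2.eq_or_lt with heq | hlt
      · rw [heq] at hint
        exact hne' (h.eq_of_mem_interior hQ' h.mem_central hint hγl)
      · obtain ⟨Q₁, hQ₁, ht'Q₁, hfreq₁⟩ := next t' ⟨ht'0.1, hlt⟩
        have e1 := h.eq_of_mem_interior hQ' hQ₁ hint ht'Q₁
        have e2 := h.eq_of_mem_interior hQ' hQ hint ht'Q
        have hIoc : ∀ᶠ u in 𝓝[>] t', u ∈ Ioc t' l := Ioc_mem_nhdsGT hlt
        obtain ⟨u, huQ, hu⟩ := (hfreq₁.and_eventually hIoc).exists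
        rw [← e1, e2] at huQ
        exact absurd (hlast ⟨⟨htt'.le.trans hu.1.le, hu.2⟩, huQ⟩) (not_le.2 hu.1)
    obtain ⟨b, hb, hb', hpath⟩ := DyadicCube.exists_unitPath_shell h.two_le (h.width_le Q hQ)
      htQ (hinv Q hQ hne) ht'Q (hinv' Q hQ hne) a
    have hab := hpath.1
    -- The detour costs at most 24n times the chord, hence at most 24n(t' - t), which preserves the
    -- time bound of the induction.
    have hstep : 24 * n * dist (γ t) (γ t') ≤ 24 * n * (t' - t) :=
      mul_le_mul_of_nonneg_left (dist_le_of_hasUnitSpeedOn hγ ht ht'0 htt'.le) (by positivity)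
    have hpath' : UnitPath D a b (γ t) (γ t') := hpath.mono fun τ hτ z hz =>
      hD Q hQ t ht htQ τ (ha.trans hτ.1) (by linarith [hτ.2]) z hz.1 fun _ => hz
    obtain ⟨b', hb'', hpath''⟩ := ih t' ht'0 b (ha.trans hab) (by linarith) hinv' (by
      refine lt_of_lt_of_le ?_ (Nat.lt_succ_iff.1 hcard)
      refine Set.ncard_lt_ncard ⟨fun Q' hQ' => ?_, fun hsub => ?_⟩ (hfin.subset fun Q' hQ' => ?_)
      · obtain ⟨hQ'W, u, hu, huQ⟩ := hQ'
        exact ⟨hQ'W, u, ⟨htt'.trans hu.1, hu.2⟩, huQ⟩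
      · obtain ⟨-, u, hu, huQ⟩ := hsub ⟨hQ, t', ⟨htt', ht'.2⟩, ht'Q⟩
        exact absurd (hlast ⟨⟨htt'.le.trans hu.1.le, hu.2⟩, huQ⟩) (not_le.2 hu.1)
      · obtain ⟨hQ'W, u, hu, huQ⟩ := hQ'
        exact ⟨hQ'W, u, ⟨ht.1.trans hu.1.le, hu.2⟩, huQ⟩)
    exact ⟨b', hb'', hpath'.trans hpath''⟩

/-- The `s`-version of a `1`-John domain satisfies the `s`-John condition. -/
theorem exists_johnPath {x₀ : EuclideanSpace ℝ (Fin n)} (hx₀ : IsJohnCenter 1 G x₀)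
    (hx₀Q₀ : x₀ ∈ Q₀.toSet) : ∃ C, 0 < C ∧ ∀ x ∈ sVersion s W Q₀, ∃ b, b ≤ C ∧
      UnitPath (JohnCond s C (sVersion s W Q₀)) 0 b x x₀ := by
  obtain ⟨M, hM0, hM⟩ := h.exists_side_le
  obtain ⟨-, c, hc, hJ⟩ := hx₀
  obtain ⟨C₁, hC₁, hstart⟩ := h.exists_path_to_boundary
  have hn1 := h.one_le_n
  have hn0 : (0 : ℝ) < n := by linarith
  -- The elapsed time at γ t is at most (2n(1+c) + 24nc) dist(γ t, ∂G), this distance is at most 5nℓ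
  -- in a cube of side ℓ, and the detour inside the cube adds at most 3nℓ.
  set K : ℝ := (2 * n * (1 + c) + 24 * n * c) * (5 * n) + 3 * n with hK
  have hK0 : 0 < K := by positivity
  -- The last entry bounds the total length: the exit from the first apartment, the detours and the
  -- final segment in `Q₀`.
  set C := max (max C₁ ((20 * n + 1) * (K ^ s * M ^ (s - 1))))
    (2 * n * M + 24 * n * c + n * M) with hCdef
  have hC : 0 < C := hC₁.trans_le ((le_max_left _ _).trans (le_max_left _ _))
  have hCM : (20 * n + 1) * (K ^ s * M ^ (s - 1)) ≤ C :=
    (le_max_right _ _).trans (le_max_left _ _)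
  have hCL : 2 * n * M + 24 * n * c + n * M ≤ C := le_max_right _ _
  have hnM : ∀ Q ∈ W, n * Q.side ≤ n * M := fun Q hQ =>
    mul_le_mul_of_nonneg_left (hM Q hQ) hn0.le
  have far : ∀ Q ∈ W, ∀ z ∈ Q.toSet, (Q ≠ Q₀ → Q.FarFromWalls s z) → ∀ τ, 0 ≤ τ →
      τ ≤ K * Q.side → JohnCond s C (sVersion s W Q₀) τ z := by
    intro Q hQ z hz hfar τ hτ hτ'
    have hl := Q.side_pos
    have hone := h.one_lt
    refine h.johnCond_of_rpow_le hK0 hC hM hCM hQ hz ((h.mem_sVersion_iff hQ hz).2 ?_) hτ hτ'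
      fun hne v hv => ?_
    · by_contra! hcon
      have := (hfar hcon.1).2 z hcon.2
      rw [dist_self] at this
      linarith
    · have h1 := (hfar hne).2 v hv
      have e2 : (K * Q.side) ^ s = K ^ s * Q.side ^ (s - 1) * Q.side := by
        rw [Real.mul_rpow hK0.le hl.le, mul_assoc, ← Real.rpow_add_one hl.ne']; ring_nf
      have h2 : τ ^ s ≤ K ^ s * M ^ (s - 1) * Q.side := by
        calc τ ^ s ≤ (K * Q.side) ^ s := by gcongr
          _ = K ^ s * Q.side ^ (s - 1) * Q.side := e2
          _ ≤ _ := by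
            have := hM Q hQ
            gcongr
      have h3 : 0 ≤ K ^ s * M ^ (s - 1) := by positivity
      calc τ ^ s ≤ K ^ s * M ^ (s - 1) * Q.side := h2
        _ = 8 * (K ^ s * M ^ (s - 1)) * (Q.side / 8) := by ring
        _ ≤ C * dist z v := mul_le_mul (by nlinarith) h1 (by positivity) hC.le
  refine ⟨C, hC, fun x hx => ?_⟩
  by_cases hxQ₀ : x ∈ Q₀.toSet
  · have hd := Q₀.dist_le_of_mem hxQ₀ hx₀Q₀
    have hl := Q₀.side_pos
    have hnl : 0 < n * Q₀.side := by positivity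
    have hncl : 0 < n * M := by positivity
    have h2 : 0 < 24 * n * c := by positivity
    refine ⟨0 + dist x x₀, ?_, UnitPath.of_segment fun θ hθ => ?_⟩
    · linarith [hnM _ h.mem_central]
    · have h1 : θ * dist x x₀ ≤ 1 * dist x x₀ := mul_le_mul_of_nonneg_right hθ.2 dist_nonneg
      refine far Q₀ h.mem_central _ (Q₀.segment_mem hxQ₀ hx₀Q₀ hθ) (fun hne => absurd rfl hne) _
        (by rw [zero_add]; exact mul_nonneg hθ.1 dist_nonneg) ?_
      have h3 : 0 ≤ (2 * n * (1 + c) + 24 * n * c) * (5 * n) * Q₀.side := by positivity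
      rw [hK]
      linarith
  · obtain ⟨Q, hQ, hxQ⟩ := h.exists_mem (h.sVersion_subset hx)
    have hne : Q ≠ Q₀ := fun heq => hxQ₀ (heq ▸ hxQ)
    obtain ⟨y, hyQ, hyQ', a₀, ha₀, ha₀', hpath⟩ := hstart Q hQ hne x hxQ hx
    obtain ⟨l, γ, hl0, hlc, -, hγ, hγG, hγ0, hγl, hγd⟩ := hJ y (h.subset hQ hyQ)
    have hd0 := h.side_le_infDist hQ hyQ
    -- the distance to the boundary along the curve controls both the time and the initial distance
    have hlow : ∀ t ∈ Icc 0 l, a₀ + 24 * n * t ≤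
        (2 * n * (1 + c) + 24 * n * c) * Metric.infDist (γ t) (frontier G) := by
      intro t ht
      have h1 := hγd t ht
      rw [Real.rpow_one, div_le_iff₀ hc] at h1
      have h2 := dist_le_of_hasUnitSpeedOn hγ (left_mem_Icc.2 hl0) ht ht.1
      have h3 := Metric.infDist_le_infDist_add_dist (s := frontier G) (x := γ 0) (y := γ t)
      rw [hγ0] at h2 h3
      have h4 : Q.side ≤ (1 + c) * Metric.infDist (γ t) (frontier G) := by linarith
      have h5 : 2 * n * Q.side ≤ 2 * n * ((1 + c) * Metric.infDist (γ t) (frontier G)) :=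
        mul_le_mul_of_nonneg_left h4 (by positivity)
      have h6 : 24 * n * t ≤ 24 * n * (Metric.infDist (γ t) (frontier G) * c) :=
        mul_le_mul_of_nonneg_left h1 (by positivity)
      linarith
    have hfin : {Q' ∈ W | ∃ u ∈ Icc 0 l, γ u ∈ Q'.toSet}.Finite := by
      have hε : 0 < Q.side / ((1 + c) * (5 * n)) := by
        have := Q.side_pos
        positivity
      refine (h.finite_le_side hε).subset fun Q' hQ' => ⟨hQ'.1, ?_⟩
      obtain ⟨hQ'W, u, hu, huQ'⟩ := hQ'
      rw [div_le_iff₀ (by positivity)]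
      have h1 := hγd u hu
      rw [Real.rpow_one, div_le_iff₀ hc] at h1
      have h2 := dist_le_of_hasUnitSpeedOn hγ (left_mem_Icc.2 hl0) hu hu.1
      have h3 := Metric.infDist_le_infDist_add_dist (s := frontier G) (x := γ 0) (y := γ u)
      rw [hγ0] at h2 h3
      have h4 : Q.side ≤ (1 + c) * Metric.infDist (γ u) (frontier G) := by linarith
      have h5 := mul_le_mul_of_nonneg_left (h.infDist_le hQ'W huQ') (by linarith : 0 ≤ 1 + c)
      linarith
    obtain ⟨b, hb, hpath'⟩ := h.exists_path_along (D := JohnCond s C (sVersion s W Q₀)) (a₀ := a₀)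
      hγ hγG (hγl ▸ hx₀Q₀) hfin (fun Q' hQ' t ht htQ' τ hτ hτ' z hz hfar => by
        refine far Q' hQ' z hz hfar τ hτ ?_
        have h1 := hlow t ht
        have h2 := mul_le_mul_of_nonneg_left (h.infDist_le hQ' htQ')
          (by positivity : 0 ≤ 2 * n * (1 + c) + 24 * n * c)
        rw [hK]
        linarith) _ 0 (left_mem_Icc.2 hl0) a₀ ha₀ (by simp) (fun Q' hQ' _ hint => by
          rw [hγ0] at hint
          obtain rfl := h.eq_of_mem_interior hQ' hQ hint hyQ
          exact hyQ' hint) (Nat.lt_succ_self _)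
    rw [hγ0, hγl] at hpath'
    refine ⟨b, hb.trans (le_trans ?_ hCL), (hpath.mono fun t _ z hz => hz.mono
      ((le_max_left _ _).trans (le_max_left _ _))).trans hpath'⟩
    have h1 := hnM Q hQ
    have h2 := hnM Q₀ h.mem_central
    have h3 : 24 * n * l ≤ 24 * n * c := mul_le_mul_of_nonneg_left hlc (by positivity)
    linarith

theorem isJohnDomain_sVersion {x₀ : EuclideanSpace ℝ (Fin n)} (hx₀ : IsJohnCenter 1 G x₀)
    (hx₀Q₀ : x₀ ∈ Q₀.toSet) : IsJohnDomain s (sVersion s W Q₀) := by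
  obtain ⟨C, hC, hpath⟩ := h.exists_johnPath hx₀ hx₀Q₀
  have hmem : x₀ ∈ sVersion s W Q₀ := Or.inl hx₀Q₀
  refine ⟨h.isOpen_sVersion, ⟨⟨x₀, hmem⟩, ?_⟩, h.isBounded_sVersion, x₀, hmem, C, hC,
    fun x hx => ?_⟩
  · refine isPreconnected_of_forall x₀ fun x hx => ?_
    obtain ⟨b, -, hb0, γ, hγ, hγ0, hγb, hD⟩ := hpath x hx
    refine ⟨γ '' Icc 0 b, ?_, ⟨b, right_mem_Icc.2 hb0, hγb⟩, ⟨0, left_mem_Icc.2 hb0, hγ0⟩,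
      isPreconnected_Icc.image _ (continuousOn_of_hasUnitSpeedOn hγ)⟩
    rintro _ ⟨t, ht, rfl⟩
    exact (hD t ht).1
  · obtain ⟨b, hbC, hb0, γ, hγ, hγ0, hγb, hD⟩ := hpath x hx
    exact ⟨b, γ, hb0, hbC, continuousOn_of_hasUnitSpeedOn hγ, hγ, fun t ht => (hD t ht).1, hγ0, hγb,
      fun t ht => (div_le_iff₀' hC).2 (hD t ht).2⟩

end IsApartmentSetting

end Chain

/-! ### The Minkowski dimension of the boundary -/

section Dimension

variable {n : ℕ} {s : ℝ} {G : Set (EuclideanSpace ℝ (Fin n))} {W : Set (DyadicCube n)}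
  {Q₀ : DyadicCube n}

theorem upperMinkowskiDim_mono {E F : Set (EuclideanSpace ℝ (Fin n))} (hEF : E ⊆ F) :
    upperMinkowskiDim E ≤ upperMinkowskiDim F := by
  refine iSup₂_le fun μ hμ => le_iSup₂_of_le μ ?_ le_rfl
  refine top_le_iff.1 (hμ.ge.trans (limsup_le_limsup (Eventually.of_forall fun r => ?_)))
  exact ENNReal.div_le_div_right (measure_mono (Metric.thickening_subset_of_subset r hEF)) _

/-- Small radii are covered by the finite limsup. On the remaining compact range of radii the volume
is bounded and the power of r is bounded below. -/
theorem exists_volume_thickening_le {E : Set (EuclideanSpace ℝ (Fin n))}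
    (hE : Bornology.IsBounded E) {μ : ℝ}
    (hμ : limsup (fun r : ℝ => minkowskiPrecontent μ E r) (𝓝[>] 0) ≠ ∞) (R : ℝ) :
    ∃ C : ℝ≥0, ∀ r, 0 < r → r ≤ R →
      volume (Metric.thickening r E) ≤ C * ENNReal.ofReal (r ^ ((n : ℝ) - μ)) := by
  obtain ⟨C₁, hC₁, -⟩ := ENNReal.lt_iff_exists_nnreal_btwn.1 (lt_top_iff_ne_top.2 hμ)
  have hev := eventually_lt_of_limsup_lt hC₁
  obtain ⟨r₀, hr₀, hsub⟩ := mem_nhdsGT_iff_exists_Ioo_subset.1 hev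
  have hr₀ : 0 < r₀ := hr₀
  have hvol : volume (Metric.thickening R E) ≠ ∞ := hE.thickening.measure_lt_top.ne
  obtain ⟨m, hm, hmr⟩ : ∃ m : ℝ, 0 < m ∧ ∀ r, r₀ ≤ r → r ≤ R → m ≤ r ^ ((n : ℝ) - μ) := by
    by_cases hR : r₀ ≤ R
    · refine ⟨min (r₀ ^ ((n : ℝ) - μ)) (R ^ ((n : ℝ) - μ)), lt_min (Real.rpow_pos_of_pos hr₀ _)
        (Real.rpow_pos_of_pos (hr₀.trans_le hR) _), fun r h1 h2 => ?_⟩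
      rcases le_total 0 ((n : ℝ) - μ) with hexp | hexp
      · exact (min_le_left _ _).trans (Real.rpow_le_rpow hr₀.le h1 hexp)
      · exact (min_le_right _ _).trans
          (Real.rpow_le_rpow_of_nonpos (hr₀.trans_le h1) h2 hexp)
    · exact ⟨1, one_pos, fun r h1 h2 => absurd (h1.trans h2) hR⟩
  refine ⟨max C₁ ((volume (Metric.thickening R E)).toNNReal / m.toNNReal), fun r hr hrR => ?_⟩
  have hpos : 0 < r ^ ((n : ℝ) - μ) := Real.rpow_pos_of_pos hr _
  rcases lt_or_ge r r₀ with hlt | hge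
  · have h1 : minkowskiPrecontent μ E r < C₁ := hsub ⟨hr, hlt⟩
    rw [minkowskiPrecontent, ENNReal.div_lt_iff (Or.inl (by simpa using hpos)) (Or.inl (by simp))]
      at h1
    refine h1.le.trans (mul_le_mul_left ?_ _)
    exact_mod_cast le_max_left _ _
  · calc volume (Metric.thickening r E) ≤ volume (Metric.thickening R E) :=
          measure_mono (Metric.thickening_mono hrR E)
      _ = ((volume (Metric.thickening R E)).toNNReal / m.toNNReal : ℝ≥0) * ENNReal.ofReal m := by
          rw [ENNReal.ofReal, ← ENNReal.coe_mul, div_mul_cancel₀ _ (by simpa using hm),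
            ENNReal.coe_toNNReal hvol]
      _ ≤ _ := by
          gcongr
          · exact le_max_right _ _
          · exact hmr r hge hrR

/-- The neighbourhood of the boundary of a box with sides of length at most `L`. -/
theorem volume_thickening_frontier_openBox_le {a b : Fin n → ℝ} (hab : ∀ i, a i < b i) {L r : ℝ}
    (hL : ∀ i, b i - a i ≤ L) (hrL : r ≤ L) :
    volume (Metric.thickening r (frontier (openBox a b))) ≤
      n * (2 * (ENNReal.ofReal (2 * r) * ENNReal.ofReal (3 * L) ^ (n - 1))) := by
  let F : Fin n → ℝ → Set (EuclideanSpace ℝ (Fin n)) := fun i c =>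
    closedBox (fun j => if j = i then c - r else a j - r) fun j => if j = i then c + r else b j + r
  have hF : ∀ i c, volume (F i c) ≤ ENNReal.ofReal (2 * r) * ENNReal.ofReal (3 * L) ^ (n - 1) := by
    intro i c
    rw [volume_closedBox, ← Finset.mul_prod_erase _ _ (Finset.mem_univ i)]
    refine mul_le_mul' (ENNReal.ofReal_le_ofReal (by simp; linarith)) ?_
    have hcard : (Finset.univ.erase i).card = n - 1 := by simp
    rw [← hcard, ← Finset.prod_const]
    refine Finset.prod_le_prod' fun j hj => ENNReal.ofReal_le_ofReal ?_
    simp only [(Finset.mem_erase.1 hj).1, if_false]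
    linarith [hL j]
  have hsub : Metric.thickening r (frontier (openBox a b)) ⊆
      ⋃ i ∈ (Finset.univ : Finset (Fin n)), (F i (a i) ∪ F i (b i)) := by
    intro z hz
    obtain ⟨v, hv, hzv⟩ := Metric.mem_thickening_iff.1 hz
    rw [frontier_openBox hab] at hv
    have hco : ∀ j, -r ≤ z j - v j ∧ z j - v j ≤ r := fun j =>
      abs_le.1 ((abs_sub_le_dist z v j).trans hzv.le)
    have hmem : ∀ i c, v i = c → z ∈ F i c := by
      intro i c hc j
      have := hco j
      have := hv.1 j
      by_cases hji : j = i
      · subst hji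
        simp only [if_true]
        constructor <;> linarith
      · simp only [hji, if_false]
        constructor <;> linarith
    obtain ⟨i, hi⟩ : ∃ i, v i = a i ∨ v i = b i := by
      by_contra! hcon
      exact hv.2 fun i => ⟨lt_of_le_of_ne (hv.1 i).1 (hcon i).1.symm,
        lt_of_le_of_ne (hv.1 i).2 (hcon i).2⟩
    simp only [Finset.mem_univ, iUnion_true, mem_iUnion]
    exact ⟨i, hi.imp (hmem i _) (hmem i _)⟩
  calc volume (Metric.thickening r (frontier (openBox a b)))
      ≤ ∑ i : Fin n, volume (F i (a i) ∪ F i (b i)) :=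
        (measure_mono hsub).trans (measure_biUnion_finset_le _ _)
    _ ≤ ∑ _i : Fin n, 2 * (ENNReal.ofReal (2 * r) * ENNReal.ofReal (3 * L) ^ (n - 1)) := by
        refine Finset.sum_le_sum fun i _ => (measure_union_le _ _).trans ?_
        rw [two_mul]
        exact add_le_add (hF _ _) (hF _ _)
    _ = _ := by simp

/-- The walls lie on the boundaries of two boxes with sides at most ℓ. The bound is a multiple of
the volume of the open cube so that it can be summed over disjoint interiors. -/
theorem DyadicCube.volume_thickening_walls_le {Q : DyadicCube n}
    (hw : (Q.side / 8) ^ s ≤ Q.side / 32) {r : ℝ} (hr : 0 < r) (hrQ : r ≤ Q.side) :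
    volume (Metric.thickening r (Q.walls s)) ≤
      (8 * n * 3 ^ (n - 1) : ℝ≥0) *
        (ENNReal.ofReal (r / Q.side) * volume (interior Q.toSet)) := by
  have hl := Q.side_pos
  have hw0 := Q.width_pos s
  rcases Nat.eq_zero_or_pos n with rfl | hn
  · have : Metric.thickening r (Q.walls s) = ∅ := by
      have : Q.walls s = ∅ := eq_empty_of_forall_notMem fun v hv => hv.2 fun i => i.elim0
      rw [this, Metric.thickening_empty]
    simp [this]
  have hsub : Metric.thickening r (Q.walls s) ⊆ Metric.thickening r (frontier Q.room) ∪
      Metric.thickening r (frontier (Q.passage s)) := by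
    rw [← Metric.thickening_union]
    exact Metric.thickening_subset_of_subset r sdiff_subset
  have h1 : volume (Metric.thickening r (frontier Q.room)) ≤
      n * (2 * (ENNReal.ofReal (2 * r) * ENNReal.ofReal (3 * Q.side) ^ (n - 1))) := by
    rw [room_eq_openBox]
    exact volume_thickening_frontier_openBox_le (fun i => by linarith) (fun i => by linarith) hrQ
  have h2 : volume (Metric.thickening r (frontier (Q.passage s))) ≤
      n * (2 * (ENNReal.ofReal (2 * r) * ENNReal.ofReal (3 * Q.side) ^ (n - 1))) := by
    rw [passage, corridor_eq_openBox]
    refine volume_thickening_frontier_openBox_le (fun i => ?_) (fun i => ?_) hrQ <;>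
      split_ifs <;> linarith
  refine (measure_mono hsub).trans ((measure_union_le _ _).trans ((add_le_add h1 h2).trans
    (le_of_eq ?_)))
  have e1 : ENNReal.ofReal (2 * r) = 2 * ENNReal.ofReal (r / Q.side) * ENNReal.ofReal Q.side := by
    rw [mul_assoc, ← ENNReal.ofReal_mul (by positivity), div_mul_cancel₀ _ hl.ne',
      ENNReal.ofReal_mul (by norm_num), ENNReal.ofReal_ofNat]
  have e2 : ENNReal.ofReal (3 * Q.side) = 3 * ENNReal.ofReal Q.side := by
    rw [ENNReal.ofReal_mul (by norm_num), ENNReal.ofReal_ofNat]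
  have e3 : ENNReal.ofReal Q.side ^ n = ENNReal.ofReal Q.side * ENNReal.ofReal Q.side ^ (n - 1) := by
    rw [← pow_succ', Nat.sub_add_cancel hn]
  rw [volume_interior_toSet, e1, e2, e3, mul_pow]
  push_cast
  ring

namespace IsApartmentSetting

variable (h : IsApartmentSetting s G W Q₀)
include h

theorem toSet_subset_thickening {Q : DyadicCube n} (hQ : Q ∈ W) {ρ : ℝ} (hρ : Q.side ≤ ρ) :
    Q.toSet ⊆ Metric.thickening (6 * n * ρ) (frontier G) := fun z hz => by
  have hn0 : (0 : ℝ) < n := by linarith [h.one_le_n]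
  rw [Metric.mem_thickening_iff_infDist_lt h.frontier_nonempty]
  have h1 := h.infDist_le hQ hz
  have h2 := Q.side_pos
  have h3 : n * Q.side ≤ n * ρ := mul_le_mul_of_nonneg_left hρ hn0.le
  have h4 : 0 < n * Q.side := by positivity
  linarith

/-- The neighbourhood of the walls in all cubes of one generation. -/
theorem volume_thickening_walls_le {k : ℤ} {r : ℝ} (hr : 0 < r) (hrk : r ≤ 2 ^ (-k)) :
    volume (⋃ Q ∈ cubesOfGen W k, Metric.thickening r (Q.walls s)) ≤
      (8 * n * 3 ^ (n - 1) : ℝ≥0) * (ENNReal.ofReal (r / 2 ^ (-k)) *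
        volume (Metric.thickening (6 * n * 2 ^ (-k)) (frontier G))) := by
  have hfin := h.finite_cubesOfGen k
  have hside : ∀ Q ∈ cubesOfGen W k, Q.side = 2 ^ (-k) := fun Q hQ => by
    rw [DyadicCube.side, hQ.2]
  have hcov : volume (⋃ Q ∈ hfin.toFinset, interior Q.toSet) =
      ∑ Q ∈ hfin.toFinset, volume (interior Q.toSet) := by
    refine measure_biUnion_finset (fun Q hQ Q' hQ' hne => ?_)
      fun Q _ => isOpen_interior.measurableSet
    simp only [Finite.coe_toFinset] at hQ hQ'
    exact h.whitney.disjoint_interior hQ.1 hQ'.1 hne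
  calc volume (⋃ Q ∈ cubesOfGen W k, Metric.thickening r (Q.walls s))
      = volume (⋃ Q ∈ hfin.toFinset, Metric.thickening r (Q.walls s)) := by simp
    _ ≤ ∑ Q ∈ hfin.toFinset, volume (Metric.thickening r (Q.walls s)) :=
        measure_biUnion_finset_le _ _
    _ ≤ ∑ Q ∈ hfin.toFinset, (8 * n * 3 ^ (n - 1) : ℝ≥0) *
          (ENNReal.ofReal (r / 2 ^ (-k)) * volume (interior Q.toSet)) := by
        refine Finset.sum_le_sum fun Q hQ => ?_
        rw [Finite.mem_toFinset] at hQ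
        rw [← hside Q hQ]
        exact DyadicCube.volume_thickening_walls_le (h.width_le Q hQ.1) hr
          (by rw [hside Q hQ]; exact hrk)
    _ = (8 * n * 3 ^ (n - 1) : ℝ≥0) * (ENNReal.ofReal (r / 2 ^ (-k)) *
          volume (⋃ Q ∈ hfin.toFinset, interior Q.toSet)) := by
        rw [hcov, Finset.mul_sum, Finset.mul_sum]
    _ ≤ _ := by
        gcongr
        refine iUnion₂_subset fun Q hQ => ?_
        rw [Finite.mem_toFinset] at hQ
        exact interior_subset.trans (h.toSet_subset_thickening hQ.1 (hside Q hQ).le)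

/-- A cube of side less than r lies within 6nr of ∂G, walls included. Any other side is dyadic and
exceeds 2^m, hence equals 2^(m+1+j) with j ≥ 0. -/
theorem thickening_frontier_sVersion_subset {r : ℝ} {m : ℤ}
    (hm : r ∈ Ioc ((2 : ℝ) ^ m) (2 ^ (m + 1))) :
    Metric.thickening r (frontier (sVersion s W Q₀)) ⊆
      Metric.thickening ((6 * n + 1) * r) (frontier G) ∪
      ⋃ j : ℕ, ⋃ Q ∈ cubesOfGen W (-(m + 1 + j)), Metric.thickening r (Q.walls s) := by
  have hr : 0 < r := (zpow_pos two_pos m).trans hm.1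
  intro z hz
  obtain ⟨v, hv, hzv⟩ := Metric.mem_thickening_iff.1 hz
  rcases h.frontier_sVersion_subset hv with hv | ⟨Q, hQ, -, hv⟩
  · refine Or.inl (Metric.mem_thickening_iff.2 ⟨v, hv, hzv.trans_le ?_⟩)
    have : 0 ≤ n * r := by positivity
    linarith
  · rcases lt_or_ge Q.side r with hlt | hge
    · obtain ⟨w, hw, hvw⟩ := Metric.mem_thickening_iff.1 (h.toSet_subset_thickening hQ hlt.le
        (interior_subset (DyadicCube.walls_subset_interior (h.width_le Q hQ) hv)))
      refine Or.inl (Metric.mem_thickening_iff.2 ⟨w, hw, ?_⟩)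
      linarith [dist_triangle z v w]
    · have h1 : m < -Q.gen := (zpow_lt_zpow_iff_right₀ one_lt_two).1 (hm.1.trans_le hge)
      refine Or.inr (mem_iUnion.2 ⟨(-Q.gen - (m + 1)).toNat, mem_biUnion (x := Q) ⟨hQ, ?_⟩
        (Metric.mem_thickening_iff.2 ⟨v, hv, hzv⟩)⟩)
      omega

theorem limsup_minkowskiPrecontent_frontier_ne_top {μ : ℝ} (hμn : (n : ℝ) - 1 < μ)
    (hμ : limsup (fun r : ℝ => minkowskiPrecontent μ (frontier G) r) (𝓝[>] 0) ≠ ∞) :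
    limsup (fun r : ℝ => minkowskiPrecontent μ (frontier (sVersion s W Q₀)) r) (𝓝[>] 0) ≠ ∞ := by
  obtain ⟨M, hM0, hM⟩ := h.exists_side_le
  have hn1 := h.one_le_n
  have hn0 : (0 : ℝ) < n := by linarith
  -- The radii needed are 6nρ for sides ρ ≤ M of actual cubes, and (6n+1)r with r ≤ 1.
  obtain ⟨C, hC⟩ := exists_volume_thickening_le
    (h.isBounded.closure.subset frontier_subset_closure) hμ (max (6 * n * M) (6 * n + 1))
  -- Ratio of the geometric series over generations; it is below 1 because μ > n - 1.
  set q : ℝ := 2 ^ ((n : ℝ) - 1 - μ) with hq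
  have hq0 : 0 < q := Real.rpow_pos_of_pos two_pos _
  have hq1 : q < 1 := Real.rpow_lt_one_of_one_lt_of_neg one_lt_two (by linarith)
  set A : ℝ≥0 := 8 * n * 3 ^ (n - 1) with hA
  set B : ℝ≥0∞ := C * ENNReal.ofReal ((6 * n + 1) ^ ((n : ℝ) - μ)) +
    A * C * ENNReal.ofReal ((6 * n) ^ ((n : ℝ) - μ)) * (1 - ENNReal.ofReal q)⁻¹ with hB
  have hBtop : B ≠ ∞ := by
    have : (1 - ENNReal.ofReal q)⁻¹ ≠ ∞ := by
      simp only [ne_eq, ENNReal.inv_eq_top, tsub_eq_zero_iff_le, not_le]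
      simpa using hq1
    rw [hB]
    finiteness
  have key : ∀ r, 0 < r → r ≤ 1 → volume (Metric.thickening r (frontier (sVersion s W Q₀))) ≤
      B * ENNReal.ofReal (r ^ ((n : ℝ) - μ)) := by
    intro r hr hr1
    obtain ⟨m, hm⟩ := exists_mem_Ioc_zpow hr one_lt_two
    have hgen : ∀ j : ℕ, volume (⋃ Q ∈ cubesOfGen W (-(m + 1 + j)), Metric.thickening r (Q.walls s))
        ≤ A * C * ENNReal.ofReal ((6 * n) ^ ((n : ℝ) - μ)) * ENNReal.ofReal (r ^ ((n : ℝ) - μ)) *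
          ENNReal.ofReal q ^ j := by
      intro j
      rcases (cubesOfGen W (-(m + 1 + j))).eq_empty_or_nonempty with hemp | ⟨Q, hQ⟩
      · rw [hemp]; simp
      have hρM : (2 : ℝ) ^ (m + 1 + (j : ℤ)) ≤ M := by
        have := hM Q hQ.1
        rwa [DyadicCube.side, hQ.2, neg_neg] at this
      have hρj : (2 : ℝ) ^ (m + 1 + (j : ℤ)) = 2 ^ (m + 1) * 2 ^ j := by
        rw [zpow_add₀ two_ne_zero, zpow_natCast]
      have hj1 : (1 : ℝ) ≤ 2 ^ j := one_le_pow₀ one_le_two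
      have hρr : r * 2 ^ j ≤ (2 : ℝ) ^ (m + 1 + (j : ℤ)) := by
        rw [hρj]
        exact mul_le_mul_of_nonneg_right hm.2 (by positivity)
      have hle := h.volume_thickening_walls_le (k := -(m + 1 + j)) hr
        (by rw [neg_neg]; nlinarith)
      rw [neg_neg] at hle
      set ρ : ℝ := (2 : ℝ) ^ (m + 1 + (j : ℤ)) with hρ
      have hρ0 : 0 < ρ := zpow_pos two_pos _
      refine hle.trans ?_
      have h1 := hC (6 * n * ρ) (by positivity)
        (le_max_of_le_left (mul_le_mul_of_nonneg_left hρM (by positivity)))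
      have h2 : r / ρ * ρ ^ ((n : ℝ) - μ) ≤ r ^ ((n : ℝ) - μ) * q ^ j := by
        have e1 : r / ρ * ρ ^ ((n : ℝ) - μ) = r * ρ ^ ((n : ℝ) - 1 - μ) := by
          rw [show (n : ℝ) - 1 - μ = (n : ℝ) - μ - 1 by ring, Real.rpow_sub_one hρ0.ne']
          ring
        have e2 : r ^ ((n : ℝ) - μ) * q ^ j = r * (r * 2 ^ j) ^ ((n : ℝ) - 1 - μ) := by
          rw [Real.mul_rpow hr.le (by positivity), hq, ← Real.rpow_natCast, ← Real.rpow_natCast,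
            ← Real.rpow_mul two_pos.le, ← Real.rpow_mul two_pos.le, mul_comm _ (j : ℝ),
            show (n : ℝ) - 1 - μ = (n : ℝ) - μ - 1 by ring, Real.rpow_sub_one hr.ne']
          field_simp
        rw [e1, e2]
        exact mul_le_mul_of_nonneg_left
          (Real.rpow_le_rpow_of_nonpos (by positivity) hρr (by linarith)) hr.le
      calc (A : ℝ≥0∞) * (ENNReal.ofReal (r / ρ) *
            volume (Metric.thickening (6 * n * ρ) (frontier G)))
          ≤ A * (ENNReal.ofReal (r / ρ) * (C * ENNReal.ofReal ((6 * n * ρ) ^ ((n : ℝ) - μ)))) := by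
            gcongr
        _ = A * C * ENNReal.ofReal ((6 * n) ^ ((n : ℝ) - μ)) *
            ENNReal.ofReal (r / ρ * ρ ^ ((n : ℝ) - μ)) := by
            rw [Real.mul_rpow (by positivity) hρ0.le, ENNReal.ofReal_mul (by positivity),
              ENNReal.ofReal_mul (by positivity)]
            ring
        _ ≤ A * C * ENNReal.ofReal ((6 * n) ^ ((n : ℝ) - μ)) *
            ENNReal.ofReal (r ^ ((n : ℝ) - μ) * q ^ j) := by
            gcongr
        _ = _ := by
            rw [ENNReal.ofReal_mul (by positivity), ENNReal.ofReal_pow hq0.le]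
            ring
    calc volume (Metric.thickening r (frontier (sVersion s W Q₀)))
        ≤ volume (Metric.thickening ((6 * n + 1) * r) (frontier G)) +
          ∑' j : ℕ, volume (⋃ Q ∈ cubesOfGen W (-(m + 1 + j)), Metric.thickening r (Q.walls s)) :=
          (measure_mono (h.thickening_frontier_sVersion_subset hm)).trans
            ((measure_union_le _ _).trans (add_le_add_right (measure_iUnion_le _) _))
      _ ≤ C * ENNReal.ofReal (((6 * n + 1) * r) ^ ((n : ℝ) - μ)) +
          ∑' j : ℕ, A * C * ENNReal.ofReal ((6 * n) ^ ((n : ℝ) - μ)) *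
            ENNReal.ofReal (r ^ ((n : ℝ) - μ)) * ENNReal.ofReal q ^ j :=
          add_le_add (hC _ (by positivity) (le_max_of_le_right (by nlinarith)))
            (ENNReal.tsum_le_tsum hgen)
      _ = _ := by
          rw [ENNReal.tsum_mul_left, ENNReal.tsum_geometric,
            Real.mul_rpow (by positivity) hr.le, ENNReal.ofReal_mul (by positivity), hB]
          ring
  refine ne_top_of_le_ne_top hBtop (limsup_le_of_le (h := ?_))
  filter_upwards [Ioc_mem_nhdsGT (zero_lt_one' ℝ)] with r hr
  exact ENNReal.div_le_of_le_mul (key r hr.1 hr.2)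

/-- Every μ > λ also exceeds n - 1, so finiteness of the limsup passes from ∂G to the larger
boundary. -/
theorem upperMinkowskiDim_frontier_sVersion {lam : ℝ} (hlam : (n : ℝ) - 1 ≤ lam)
    (hdim : upperMinkowskiDim (frontier G) = ENNReal.ofReal lam) :
    upperMinkowskiDim (frontier (sVersion s W Q₀)) = ENNReal.ofReal lam := by
  refine le_antisymm (iSup₂_le fun μ hμ => ?_) (hdim ▸ upperMinkowskiDim_mono h.frontier_subset)
  by_contra! hlt
  have hlt' : lam < μ := by
    rwa [← ENNReal.ofReal_coe_nnreal, ENNReal.ofReal_lt_ofReal_iff_of_nonneg] at hlt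
    linarith [h.one_le_n]
  refine h.limsup_minkowskiPrecontent_frontier_ne_top (by linarith) (fun htop => ?_) hμ
  rw [← hdim] at hlt
  exact absurd (le_iSup₂_of_le (f := fun (μ : ℝ≥0) (_ : limsup (fun r : ℝ =>
    minkowskiPrecontent (μ : ℝ) (frontier G) r) (𝓝[>] 0) = ∞) => (μ : ℝ≥0∞)) μ htop le_rfl)
    (not_le.2 hlt)

end IsApartmentSetting

end Dimension

/-! ### The bump functions and where they vary -/

section Bump

variable {n : ℕ} {s : ℝ} {G : Set (EuclideanSpace ℝ (Fin n))} {W : Set (DyadicCube n)}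
  {Q₀ : DyadicCube n}

namespace DyadicCube

variable {Q : DyadicCube n} {last : Fin n} {x y z : EuclideanSpace ℝ (Fin n)}

/-- The function of the last coordinate that decreases linearly from `1` to `0` along the
passage. -/
noncomputable def ramp (Q : DyadicCube n) (last : Fin n) (x : EuclideanSpace ℝ (Fin n)) : ℝ :=
  max 0 (min 1 ((Q.mid last + Q.side / 4 - x last) / (Q.side / 8)))

/-- The room together with the passage and its lower opening. -/
def suite (s : ℝ) (Q : DyadicCube n) (last : Fin n) : Set (EuclideanSpace ℝ (Fin n)) :=
  Q.room ∪ (Q.longPassage s ∩ {x | x last < Q.mid last + Q.side / 4})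

/-- The function that is `1` in the room, decreases to `0` along the passage and vanishes
elsewhere. -/
noncomputable def bump (s : ℝ) (Q : DyadicCube n) (last : Fin n) :
    EuclideanSpace ℝ (Fin n) → ℝ :=
  (Q.suite s last).indicator (Q.ramp last)

theorem continuous_ramp : Continuous (Q.ramp last) := by
  unfold ramp
  fun_prop

theorem ramp_nonneg : 0 ≤ Q.ramp last x := le_max_left _ _

theorem ramp_le_one : Q.ramp last x ≤ 1 := max_le zero_le_one (min_le_left _ _)

theorem ramp_eq_one (hx : x last ≤ Q.mid last + Q.side / 8) : Q.ramp last x = 1 := by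
  have hl := Q.side_pos
  rw [ramp, min_eq_left, max_eq_right zero_le_one]
  rw [one_le_div (by positivity)]
  linarith

theorem ramp_eq_zero (hx : Q.mid last + Q.side / 4 ≤ x last) : Q.ramp last x = 0 := by
  have hl := Q.side_pos
  exact max_eq_left ((min_le_right _ _).trans
    (div_nonpos_of_nonpos_of_nonneg (by linarith) (by positivity)))

theorem abs_ramp_sub_le : |Q.ramp last x - Q.ramp last y| ≤ 8 / Q.side * dist x y := by
  have hl := Q.side_pos
  calc |Q.ramp last x - Q.ramp last y|
      ≤ |(Q.mid last + Q.side / 4 - x last) / (Q.side / 8) -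
          (Q.mid last + Q.side / 4 - y last) / (Q.side / 8)| := by
        refine (abs_max_sub_max_le_max _ _ _ _).trans ?_
        rw [sub_self, abs_zero]
        refine max_le (abs_nonneg _) ((abs_min_sub_min_le_max _ _ _ _).trans ?_)
        rw [sub_self, abs_zero]
        exact max_le (abs_nonneg _) le_rfl
    _ = 8 / Q.side * |x last - y last| := by
        rw [← sub_div, abs_div, abs_of_pos (by positivity : 0 < Q.side / 8),
          sub_sub_sub_cancel_left, abs_sub_comm]
        field_simp
    _ ≤ _ := mul_le_mul_of_nonneg_left (abs_sub_le_dist x y last) (by positivity)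

theorem isOpen_suite : IsOpen (Q.suite s last) :=
  Q.isOpen_room.union ((Q.isOpen_corridor s _ _).inter
    (isOpen_lt (by fun_prop) continuous_const))

theorem measurable_bump : Measurable (Q.bump s last) :=
  continuous_ramp.measurable.indicator isOpen_suite.measurableSet

theorem bump_nonneg : 0 ≤ Q.bump s last x := indicator_nonneg (fun _ _ => ramp_nonneg) _

theorem bump_le_one : Q.bump s last x ≤ 1 :=
  indicator_le' (fun _ _ => ramp_le_one) (fun _ _ => zero_le_one) x

theorem bump_eq_one (hx : x ∈ Q.room) : Q.bump s last x = 1 := by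
  rw [bump, indicator_of_mem (show x ∈ Q.suite s last from Or.inl hx)]
  exact ramp_eq_one (by linarith [(abs_lt.1 (hx last)).2])

theorem suite_subset_interior (hw : (Q.side / 8) ^ s ≤ Q.side / 32) :
    Q.suite s last ⊆ interior Q.toSet := by
  rintro v (hv | hv)
  · exact Q.mem_interior_iff.2 fun i => by linarith [hv i, Q.side_pos]
  · exact longPassage_subset hw hv.1

theorem bump_eq_zero_of_not_mem (hw : (Q.side / 8) ^ s ≤ Q.side / 32)
    (hx : x ∉ interior Q.toSet) : Q.bump s last x = 0 :=
  indicator_of_notMem (fun hx' => hx (suite_subset_interior hw hx')) _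

/-- An open cube below the room. -/
def cellar (Q : DyadicCube n) (last : Fin n) : Set (EuclideanSpace ℝ (Fin n)) :=
  openBox (fun i => Q.mid i - if i = last then 3 * Q.side / 8 else Q.side / 8)
    fun i => Q.mid i + if i = last then -(Q.side / 8) else Q.side / 8

theorem lt_of_mem_cellar (hx : x ∈ Q.cellar last) : x last < Q.mid last - Q.side / 8 := by
  have := (hx last).2
  simp only [if_true] at this
  linarith

theorem cellar_subset_interior : Q.cellar last ⊆ interior Q.toSet := fun x hx =>
  Q.mem_interior_iff.2 fun i => by
    have hl := Q.side_pos
    have := hx i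
    dsimp only at this
    rw [abs_lt]
    split_ifs at this <;> constructor <;> linarith

theorem bump_eq_zero_of_mem_cellar (hlast : (last : ℕ) + 1 = n) (hx : x ∈ Q.cellar last) :
    Q.bump s last x = 0 := by
  have h1 := lt_of_mem_cellar hx
  have hl := Q.side_pos
  refine indicator_of_notMem ?_ _
  rintro (hx' | hx')
  · linarith [(abs_lt.1 (hx' last)).1]
  · linarith [((hx'.1 last).2 hlast).1]

/-- The cellar is as large as the room, so the two are interchangeable in the lower bound for the
oscillation. -/
theorem volume_cellar : volume (Q.cellar last) = ENNReal.ofReal (Q.side / 4) ^ n := by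
  rw [cellar, volume_openBox]
  calc _ = ∏ _i : Fin n, ENNReal.ofReal (Q.side / 4) :=
        Finset.prod_congr rfl fun i _ => by split_ifs <;> ring_nf
    _ = _ := by simp

theorem volume_room : volume Q.room = ENNReal.ofReal (Q.side / 4) ^ n := by
  rw [room_eq_openBox, volume_openBox]
  calc _ = ∏ _i : Fin n, ENNReal.ofReal (Q.side / 4) :=
        Finset.prod_congr rfl fun i _ => by ring_nf
    _ = _ := by simp

theorem lateral_of_ne (hlast : (last : ℕ) + 1 = n) {i : Fin n} (hi : i ≠ last) :
    (i : ℕ) + 1 < n := by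
  have : (i : ℕ) ≠ last := fun h => hi (Fin.ext h)
  omega

theorem room_subset_interior : Q.room ⊆ interior Q.toSet := fun v hv =>
  Q.mem_interior_iff.2 fun i => by linarith [hv i, Q.side_pos]

end DyadicCube

namespace IsApartmentSetting

variable (h : IsApartmentSetting s G W Q₀) {Q : DyadicCube n} (hQ : Q ∈ W) (hne : Q ≠ Q₀)
  {last : Fin n} (hlast : (last : ℕ) + 1 = n) {x y z : EuclideanSpace ℝ (Fin n)}
include h hQ

theorem room_subset_sVersion : Q.room ⊆ sVersion s W Q₀ := fun z hz =>
  (h.mem_sVersion_iff hQ (interior_subset (DyadicCube.room_subset_interior hz))).2 (Or.inr fun hw => by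
    obtain ⟨i, hi⟩ := DyadicCube.exists_side_le_of_mem_walls (h.width_le Q hQ) hw
    exact absurd (hz i) (not_lt.2 hi))

include hlast in
theorem cellar_subset_sVersion : Q.cellar last ⊆ sVersion s W Q₀ := fun z hz =>
  (h.mem_sVersion_iff hQ (interior_subset (DyadicCube.cellar_subset_interior hz))).2
    (Or.inr fun hw => by
      have hl := Q.side_pos
      have h1 := DyadicCube.lt_of_mem_cellar hz
      rcases DyadicCube.mem_closure_of_mem_walls hw with h2 | h2
      · linarith [(abs_le.1 (Q.mem_closure_room_iff.1 h2 last)).1]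
      · linarith [(((Q.mem_closure_corridor_iff s (by linarith)).1 h2 last).2 hlast).1])

include hne

theorem mem_longPassage_of_mem_frontier (hz : z ∈ sVersion s W Q₀)
    (hz' : z ∈ frontier Q.room ∪ frontier (Q.passage s)) : z ∈ Q.longPassage s := by
  have hl := Q.side_pos
  have hw := h.width_le Q hQ
  have hzQ : z ∈ Q.toSet := by
    refine Q.mem_toSet_iff.2 fun i => ?_
    rcases hz' with h1 | h1
    · linarith [Q.mem_closure_room_iff.1 h1.1 i]
    · have h2 := (Q.mem_closure_corridor_iff s (by linarith)).1 h1.1 i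
      rcases (show (i : ℕ) + 1 < n ∨ (i : ℕ) + 1 = n by omega) with hi | hi
      · linarith [h2.1 hi]
      · have := h2.2 hi
        rw [abs_le]
        constructor <;> linarith
  have := ((h.mem_sVersion_iff hQ hzQ).1 hz).resolve_left hne
  by_contra hL
  exact this ⟨hz', hL⟩

include hlast

/-- The long passage lies above the midpoint and is narrower than the room, so it opens the room
only at the top. -/
theorem mem_frontier_room (hz : z ∈ sVersion s W Q₀) (hz' : z ∈ frontier Q.room) :
    z ∈ Q.longPassage s ∧ z last = Q.mid last + Q.side / 8 := by
  have hl := Q.side_pos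
  have hL := h.mem_longPassage_of_mem_frontier hQ hne hz (Or.inl hz')
  refine ⟨hL, ?_⟩
  rw [Q.isOpen_room.frontier_eq] at hz'
  have h1 := abs_le.1 (Q.mem_closure_room_iff.1 hz'.1 last)
  refine le_antisymm (by linarith) ?_
  by_contra! hlt
  refine hz'.2 fun i => ?_
  by_cases hi : i = last
  · subst hi
    have := (hL i).2 hlast
    rw [abs_lt]
    constructor <;> linarith
  · linarith [(hL i).1 (DyadicCube.lateral_of_ne hlast hi), h.width_le Q hQ]

/-- Within the s-version the suite can only be left through the upper end of the passage, where the
ramp vanishes. This keeps the cut-off ramp continuous there. -/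
theorem mem_frontier_suite (hz : z ∈ sVersion s W Q₀) (hz' : z ∈ frontier (Q.suite s last)) :
    z ∈ Q.longPassage s ∧ z last = Q.mid last + Q.side / 4 := by
  have hl := Q.side_pos
  rw [DyadicCube.isOpen_suite.frontier_eq] at hz'
  have hsub : Q.suite s last ⊆ closure Q.room ∪ closure (Q.passage s) := by
    rintro v (hv | ⟨hv, hv'⟩)
    · exact Or.inl (subset_closure hv)
    · have hv' : v last < Q.mid last + Q.side / 4 := hv'
      rcases lt_or_ge (v last) (Q.mid last + Q.side / 8) with hlt | hge
      · refine Or.inl (subset_closure fun i => ?_)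
        by_cases hi : i = last
        · subst hi
          have := (hv i).2 hlast
          rw [abs_lt]
          constructor <;> linarith
        · linarith [(hv i).1 (DyadicCube.lateral_of_ne hlast hi), h.width_le Q hQ]
      · refine Or.inr ((Q.mem_closure_corridor_iff s (by linarith)).2 fun i =>
          ⟨fun hi => ((hv i).1 hi).le, fun hi => ?_⟩)
        obtain rfl : i = last := Fin.ext (by omega)
        exact ⟨hge, hv'.le⟩
  have hcl := closure_minimal hsub (isClosed_closure.union isClosed_closure) hz'.1
  rcases hcl with h1 | h1
  · have h2 : z ∈ frontier Q.room := by
      rw [Q.isOpen_room.frontier_eq]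
      exact ⟨h1, fun h3 => hz'.2 (Or.inl h3)⟩
    have h4 := h.mem_frontier_room hQ hne hlast hz h2
    exact absurd (Or.inr ⟨h4.1, show z last < _ by rw [h4.2]; linarith⟩) hz'.2
  · have h2 : z ∈ Q.longPassage s := by
      by_cases hP : z ∈ Q.passage s
      · refine fun i => ⟨(hP i).1, fun hi => ?_⟩
        have := (hP i).2 hi
        constructor <;> linarith
      · refine h.mem_longPassage_of_mem_frontier hQ hne hz (Or.inr ?_)
        rw [DyadicCube.passage, (Q.isOpen_corridor s _ _).frontier_eq]
        exact ⟨h1, hP⟩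
    refine ⟨h2, le_antisymm
      (((Q.mem_closure_corridor_iff s (by linarith)).1 h1 last).2 hlast).2 ?_⟩
    by_contra! hlt
    exact hz'.2 (Or.inr ⟨h2, hlt⟩)

/-- Along segments in the `s`-version, the bump function is Lipschitz. -/
theorem abs_bump_sub_le (hseg : segment ℝ x y ⊆ sVersion s W Q₀) :
    |Q.bump s last x - Q.bump s last y| ≤ 8 / Q.side * dist x y := by
  have hl := Q.side_pos
  have one : ∀ {x y : EuclideanSpace ℝ (Fin n)}, segment ℝ x y ⊆ sVersion s W Q₀ →
      x ∈ Q.suite s last → y ∉ Q.suite s last →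
      |Q.bump s last x - Q.bump s last y| ≤ 8 / Q.side * dist x y := by
    intro x y hseg hx hy
    -- The segment leaves the suite at a point z where the ramp is 0, so the Lipschitz bound of the
    -- ramp between x and z suffices.
    obtain ⟨z, hz, hzf⟩ := exists_mem_frontier_of_segment hx hy
    have hz0 : Q.ramp last z = 0 :=
      DyadicCube.ramp_eq_zero (h.mem_frontier_suite hQ hne hlast (hseg hz) hzf).2.ge
    rw [DyadicCube.bump, indicator_of_mem hx, indicator_of_notMem hy, ← hz0]
    refine DyadicCube.abs_ramp_sub_le.trans (mul_le_mul_of_nonneg_left ?_ (by positivity))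
    linarith [dist_add_dist_of_mem_segment hz, dist_nonneg (x := z) (y := y)]
  by_cases hx : x ∈ Q.suite s last <;> by_cases hy : y ∈ Q.suite s last
  · rw [DyadicCube.bump, indicator_of_mem hx, indicator_of_mem hy]
    exact DyadicCube.abs_ramp_sub_le
  · exact one hseg hx hy
  · rw [abs_sub_comm, dist_comm]
    exact one (segment_symm ℝ x y ▸ hseg) hy hx
  · rw [DyadicCube.bump, indicator_of_notMem hx, indicator_of_notMem hy, sub_self, abs_zero]
    positivity

/-- A segment in the `s`-version along which the bump function changes meets the passage. -/
theorem exists_mem_passage_of_bump_ne (hseg : segment ℝ x y ⊆ sVersion s W Q₀)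
    (hxy : Q.bump s last x ≠ Q.bump s last y) : ∃ z ∈ segment ℝ x y, z ∈ Q.longPassage s ∧
      Q.mid last + Q.side / 8 ≤ z last ∧ z last ≤ Q.mid last + Q.side / 4 := by
  have hl := Q.side_pos
  have one : ∀ {x y : EuclideanSpace ℝ (Fin n)}, segment ℝ x y ⊆ sVersion s W Q₀ →
      x ∈ Q.room → y ∉ Q.room → ∃ z ∈ segment ℝ x y, z ∈ Q.longPassage s ∧
      Q.mid last + Q.side / 8 ≤ z last ∧ z last ≤ Q.mid last + Q.side / 4 := by
    intro x y hseg hx hy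
    obtain ⟨z, hz, hzf⟩ := exists_mem_frontier_of_segment hx hy
    have := h.mem_frontier_room hQ hne hlast (hseg hz) hzf
    exact ⟨z, hz, this.1, this.2.ge, by linarith [this.2]⟩
  have two : ∀ {x : EuclideanSpace ℝ (Fin n)}, x ∉ Q.room → Q.bump s last x ≠ 0 →
      x ∈ Q.longPassage s ∧ Q.mid last + Q.side / 8 ≤ x last ∧
      x last ≤ Q.mid last + Q.side / 4 := by
    intro x hx hx0
    obtain ⟨hL, hlt⟩ := (mem_of_indicator_ne_zero hx0).resolve_left hx
    refine ⟨hL, ?_, le_of_lt hlt⟩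
    by_contra! hlt'
    refine hx fun i => ?_
    by_cases hi : i = last
    · subst hi
      have := (hL i).2 hlast
      rw [abs_lt]
      constructor <;> linarith
    · linarith [(hL i).1 (DyadicCube.lateral_of_ne hlast hi), h.width_le Q hQ]
  by_cases hx : x ∈ Q.room <;> by_cases hy : y ∈ Q.room
  · rw [DyadicCube.bump_eq_one hx, DyadicCube.bump_eq_one hy] at hxy
    exact absurd rfl hxy
  · exact one hseg hx hy
  · obtain ⟨z, hz, hz'⟩ := one (segment_symm ℝ x y ▸ hseg) hy hx
    exact ⟨z, segment_symm ℝ x y ▸ hz, hz'⟩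
  · by_cases hx0 : Q.bump s last x = 0
    · exact ⟨y, right_mem_segment ℝ x y, two hy fun hy0 => hxy (hx0.trans hy0.symm)⟩
    · exact ⟨x, left_mem_segment ℝ x y, two hx hx0⟩

/-- In the passage, the boundary of the `s`-version is near. -/
theorem infDist_le_of_mem_passage (hzL : z ∈ Q.longPassage s)
    (hz1 : Q.mid last + Q.side / 8 ≤ z last) (hz2 : z last ≤ Q.mid last + Q.side / 4) :
    Metric.infDist z (frontier (sVersion s W Q₀)) ≤ 2 * n * (Q.side / 8) ^ s := by
  have hl := Q.side_pos
  have hw := h.width_le Q hQ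
  have hw0 := Q.width_pos s
  have h2 := h.two_le
  -- As n ≥ 2, the first coordinate is lateral. Pushing it to the width of the passage moves z onto
  -- a side wall.
  let i₀ : Fin n := ⟨0, by omega⟩
  have hi₀ : (i₀ : ℕ) + 1 < n := by simp [i₀]; omega
  have hne₀ : last ≠ i₀ := fun heq => by rw [heq] at hlast; omega
  let v : EuclideanSpace ℝ (Fin n) :=
    WithLp.toLp 2 (Function.update z.ofLp i₀ (Q.mid i₀ + (Q.side / 8) ^ s))
  have hv0 : v i₀ = Q.mid i₀ + (Q.side / 8) ^ s := by simp [v]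
  have hvi : ∀ i, i ≠ i₀ → v i = z i := fun i hi => by simp [v, hi]
  have hvL : v ∉ Q.longPassage s := fun hvL => by
    have := (hvL i₀).1 hi₀
    rw [hv0, add_sub_cancel_left, abs_of_pos hw0] at this
    exact lt_irrefl _ this
  have hvP : v ∈ frontier (Q.passage s) := by
    rw [DyadicCube.passage, (Q.isOpen_corridor s _ _).frontier_eq]
    refine ⟨(Q.mem_closure_corridor_iff s (by linarith)).2 fun i => ⟨fun hi => ?_, fun hi => ?_⟩,
      fun hvP => ?_⟩
    · by_cases hii : i = i₀
      · rw [hii, hv0, add_sub_cancel_left, abs_of_pos hw0]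
      · rw [hvi i hii]; exact ((hzL i).1 hi).le
    · obtain rfl : i = last := Fin.ext (by omega)
      rw [hvi i hne₀]
      exact ⟨hz1, hz2⟩
    · have := (hvP i₀).1 hi₀
      rw [hv0, add_sub_cancel_left, abs_of_pos hw0] at this
      exact lt_irrefl _ this
  have hvw : v ∈ Q.walls s := ⟨Or.inr hvP, hvL⟩
  have hvG : v ∉ sVersion s W Q₀ := fun hvG =>
    ((h.mem_sVersion_iff hQ (interior_subset (DyadicCube.walls_subset_interior hw hvw))).1
      hvG).resolve_left hne hvw
  have hzG : z ∈ sVersion s W Q₀ :=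
    (h.mem_sVersion_iff hQ (interior_subset (DyadicCube.longPassage_subset hw hzL))).2
      (Or.inr fun hzw => hzw.2 hzL)
  refine (infDist_frontier_le hzG hvG).trans ?_
  refine (dist_le_of_abs_sub_le (M := 2 * (Q.side / 8) ^ s) (by positivity) fun i => ?_).trans
    (le_of_eq (by ring))
  by_cases hii : i = i₀
  · have := abs_lt.1 ((hzL i₀).1 hi₀)
    rw [hii, hv0, abs_le]
    constructor <;> linarith
  · rw [hvi i hii, sub_self, abs_zero]
    positivity

end IsApartmentSetting

end Bump

/-! ### The fractional energy of sums of bumps -/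

section Energy

variable {n : ℕ} {s : ℝ} {G : Set (EuclideanSpace ℝ (Fin n))} {W : Set (DyadicCube n)}
  {Q₀ : DyadicCube n}

/-- The singularity is integrable since α > 0; translation and scaling reduce to the unit ball at
the origin. -/
theorem exists_lintegral_ball_rpow_le (hn : 0 < n) {α : ℝ} (hα : 0 < α) :
    ∃ K : ℝ, 0 ≤ K ∧ ∀ (x : EuclideanSpace ℝ (Fin n)) (ρ : ℝ), 0 < ρ →
      ∫⁻ y in Metric.ball x ρ, ENNReal.ofReal (‖x - y‖ ^ (α - n)) ≤
        ENNReal.ofReal (K * ρ ^ α) := by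
  have hfr : Module.finrank ℝ (EuclideanSpace ℝ (Fin n)) = n := finrank_euclideanSpace_fin
  have hn' : Nonempty (Fin n) := ⟨⟨0, hn⟩⟩
  have hmeas : Measurable fun y : EuclideanSpace ℝ (Fin n) => ‖y‖ ^ (α - n) := by fun_prop
  have hint : ∀ ρ : ℝ, IntegrableOn (fun y : EuclideanSpace ℝ (Fin n) => ‖y‖ ^ (α - n))
      (Metric.ball 0 ρ) := fun ρ => by
    refine integrableOn_ball_of_norm_le_rpow (C := 1) (α := n - α) (by rw [hfr]; exact hn)
      (by rw [hfr]; linarith) (Eventually.of_forall fun y => ?_) hmeas.aestronglyMeasurable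
    rw [Real.norm_of_nonneg (by positivity), one_mul, neg_sub]
  refine ⟨∫ y in Metric.ball (0 : EuclideanSpace ℝ (Fin n)) 1, ‖y‖ ^ (α - n),
    integral_nonneg fun y => by positivity, fun x ρ hρ => ?_⟩
  have hshift : ∫⁻ y in Metric.ball x ρ, ENNReal.ofReal (‖x - y‖ ^ (α - n)) =
      ∫⁻ y in Metric.ball (0 : EuclideanSpace ℝ (Fin n)) ρ, ENNReal.ofReal (‖y‖ ^ (α - n)) := by
    rw [← lintegral_indicator Metric.isOpen_ball.measurableSet,
      ← lintegral_indicator Metric.isOpen_ball.measurableSet,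
      ← lintegral_sub_left_eq_self _ x]
    congr 1
    ext y
    simp only [indicator, Metric.mem_ball, dist_eq_norm, sub_zero, sub_sub_cancel,
      sub_sub_cancel_left, norm_neg]
  have hscale := Measure.setIntegral_comp_smul_of_pos volume
    (fun y : EuclideanSpace ℝ (Fin n) => ‖y‖ ^ (α - n)) (Metric.ball 0 1) hρ
  rw [smul_unitBall hρ.ne', Real.norm_of_nonneg hρ.le, hfr] at hscale
  simp only [norm_smul, Real.norm_of_nonneg hρ.le, Real.mul_rpow hρ.le (norm_nonneg _)] at hscale
  rw [integral_const_mul, smul_eq_mul] at hscale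
  rw [hshift, ← ofReal_integral_eq_lintegral_ofReal (hint ρ)
    (Eventually.of_forall fun y => by positivity)]
  refine ENNReal.ofReal_le_ofReal (le_of_eq ?_)
  rw [eq_comm, inv_mul_eq_iff_eq_mul₀ (by positivity)] at hscale
  rw [hscale, Real.rpow_sub hρ, Real.rpow_natCast]
  field_simp

namespace DyadicCube

/-- The box of the points whose distance from the passage is at most `A` times its width. -/
def passageNhd (s A : ℝ) (Q : DyadicCube n) (last : Fin n) : Set (EuclideanSpace ℝ (Fin n)) :=
  closedBox
    (fun i => Q.mid i + (if i = last then Q.side / 8 else 0) - A * (Q.side / 8) ^ s)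
    fun i => Q.mid i + (if i = last then Q.side / 4 else 0) + A * (Q.side / 8) ^ s

theorem volume_passageNhd_le {Q : DyadicCube n} {A : ℝ} (hA : 0 ≤ A)
    (hw : (Q.side / 8) ^ s ≤ Q.side / 32) (last : Fin n) :
    volume (Q.passageNhd s A last) ≤
      ENNReal.ofReal ((1 + 2 * A) * Q.side * (2 * A * (Q.side / 8) ^ s) ^ (n - 1)) := by
  have hl := Q.side_pos
  have hw0 := Q.width_pos s
  have hAw : A * (Q.side / 8) ^ s ≤ A * (Q.side / 32) := mul_le_mul_of_nonneg_left hw hA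
  have hAl : 0 ≤ A * Q.side := by positivity
  rw [passageNhd, volume_closedBox, ← Finset.mul_prod_erase _ _ (Finset.mem_univ last),
    ENNReal.ofReal_mul (by positivity), ENNReal.ofReal_pow (by positivity)]
  refine mul_le_mul' (ENNReal.ofReal_le_ofReal ?_) ?_
  · simp only [if_true]
    linarith
  · have hcard : (Finset.univ.erase last).card = n - 1 := by simp
    rw [← hcard, ← Finset.prod_const]
    refine Finset.prod_le_prod' fun j hj => ENNReal.ofReal_le_ofReal ?_
    simp only [(Finset.mem_erase.1 hj).1, if_false]
    linarith

end DyadicCube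

namespace IsApartmentSetting

variable (h : IsApartmentSetting s G W Q₀) {last : Fin n} (hlast : (last : ℕ) + 1 = n)
include h hlast

/-- If the bump function is not constant near `x`, then `x` is near the passage. -/
theorem mem_passageNhd {Q : DyadicCube n} (hQ : Q ∈ W) (hne : Q ≠ Q₀) {τ : ℝ}
    (hτ : τ ∈ Ioo (0 : ℝ) 1) {x y : EuclideanSpace ℝ (Fin n)} (hx : x ∈ sVersion s W Q₀)
    (hy : dist x y < τ * Metric.infDist x (frontier (sVersion s W Q₀)))
    (hxy : Q.bump s last x ≠ Q.bump s last y) :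
    x ∈ Q.passageNhd s (2 * n / (1 - τ)) last ∧
      Metric.infDist x (frontier (sVersion s W Q₀)) ≤ 2 * n / (1 - τ) * (Q.side / 8) ^ s := by
  set d := Metric.infDist x (frontier (sVersion s W Q₀)) with hd
  have hd0 : 0 ≤ d := Metric.infDist_nonneg
  have hw0 := Q.width_pos s
  have hτ1 : 0 < 1 - τ := by linarith [hτ.2]
  -- Since τ < 1, the point y is nearer to x than the boundary is, so the segment cannot leave the
  -- s-version.
  have hseg : segment ℝ x y ⊆ sVersion s W Q₀ := fun z hz => by
    by_contra hzG
    have h1 := infDist_frontier_le hx hzG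
    have h2 := dist_add_dist_of_mem_segment hz
    have h3 : τ * d ≤ 1 * d := mul_le_mul_of_nonneg_right hτ.2.le hd0
    linarith [dist_nonneg (x := z) (y := y)]
  obtain ⟨z, hz, hzL, hz1, hz2⟩ := h.exists_mem_passage_of_bump_ne hQ hne hlast hseg hxy
  have hzd := h.infDist_le_of_mem_passage hQ hne hlast hzL hz1 hz2
  have hxz : dist x z ≤ τ * d := by
    linarith [dist_add_dist_of_mem_segment hz, dist_nonneg (x := z) (y := y)]
  have hdz := Metric.infDist_le_infDist_add_dist (s := frontier (sVersion s W Q₀)) (x := x) (y := z)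
  -- The distance to the boundary is at most 2n times the width at z, and d ≤ dist(z, boundary) +
  -- τd; solving for d produces the factor 1/(1 - τ).
  have hdA : d ≤ 2 * n / (1 - τ) * (Q.side / 8) ^ s := by
    rw [div_mul_eq_mul_div, le_div_iff₀ hτ1]
    linarith
  refine ⟨fun i => ?_, hdA⟩
  have hco := abs_le.1 ((abs_sub_le_dist x z i).trans hxz)
  have hA : (Q.side / 8) ^ s + τ * d ≤ 2 * n / (1 - τ) * (Q.side / 8) ^ s := by
    have h1 : τ * d ≤ τ * (2 * n / (1 - τ) * (Q.side / 8) ^ s) :=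
      mul_le_mul_of_nonneg_left hdA hτ.1.le
    have h2 : (1 - τ) * (2 * n / (1 - τ) * (Q.side / 8) ^ s) = 2 * n * (Q.side / 8) ^ s := by
      field_simp
    have h3 : 1 * (Q.side / 8) ^ s ≤ n * (Q.side / 8) ^ s :=
      mul_le_mul_of_nonneg_right h.one_le_n hw0.le
    linarith
  by_cases hi : i = last
  · subst hi
    simp only [if_true]
    constructor <;> linarith
  · have := abs_lt.1 ((hzL i).1 (DyadicCube.lateral_of_ne hlast hi))
    simp only [hi, if_false]
    constructor <;> linarith

/-- Bound for the inner integral in the fractional energy of a bump function. -/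
theorem lintegral_bump_le {Q : DyadicCube n} (hQ : Q ∈ W) (hne : Q ≠ Q₀) {τ δ p K : ℝ}
    (hτ : τ ∈ Ioo (0 : ℝ) 1) (hp : 1 ≤ p)
    (hK : ∀ (x : EuclideanSpace ℝ (Fin n)) (ρ : ℝ), 0 < ρ →
      ∫⁻ y in Metric.ball x ρ, ENNReal.ofReal (‖x - y‖ ^ (p * (1 - δ) - n)) ≤
        ENNReal.ofReal (K * ρ ^ (p * (1 - δ))))
    {x : EuclideanSpace ℝ (Fin n)} (hx : x ∈ sVersion s W Q₀) :
    ∫⁻ y in sVersion s W Q₀ ∩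
        Metric.ball x (τ * Metric.infDist x (frontier (sVersion s W Q₀))),
      ENNReal.ofReal (|Q.bump s last x - Q.bump s last y| ^ p / ‖x - y‖ ^ ((n : ℝ) + δ * p)) ≤
    (Q.passageNhd s (2 * n / (1 - τ)) last).indicator (fun _ => ENNReal.ofReal ((8 / Q.side) ^ p) *
      ENNReal.ofReal (K * (2 * n / (1 - τ) * (Q.side / 8) ^ s) ^ (p * (1 - δ)))) x := by
  set d := Metric.infDist x (frontier (sVersion s W Q₀)) with hd
  set A : ℝ := 2 * n / (1 - τ) with hA
  have hd0 : 0 ≤ d := Metric.infDist_nonneg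
  have hl := Q.side_pos
  have hw0 := Q.width_pos s
  have hτ1 : 0 < 1 - τ := by linarith [hτ.2]
  have hn0 : (0 : ℝ) < n := by linarith [h.one_le_n]
  have hA0 : 0 < A := by positivity
  have hmeas : MeasurableSet (sVersion s W Q₀ ∩ Metric.ball x (τ * d)) :=
    (h.isOpen_sVersion.inter Metric.isOpen_ball).measurableSet
  by_cases hex : ∃ y ∈ Metric.ball x (τ * d), Q.bump s last x ≠ Q.bump s last y
  · obtain ⟨y, hy, hxy⟩ := hex
    obtain ⟨hmem, hdA⟩ := h.mem_passageNhd hlast hQ hne hτ hx (by rwa [dist_comm]) hxy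
    have hτd : τ * d ≤ 1 * d := mul_le_mul_of_nonneg_right hτ.2.le hd0
    rw [indicator_of_mem hmem]
    calc _ ≤ ∫⁻ y in sVersion s W Q₀ ∩ Metric.ball x (τ * d),
          ENNReal.ofReal ((8 / Q.side) ^ p) * ENNReal.ofReal (‖x - y‖ ^ (p * (1 - δ) - n)) := by
          refine setLIntegral_mono' hmeas fun y hy => ?_
          rw [← ENNReal.ofReal_mul (by positivity)]
          refine ENNReal.ofReal_le_ofReal ?_
          rcases eq_or_ne x y with rfl | hxy
          · rw [sub_self, abs_zero, Real.zero_rpow (by linarith : p ≠ 0), zero_div]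
            positivity
          have hpos : 0 < ‖x - y‖ := norm_pos_iff.2 (sub_ne_zero.2 hxy)
          have hseg : segment ℝ x y ⊆ sVersion s W Q₀ := fun z hz => by
            by_contra hzG
            have h1 := infDist_frontier_le hx hzG
            have h2 := dist_add_dist_of_mem_segment hz
            have h3 := Metric.mem_ball'.1 hy.2
            linarith [dist_nonneg (x := z) (y := y)]
          have hlip := h.abs_bump_sub_le hQ hne hlast hseg
          rw [dist_eq_norm] at hlip
          rw [div_le_iff₀ (by positivity)]
          -- The Lipschitz bound weakens the kernel to the integrable exponent p - (n + δp) = p(1 -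
          -- δ) - n.
          calc _ ≤ (8 / Q.side * ‖x - y‖) ^ p :=
                Real.rpow_le_rpow (abs_nonneg _) hlip (by linarith)
            _ = (8 / Q.side) ^ p * (‖x - y‖ ^ (p * (1 - δ) - n) * ‖x - y‖ ^ ((n : ℝ) + δ * p)) := by
                rw [Real.mul_rpow (by positivity) hpos.le, ← Real.rpow_add hpos]
                ring_nf
            _ = _ := by ring
      _ ≤ ∫⁻ y in Metric.ball x (A * (Q.side / 8) ^ s),
          ENNReal.ofReal ((8 / Q.side) ^ p) * ENNReal.ofReal (‖x - y‖ ^ (p * (1 - δ) - n)) :=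
          lintegral_mono_set (inter_subset_right.trans (Metric.ball_subset_ball (by linarith)))
      _ ≤ _ := by
          rw [lintegral_const_mul _ (by fun_prop)]
          exact mul_le_mul_right (hK x _ (by positivity)) _
  · push Not at hex
    refine le_trans (le_of_eq ?_) zero_le
    rw [setLIntegral_congr_fun hmeas (g := fun _ => 0), lintegral_zero]
    intro y hy
    simp only
    rw [hex y hy.2, sub_self, abs_zero, Real.zero_rpow (by linarith : p ≠ 0), zero_div,
      ENNReal.ofReal_zero]

omit hlast in
-- The bumps live in disjoint open cubes, so at most one is nonzero at x and at most one at y. The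
-- power mean inequality for two terms costs 2^(p-1) ≤ 2^p.
theorem abs_sum_bump_sub_rpow_le {F : Finset (DyadicCube n)} (hF : ∀ Q ∈ F, Q ∈ W)
    {a : DyadicCube n → ℝ} (ha : ∀ Q, 0 ≤ a Q) {p : ℝ} (hp : 1 ≤ p)
    (x y : EuclideanSpace ℝ (Fin n)) :
    |∑ Q ∈ F, a Q * Q.bump s last x - ∑ Q ∈ F, a Q * Q.bump s last y| ^ p ≤
      ∑ Q ∈ F, 2 ^ p * a Q ^ p * |Q.bump s last x - Q.bump s last y| ^ p := by
  classical
  have hsub : ∀ z : EuclideanSpace ℝ (Fin n),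
      (F.filter fun Q => Q.bump s last z ≠ 0).card ≤ 1 := fun z => by
    refine Finset.card_le_one.2 fun Q hQ Q' hQ' => ?_
    rw [Finset.mem_filter] at hQ hQ'
    have h1 := DyadicCube.suite_subset_interior (h.width_le Q (hF Q hQ.1))
      (mem_of_indicator_ne_zero hQ.2)
    have h2 := DyadicCube.suite_subset_interior (h.width_le Q' (hF Q' hQ'.1))
      (mem_of_indicator_ne_zero hQ'.2)
    exact h.eq_of_mem_interior (hF Q hQ.1) (hF Q' hQ'.1) h1 (interior_subset h2)
  set F' := (F.filter fun Q => Q.bump s last x ≠ 0) ∪ F.filter fun Q => Q.bump s last y ≠ 0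
    with hF'
  have hF'F : F' ⊆ F := Finset.union_subset (Finset.filter_subset _ _) (Finset.filter_subset _ _)
  have hcard : (F'.card : ℝ) ≤ 2 := by
    exact_mod_cast (Finset.card_union_le _ _).trans (Nat.add_le_add (hsub x) (hsub y))
  have hsum : ∑ Q ∈ F, a Q * Q.bump s last x - ∑ Q ∈ F, a Q * Q.bump s last y =
      ∑ Q ∈ F', a Q * (Q.bump s last x - Q.bump s last y) := by
    rw [← Finset.sum_sub_distrib, Finset.sum_subset hF'F]
    · exact Finset.sum_congr rfl fun Q _ => by ring
    · intro Q hQ hQ'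
      simp only [hF', Finset.mem_union, Finset.mem_filter, hQ, true_and, not_or, not_not] at hQ'
      rw [hQ'.1, hQ'.2, sub_self, mul_zero]
  have habs : |∑ Q ∈ F', a Q * (Q.bump s last x - Q.bump s last y)| ≤
      ∑ Q ∈ F', a Q * |Q.bump s last x - Q.bump s last y| := by
    refine (Finset.abs_sum_le_sum_abs _ _).trans (le_of_eq (Finset.sum_congr rfl fun Q _ => ?_))
    rw [abs_mul, abs_of_nonneg (ha Q)]
  rw [hsum]
  calc _ ≤ (∑ Q ∈ F', a Q * |Q.bump s last x - Q.bump s last y|) ^ p :=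
        Real.rpow_le_rpow (abs_nonneg _) habs (by linarith)
    _ ≤ (F'.card : ℝ) ^ (p - 1) * ∑ Q ∈ F', (a Q * |Q.bump s last x - Q.bump s last y|) ^ p :=
        Real.rpow_sum_le_const_mul_sum_rpow_of_nonneg _ hp
          fun Q _ => mul_nonneg (ha Q) (abs_nonneg _)
    _ ≤ 2 ^ p * ∑ Q ∈ F', (a Q * |Q.bump s last x - Q.bump s last y|) ^ p := by
        refine mul_le_mul_of_nonneg_right ?_ (Finset.sum_nonneg fun Q _ =>
          Real.rpow_nonneg (mul_nonneg (ha Q) (abs_nonneg _)) _)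
        exact (Real.rpow_le_rpow (Nat.cast_nonneg _) hcard (by linarith)).trans
          (Real.rpow_le_rpow_of_exponent_le one_le_two (by linarith))
    _ = ∑ Q ∈ F', 2 ^ p * a Q ^ p * |Q.bump s last x - Q.bump s last y| ^ p := by
        rw [Finset.mul_sum]
        refine Finset.sum_congr rfl fun Q _ => ?_
        rw [Real.mul_rpow (ha Q) (abs_nonneg _), mul_assoc]
    _ ≤ _ := Finset.sum_le_sum_of_subset_of_nonneg hF'F fun Q _ _ => by
        have := ha Q
        positivity

/-- The fractional energy of a combination of bump functions. -/
theorem exists_fractionalEnergy_le {τ δ p : ℝ} (hτ : τ ∈ Ioo (0 : ℝ) 1) (hδ : δ < 1)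
    (hp : 1 ≤ p) : ∃ C : ℝ, 0 ≤ C ∧ ∀ (F : Finset (DyadicCube n)) (a : DyadicCube n → ℝ),
      (∀ Q ∈ F, Q ∈ W ∧ Q ≠ Q₀) → (∀ Q, 0 ≤ a Q) →
      fractionalEnergy p δ τ (sVersion s W Q₀) (fun x => ∑ Q ∈ F, a Q * Q.bump s last x) ≤
        ENNReal.ofReal (C * ∑ Q ∈ F, a Q ^ p *
          (Q.side ^ (1 - p) * ((Q.side / 8) ^ s) ^ ((n : ℝ) - 1 + p * (1 - δ)))) := by
  have hα : 0 < p * (1 - δ) := mul_pos (by linarith) (by linarith)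
  obtain ⟨K, hK0, hK⟩ := exists_lintegral_ball_rpow_le h.n_pos hα
  have hτ1 : 0 < 1 - τ := by linarith [hτ.2]
  have hn0 : (0 : ℝ) < n := by linarith [h.one_le_n]
  set A : ℝ := 2 * n / (1 - τ) with hA
  have hA0 : 0 < A := by positivity
  -- The factors come from the overlap of two bumps, the inner integral and the volume of the
  -- neighbourhood of the passage.
  refine ⟨2 ^ p * (8 ^ p * (K * A ^ (p * (1 - δ))) * ((1 + 2 * A) * (2 * A) ^ (n - 1))),
    by positivity, fun F a hF ha => ?_⟩
  have hG := h.isOpen_sVersion.measurableSet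
  calc fractionalEnergy p δ τ (sVersion s W Q₀) (fun x => ∑ Q ∈ F, a Q * Q.bump s last x)
      ≤ ∫⁻ x in sVersion s W Q₀, ∑ Q ∈ F, ENNReal.ofReal (2 ^ p * a Q ^ p) *
          (Q.passageNhd s A last).indicator (fun _ => ENNReal.ofReal ((8 / Q.side) ^ p) *
            ENNReal.ofReal (K * (A * (Q.side / 8) ^ s) ^ (p * (1 - δ)))) x := by
        refine setLIntegral_mono' hG fun x hx => ?_
        calc _ ≤ ∫⁻ y in sVersion s W Q₀ ∩
                Metric.ball x (τ * Metric.infDist x (frontier (sVersion s W Q₀))),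
              ∑ Q ∈ F, ENNReal.ofReal (2 ^ p * a Q ^ p) *
                ENNReal.ofReal (|Q.bump s last x - Q.bump s last y| ^ p /
                  ‖x - y‖ ^ ((n : ℝ) + δ * p)) := by
              refine lintegral_mono fun y => ?_
              dsimp only
              have hsum : ∑ Q ∈ F, ENNReal.ofReal (2 ^ p * a Q ^ p) *
                  ENNReal.ofReal (|Q.bump s last x - Q.bump s last y| ^ p /
                    ‖x - y‖ ^ ((n : ℝ) + δ * p)) =
                  ENNReal.ofReal (∑ Q ∈ F, 2 ^ p * a Q ^ p *
                    |Q.bump s last x - Q.bump s last y| ^ p / ‖x - y‖ ^ ((n : ℝ) + δ * p)) := by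
                rw [ENNReal.ofReal_sum_of_nonneg fun Q _ => by have := ha Q; positivity]
                refine Finset.sum_congr rfl fun Q _ => ?_
                rw [← ENNReal.ofReal_mul (by have := ha Q; positivity), mul_div_assoc]
              rw [hsum, ← Finset.sum_div]
              refine ENNReal.ofReal_le_ofReal (div_le_div_of_nonneg_right ?_ (by positivity))
              exact h.abs_sum_bump_sub_rpow_le (fun Q hQ => (hF Q hQ).1) ha hp x y
          _ = ∑ Q ∈ F, ENNReal.ofReal (2 ^ p * a Q ^ p) * ∫⁻ y in sVersion s W Q₀ ∩
                Metric.ball x (τ * Metric.infDist x (frontier (sVersion s W Q₀))),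
                ENNReal.ofReal (|Q.bump s last x - Q.bump s last y| ^ p /
                  ‖x - y‖ ^ ((n : ℝ) + δ * p)) := by
              have hm : ∀ Q : DyadicCube n, Measurable fun y : EuclideanSpace ℝ (Fin n) =>
                  ENNReal.ofReal (|Q.bump s last x - Q.bump s last y| ^ p /
                    ‖x - y‖ ^ ((n : ℝ) + δ * p)) := fun Q => by
                have := DyadicCube.measurable_bump (Q := Q) (s := s) (last := last)
                fun_prop
              rw [lintegral_finsetSum _ fun Q _ => (hm Q).const_mul _]
              exact Finset.sum_congr rfl fun Q _ => lintegral_const_mul _ (hm Q)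
          _ ≤ _ := Finset.sum_le_sum fun Q hQ => mul_le_mul_right
              (h.lintegral_bump_le hlast (hF Q hQ).1 (hF Q hQ).2 hτ hp hK hx) _
    _ ≤ ∫⁻ x, ∑ Q ∈ F, ENNReal.ofReal (2 ^ p * a Q ^ p) *
          (Q.passageNhd s A last).indicator (fun _ => ENNReal.ofReal ((8 / Q.side) ^ p) *
            ENNReal.ofReal (K * (A * (Q.side / 8) ^ s) ^ (p * (1 - δ)))) x :=
        setLIntegral_le_lintegral _ _
    _ = ∑ Q ∈ F, ENNReal.ofReal (2 ^ p * a Q ^ p) * ((ENNReal.ofReal ((8 / Q.side) ^ p) *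
            ENNReal.ofReal (K * (A * (Q.side / 8) ^ s) ^ (p * (1 - δ)))) *
              volume (Q.passageNhd s A last)) := by
        have hm : ∀ Q : DyadicCube n, MeasurableSet (Q.passageNhd s A last) := fun Q =>
          (isClosed_closedBox _ _).measurableSet
        rw [lintegral_finsetSum _ fun Q _ => (measurable_const.indicator (hm Q)).const_mul _]
        refine Finset.sum_congr rfl fun Q _ => ?_
        rw [lintegral_const_mul _ (measurable_const.indicator (hm Q)), lintegral_indicator (hm Q),
          setLIntegral_const]
    _ ≤ ∑ Q ∈ F, ENNReal.ofReal (2 ^ p * a Q ^ p * ((8 / Q.side) ^ p *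
            (K * (A * (Q.side / 8) ^ s) ^ (p * (1 - δ))) *
              ((1 + 2 * A) * Q.side * (2 * A * (Q.side / 8) ^ s) ^ (n - 1)))) := by
        refine Finset.sum_le_sum fun Q hQ => ?_
        have hl := Q.side_pos
        have hw0 := Q.width_pos s
        have haQ := ha Q
        rw [ENNReal.ofReal_mul (p := 2 ^ p * a Q ^ p) (by positivity),
          ENNReal.ofReal_mul (p := (8 / Q.side) ^ p * _) (by positivity),
          ENNReal.ofReal_mul (p := (8 / Q.side) ^ p) (by positivity)]
        gcongr
        exact DyadicCube.volume_passageNhd_le hA0.le (h.width_le Q (hF Q hQ).1) last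
    _ = _ := by
        rw [← ENNReal.ofReal_sum_of_nonneg, Finset.mul_sum]
        · congr 1
          refine Finset.sum_congr rfl fun Q _ => ?_
          have hl := Q.side_pos
          have hw0 := Q.width_pos s
          set w := (Q.side / 8) ^ s with hw
          rw [Real.rpow_add hw0, Real.mul_rpow hA0.le hw0.le, Real.div_rpow (by norm_num) hl.le,
            mul_pow, Real.rpow_sub hl, Real.rpow_one, ← Nat.cast_pred h.n_pos, Real.rpow_natCast]
          ring
        · intro Q _
          have hl := Q.side_pos
          have hw0 := Q.width_pos s
          have haQ := ha Q
          positivity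

end IsApartmentSetting

end Energy

/-! ### Failure of the Poincaré inequality -/

section Failure

variable {n : ℕ} {s : ℝ} {G : Set (EuclideanSpace ℝ (Fin n))} {W : Set (DyadicCube n)}
  {Q₀ : DyadicCube n}

/-- The weighted energy of the bump functions in the cubes of one generation is bounded. -/
theorem generation_energy_le {N l c₀ lam d p q δ : ℝ} (hl : 0 < l) (hl1 : l ≤ 1) (hc₀ : 0 < c₀)
    (hN : c₀ * l ^ (-lam) ≤ N) (hq : 1 ≤ q) (hqp : q < p)
    (hrel : 1 - s * (1 - δ) ≤ (p - q) * (lam - d) / (p * q) + (s - 1) * (d - 1) / p) :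
    N * (((N * l ^ d) ^ (-1 / q)) ^ p * (l ^ (1 - p) * ((l / 8) ^ s) ^ (d - 1 + p * (1 - δ)))) ≤
      c₀ ^ (1 - p / q) * (1 / 8) ^ (s * (d - 1 + p * (1 - δ))) := by
  have hq0 : 0 < q := by linarith
  have hp0 : 0 < p := by linarith
  have hN0 : 0 < N := lt_of_lt_of_le (by positivity) hN
  set E := d - 1 + p * (1 - δ) with hE
  -- This is `hrel` multiplied by p: the total power of l is nonnegative.
  have hexp : 0 ≤ (-lam) * (1 - p / q) + (-(d * p / q) + (1 - p) + s * E) := by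
    have h1 := mul_le_mul_of_nonneg_left hrel hp0.le
    have h2 : p * ((p - q) * (lam - d) / (p * q) + (s - 1) * (d - 1) / p) =
        (p / q - 1) * (lam - d) + (s - 1) * (d - 1) := by
      field_simp
    rw [h2] at h1
    have h3 : d * p / q = d * (p / q) := by ring
    rw [h3, hE]
    nlinarith
  have e1 : N * (((N * l ^ d) ^ (-1 / q)) ^ p * (l ^ (1 - p) * ((l / 8) ^ s) ^ E)) =
      N ^ (1 - p / q) * (l ^ (-(d * p / q) + (1 - p) + s * E) * (1 / 8) ^ (s * E)) := by
    rw [← Real.rpow_mul (by positivity), Real.mul_rpow hN0.le (by positivity), ← Real.rpow_mul hl.le,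
      ← Real.rpow_mul (by positivity), show l / 8 = l * (1 / 8) by ring,
      Real.mul_rpow hl.le (by norm_num), Real.rpow_add hl, Real.rpow_add hl, Real.rpow_sub hN0,
      Real.rpow_one, show -1 / q * p = -(p / q) by ring, Real.rpow_neg hN0.le,
      show d * (-(p / q)) = -(d * p / q) by ring]
    ring
  rw [e1]
  -- The exponent 1 - p/q is negative, so a lower bound on the number of cubes is enough.
  have e2 : N ^ (1 - p / q) ≤ c₀ ^ (1 - p / q) * l ^ ((-lam) * (1 - p / q)) := by
    rw [Real.rpow_mul hl.le, ← Real.mul_rpow hc₀.le (by positivity)]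
    refine Real.rpow_le_rpow_of_nonpos (by positivity) hN ?_
    rw [sub_nonpos, le_div_iff₀ hq0]
    linarith
  calc _ ≤ c₀ ^ (1 - p / q) * l ^ ((-lam) * (1 - p / q)) *
          (l ^ (-(d * p / q) + (1 - p) + s * E) * (1 / 8) ^ (s * E)) :=
        mul_le_mul_of_nonneg_right e2 (by positivity)
    _ = c₀ ^ (1 - p / q) * (1 / 8) ^ (s * E) *
          l ^ ((-lam) * (1 - p / q) + (-(d * p / q) + (1 - p) + s * E)) := by
        rw [Real.rpow_add hl ((-lam) * (1 - p / q))]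
        ring
    _ ≤ c₀ ^ (1 - p / q) * (1 / 8) ^ (s * E) * 1 :=
        mul_le_mul_of_nonneg_left (Real.rpow_le_one hl.le hl1 hexp) (by positivity)
    _ = _ := mul_one _

namespace IsApartmentSetting

variable (h : IsApartmentSetting s G W Q₀) {last : Fin n} (hlast : (last : ℕ) + 1 = n)
include h

include hlast in
-- The function is a_Q on the room and 0 on the cellar, and a_Q ≤ |a_Q - m| + |m|. So on one of the
-- two it differs from m by at least a_Q/2, whatever m is.
theorem le_lintegral_sum_bump {F : Finset (DyadicCube n)} (hF : ∀ Q ∈ F, Q ∈ W ∧ Q ≠ Q₀)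
    {a : DyadicCube n → ℝ} (ha : ∀ Q, 0 ≤ a Q) {q : ℝ} (hq : 0 ≤ q) (m : ℝ) :
    ENNReal.ofReal (∑ Q ∈ F, (a Q / 2) ^ q * (Q.side / 4) ^ n) ≤
      ∫⁻ x in sVersion s W Q₀,
        ENNReal.ofReal (|∑ Q ∈ F, a Q * Q.bump s last x - m| ^ q) := by
  classical
  let S : DyadicCube n → Set (EuclideanSpace ℝ (Fin n)) := fun Q =>
    if a Q / 2 ≤ |a Q - m| then Q.room else Q.cellar last
  have hSint : ∀ Q, S Q ⊆ interior Q.toSet := fun Q => by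
    simp only [S]
    split_ifs
    · exact DyadicCube.room_subset_interior
    · exact DyadicCube.cellar_subset_interior
  have hSmeas : ∀ Q, MeasurableSet (S Q) := fun Q => by
    simp only [S]
    split_ifs
    · exact Q.isOpen_room.measurableSet
    · exact (isOpen_openBox _ _).measurableSet
  have hSvol : ∀ Q, volume (S Q) = ENNReal.ofReal (Q.side / 4) ^ n := fun Q => by
    simp only [S]
    split_ifs
    · exact DyadicCube.volume_room
    · exact DyadicCube.volume_cellar
  have hSsub : ⋃ Q ∈ F, S Q ⊆ sVersion s W Q₀ := iUnion₂_subset fun Q hQ => by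
    simp only [S]
    split_ifs
    · exact h.room_subset_sVersion (hF Q hQ).1
    · exact h.cellar_subset_sVersion (hF Q hQ).1 hlast
  have hSdisj : Set.PairwiseDisjoint (F : Set (DyadicCube n)) S := fun Q hQ Q' hQ' hne =>
    (h.whitney.disjoint_interior (hF Q hQ).1 (hF Q' hQ').1 hne).mono (hSint Q) (hSint Q')
  have hval : ∀ Q ∈ F, ∀ x ∈ S Q, a Q / 2 ≤ |∑ Q ∈ F, a Q * Q.bump s last x - m| := by
    intro Q hQ x hx
    have hsum : ∑ Q ∈ F, a Q * Q.bump s last x = a Q * Q.bump s last x := by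
      refine Finset.sum_eq_single_of_mem Q hQ fun Q' hQ' hne => ?_
      rw [DyadicCube.bump_eq_zero_of_not_mem (h.width_le Q' (hF Q' hQ').1), mul_zero]
      exact fun hx' => hne (h.eq_of_mem_interior (hF Q' hQ').1 (hF Q hQ).1 hx'
        (interior_subset (hSint Q hx)))
    rw [hsum]
    simp only [S] at hx
    split_ifs at hx with hcase
    · rwa [DyadicCube.bump_eq_one hx, mul_one]
    · rw [DyadicCube.bump_eq_zero_of_mem_cellar hlast hx, mul_zero, zero_sub, abs_neg]
      have h1 := abs_add_le (a Q - m) m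
      rw [sub_add_cancel, abs_of_nonneg (ha Q)] at h1
      linarith
  calc ENNReal.ofReal (∑ Q ∈ F, (a Q / 2) ^ q * (Q.side / 4) ^ n)
      = ∑ Q ∈ F, ENNReal.ofReal ((a Q / 2) ^ q) * volume (S Q) := by
        rw [ENNReal.ofReal_sum_of_nonneg fun Q _ => by
          have := ha Q
          have := Q.side_pos
          positivity]
        refine Finset.sum_congr rfl fun Q _ => ?_
        have := ha Q
        have := Q.side_pos
        rw [hSvol, ENNReal.ofReal_mul (by positivity), ENNReal.ofReal_pow (by positivity)]
    _ ≤ ∑ Q ∈ F, ∫⁻ x in S Q, ENNReal.ofReal (|∑ Q ∈ F, a Q * Q.bump s last x - m| ^ q) := by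
        refine Finset.sum_le_sum fun Q hQ => ?_
        rw [← setLIntegral_const]
        refine setLIntegral_mono' (hSmeas Q) fun x hx => ENNReal.ofReal_le_ofReal ?_
        exact Real.rpow_le_rpow (by have := ha Q; positivity) (hval Q hQ x hx) hq
    _ = ∫⁻ x in ⋃ Q ∈ F, S Q, ENNReal.ofReal (|∑ Q ∈ F, a Q * Q.bump s last x - m| ^ q) :=
        (lintegral_biUnion_finset hSdisj (fun Q _ => hSmeas Q) _).symm
    _ ≤ _ := lintegral_mono_set hSsub

theorem memLp_sum_bump (F : Finset (DyadicCube n)) (a : DyadicCube n → ℝ) (p : ℝ≥0∞) :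
    MemLp (fun x => ∑ Q ∈ F, a Q * Q.bump s last x) p (volume.restrict (sVersion s W Q₀)) := by
  have : IsFiniteMeasure (volume.restrict (sVersion s W Q₀)) :=
    isFiniteMeasure_restrict.2 h.isBounded_sVersion.measure_lt_top.ne
  refine memLp_finsetSum F fun Q _ => MemLp.of_bound
    (DyadicCube.measurable_bump.const_mul _).aestronglyMeasurable |a Q|
    (Eventually.of_forall fun x => ?_)
  rw [norm_mul, Real.norm_eq_abs, Real.norm_of_nonneg DyadicCube.bump_nonneg]
  exact mul_le_of_le_one_right (abs_nonneg _) DyadicCube.bump_le_one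

/-- There are infinitely many generations with many cubes. -/
theorem exists_infinite_generations {lam : ℝ}
    (hcount : 0 < limsup (fun k : ℕ => ENNReal.ofReal ((2 : ℝ) ^ (-(lam * (k : ℝ)))) *
      (((cubesOfGen W (k : ℤ)).encard : ℕ∞) : ℝ≥0∞)) atTop) :
    ∃ c₀ : ℝ, 0 < c₀ ∧ {k : ℕ | Q₀.gen < k ∧
      c₀ * ((2 : ℝ) ^ (-(k : ℤ))) ^ (-lam) ≤ (cubesOfGen W (k : ℤ)).ncard}.Infinite := by
  obtain ⟨b, hb, hb'⟩ := ENNReal.lt_iff_exists_nnreal_btwn.1 hcount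
  refine ⟨b, by simpa using hb, ?_⟩
  rw [← Nat.frequently_atTop_iff_infinite]
  -- Generations beyond that of `Q₀` do not contain the central cube, which has no apartment.
  refine ((frequently_lt_of_lt_limsup (h := hb')).and_eventually
    (eventually_gt_atTop Q₀.gen.toNat)).mono fun k ⟨hk, hk'⟩ => ⟨by omega, ?_⟩
  rw [← (h.finite_cubesOfGen k).cast_ncard_eq] at hk
  have hpow : (0 : ℝ) < 2 ^ (-(lam * (k : ℝ))) := Real.rpow_pos_of_pos two_pos _
  have hk2 : (b : ℝ) < 2 ^ (-(lam * (k : ℝ))) * (cubesOfGen W (k : ℤ)).ncard := by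
    rw [← ENNReal.ofReal_coe_nnreal, ENat.toENNReal_coe, ← ENNReal.ofReal_natCast,
      ← ENNReal.ofReal_mul hpow.le] at hk
    exact (ENNReal.ofReal_lt_ofReal_iff_of_nonneg b.2).1 hk
  have e : ((2 : ℝ) ^ (-(k : ℤ))) ^ (-lam) = (2 ^ (-(lam * (k : ℝ))))⁻¹ := by
    rw [← Real.rpow_neg two_pos.le, neg_neg, zpow_neg, zpow_natCast, ← Real.rpow_natCast,
      ← Real.rpow_neg two_pos.le, ← Real.rpow_mul two_pos.le]
    ring_nf
  rw [e, ← div_eq_mul_inv, div_le_iff₀ hpow, mul_comm]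
  exact hk2.le

theorem not_supportsFractionalPoincare {lam : ℝ}
    (hcount : 0 < limsup (fun k : ℕ => ENNReal.ofReal ((2 : ℝ) ^ (-(lam * (k : ℝ)))) *
      (((cubesOfGen W (k : ℤ)).encard : ℕ∞) : ℝ≥0∞)) atTop)
    {δ τ q p : ℝ} (hδ : δ < 1) (hτ : τ ∈ Ioo (0 : ℝ) 1) (hq : 1 ≤ q) (hqp : q < p)
    (hrel : 1 - s * (1 - δ) ≤
      (p - q) * (lam - n) / (p * q) + (s - 1) * ((n : ℝ) - 1) / p) :
    ¬ SupportsFractionalPoincare q p δ τ (sVersion s W Q₀) := by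
  classical
  rintro ⟨c, hc⟩
  have hq0 : 0 < q := by linarith
  have hp0 : 0 < p := by linarith
  obtain ⟨last, hlast⟩ : ∃ last : Fin n, (last : ℕ) + 1 = n :=
    ⟨⟨n - 1, by have := h.n_pos; omega⟩, by have := h.n_pos; simp; omega⟩
  obtain ⟨C, hC0, hC⟩ := h.exists_fractionalEnergy_le hlast hτ hδ (hq.trans hqp.le)
  obtain ⟨c₀, hc₀, hinf⟩ := h.exists_infinite_generations hcount
  set C₁ : ℝ := c₀ ^ (1 - p / q) * (1 / 8) ^ (s * ((n : ℝ) - 1 + p * (1 - δ))) with hC₁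
  have hC₁0 : 0 < C₁ := by positivity
  set κ : ℝ := (1 / 2) ^ q * (1 / 4) ^ n with hκ
  have hκ0 : 0 < κ := by positivity
  have key : ∀ K : ℕ, K * κ ≤ c * (C * (K * C₁)) ^ (q / p) := by
    intro K
    obtain ⟨T, hT, hTK⟩ := hinf.exists_subset_card_eq K
    let F : Finset (DyadicCube n) := T.biUnion fun k => (h.finite_cubesOfGen k).toFinset
    -- Normalized so that N ℓ^n a^q = 1 in each generation; the left side then grows linearly in the
    -- number K of generations.
    let a : DyadicCube n → ℝ := fun Q =>
      ((cubesOfGen W Q.gen).ncard * Q.side ^ (n : ℝ)) ^ (-1 / q)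
    have ha : ∀ Q, 0 ≤ a Q := fun Q => by
      have := Q.side_pos
      positivity
    have hF : ∀ Q ∈ F, Q ∈ W ∧ Q ≠ Q₀ := by
      intro Q hQ
      simp only [F, Finset.mem_biUnion, Finite.mem_toFinset] at hQ
      obtain ⟨k, hk, hQW, hQk⟩ := hQ
      refine ⟨hQW, ?_⟩
      rintro rfl
      have := (hT hk).1
      omega
    have hsum : ∀ f : ℝ → ℝ → ℝ, ∑ Q ∈ F, f (a Q) Q.side = ∑ k ∈ T,
        (cubesOfGen W (k : ℤ)).ncard * f (((cubesOfGen W (k : ℤ)).ncard *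
          ((2 : ℝ) ^ (-(k : ℤ))) ^ (n : ℝ)) ^ (-1 / q)) (2 ^ (-(k : ℤ))) := by
      intro f
      rw [Finset.sum_biUnion]
      · refine Finset.sum_congr rfl fun k _ => ?_
        rw [Set.ncard_eq_toFinset_card _ (h.finite_cubesOfGen k), ← nsmul_eq_mul]
        refine Finset.sum_eq_card_nsmul fun Q hQ => ?_
        rw [Finite.mem_toFinset] at hQ
        simp only [a, DyadicCube.side, hQ.2,
          Set.ncard_eq_toFinset_card _ (h.finite_cubesOfGen k)]
      · intro k _ k' _ hkk'
        refine Finset.disjoint_left.2 fun Q hQ hQ' => hkk' ?_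
        rw [Finite.mem_toFinset] at hQ hQ'
        exact_mod_cast hQ.2.symm.trans hQ'.2
    have hNpos : ∀ k ∈ T, 0 < ((cubesOfGen W (k : ℤ)).ncard : ℝ) := fun k hk =>
      lt_of_lt_of_le (by positivity) (hT hk).2
    have hleft : ∑ Q ∈ F, (a Q / 2) ^ q * (Q.side / 4) ^ n = K * κ := by
      rw [hsum fun a l => (a / 2) ^ q * (l / 4) ^ n, ← hTK, ← nsmul_eq_mul]
      refine Finset.sum_eq_card_nsmul fun k hk => ?_
      have hN := hNpos k hk
      have hl : (0 : ℝ) < 2 ^ (-(k : ℤ)) := zpow_pos two_pos _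
      set N : ℝ := ((cubesOfGen W (k : ℤ)).ncard : ℝ)
      set l : ℝ := 2 ^ (-(k : ℤ))
      rw [div_eq_mul_one_div _ (2 : ℝ), Real.mul_rpow (by positivity) (by norm_num),
        ← Real.rpow_mul (by positivity), div_mul_cancel₀ _ hq0.ne', Real.rpow_neg_one,
        Real.rpow_natCast, hκ, div_pow, div_pow]
      field_simp
      simp
    have hright : ∑ Q ∈ F, a Q ^ p * (Q.side ^ (1 - p) *
        ((Q.side / 8) ^ s) ^ ((n : ℝ) - 1 + p * (1 - δ))) ≤ K * C₁ := by
      rw [hsum fun a l => a ^ p * (l ^ (1 - p) * ((l / 8) ^ s) ^ ((n : ℝ) - 1 + p * (1 - δ))),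
        ← hTK, ← nsmul_eq_mul]
      refine Finset.sum_le_card_nsmul _ _ _ fun k hk => ?_
      exact generation_energy_le (zpow_pos two_pos _)
        (zpow_le_one_of_nonpos₀ one_le_two (by simp)) hc₀ (hT hk).2 hq hqp hrel
    have h1 := h.le_lintegral_sum_bump hlast hF ha hq0.le
      (⨍ y in sVersion s W Q₀, ∑ Q ∈ F, a Q * Q.bump s last y)
    have h2 := hc _ (h.memLp_sum_bump (last := last) F a (ENNReal.ofReal p))
    have h3 := hC F a hF ha
    rw [hleft] at h1
    have h4 : ENNReal.ofReal (K * κ) ≤ ENNReal.ofReal (c * (C * (K * C₁)) ^ (q / p)) := by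
      refine h1.trans (h2.trans ?_)
      rw [ENNReal.ofReal_mul (NNReal.coe_nonneg c), ENNReal.ofReal_coe_nnreal,
        ← ENNReal.ofReal_rpow_of_nonneg (by positivity) (by positivity)]
      gcongr
      exact h3.trans (ENNReal.ofReal_le_ofReal (mul_le_mul_of_nonneg_left hright hC0))
    exact (ENNReal.ofReal_le_ofReal_iff (by positivity)).1 h4
  have hexp : 0 < 1 - q / p := by
    rw [sub_pos, div_lt_one hp0]
    exact hqp
  have htend := (tendsto_rpow_atTop hexp).comp tendsto_natCast_atTop_atTop
  -- Since q < p, the quotient of K by K^(q/p) tends to infinity, against `key`.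
  obtain ⟨K, hK, hK1⟩ := (htend.eventually_gt_atTop (c * (C * C₁) ^ (q / p) / κ)).and (eventually_gt_atTop 0) |>.exists
  have hK0 : (0 : ℝ) < K := by exact_mod_cast hK1
  have h5 := key K
  rw [show C * (K * C₁) = C * C₁ * K by ring, Real.mul_rpow (by positivity) hK0.le] at h5
  simp only [Function.comp_apply] at hK
  rw [div_lt_iff₀ hκ0, Real.rpow_sub hK0, Real.rpow_one, div_mul_eq_mul_div,
    lt_div_iff₀ (by positivity)] at hK
  linarith

end IsApartmentSetting

end Failure

end FracPoincare

theorem proposition6p3 (n : ℕ) (hn : 2 ≤ n)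
    (G : Set (EuclideanSpace ℝ (Fin n))) (hG : FracPoincare.IsJohnDomain 1 G)
    (x₀ : EuclideanSpace ℝ (Fin n)) (hx₀ : FracPoincare.IsJohnCenter 1 G x₀)
    (W : Set (FracPoincare.DyadicCube n)) (hW : FracPoincare.IsWhitneyDecomposition G W)
    (Q₀ : FracPoincare.DyadicCube n) (hQ₀ : Q₀ ∈ W) (hx₀Q₀ : x₀ ∈ Q₀.toSet)
    (s : ℝ) (hs : 1 < s) (hsW : ∀ Q ∈ W, (Q.side / 8) ^ s ≤ Q.side / 32)
    (lam : ℝ) (hlam : (n : ℝ) - 1 ≤ lam) (hlam' : lam < n)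
    (hdim : FracPoincare.upperMinkowskiDim (frontier G) = ENNReal.ofReal lam)
    (hcount : 0 < limsup (fun k : ℕ => ENNReal.ofReal ((2 : ℝ) ^ (-(lam * (k : ℝ)))) *
      (((FracPoincare.cubesOfGen W (k : ℤ)).encard : ℕ∞) : ℝ≥0∞)) atTop)
    (δ τ : ℝ) (hδ : δ ∈ Ioo (0 : ℝ) 1) (hτ : τ ∈ Ioo (0 : ℝ) 1)
    (q p : ℝ) (hq : 1 ≤ q) (hqp : q < p)
    (hrel : 1 - s * (1 - δ) ≤
      (p - q) * (lam - n) / (p * q) + (s - 1) * ((n : ℝ) - 1) / p) :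
    FracPoincare.IsJohnDomain s (FracPoincare.sVersion s W Q₀) ∧
    FracPoincare.upperMinkowskiDim (frontier (FracPoincare.sVersion s W Q₀)) =
      ENNReal.ofReal lam ∧
    ¬ FracPoincare.SupportsFractionalPoincare q p δ τ (FracPoincare.sVersion s W Q₀) := by
  have h : FracPoincare.IsApartmentSetting s G W Q₀ :=
    ⟨hn, hG.isOpen, hG.isBounded, hW, hQ₀, hs, hsW⟩
  exact ⟨h.isJohnDomain_sVersion hx₀ hx₀Q₀, h.upperMinkowskiDim_frontier_sVersion hlam hdim,
    h.not_supportsFractionalPoincare hcount hδ.2 hτ hq hqp hrel⟩
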